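/- Let $k$ be a field of characteristic $0$, $A$ a smooth commutative $k$-algebra of finite type and $W\in A$. Regard $(A,W)$ as a $\mathbb Z/2$-graded curved DG algebra concentrated in even degree, with zero differential and curvature $W$. **Mixed complexes.** A mixed complex $(C,b,B)$ is a $\mathbb Z/2$-graded $k$-vector space with odd operators satisfying $b^2=B^2=bB+Bb=0$; a morphism is an even linear map commuting with $b$ and $B$, and it is a quasi-isomorphism if it induces an isomorphism $\ker b/\operatorname{im} b\to\ker b'/\operatorname{im} b'$. Put $C((u))=\operatorname{colim}_m u^{-m}C[[u]]$. A $u$-connection is a $k$-linear operator $\nabla=\frac{d}{du}+T$ on $C((u))$, with $T$ being $k((u))$-linear, such that $[\nabla,b+uB]=\frac1{2u}(b+uB)$. A weak morphism $(f,H):(C,b,B,\nabla)\to(C',b',B',\nabla')$ is a morphism $f$ of mixed complexes together with an odd $k((u))$-linear map $H:C((u))\to C'((u))$ such that $$\nabla' f-f\nabla=(b'+uB')H+H(b+uB).$$ **Hochschild complex of the second kind.** Let $A^e=A\oplus k\cdot e$ with $e$ a formally added identity, and $$\mathrm{Hoch}^\Pi(A,W)=A\oplus\prod_{n\ge1}A^e\otimes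 A^{\otimes n},$$ where $(a_0,\dots,a_n)$ has parity $n$ (here $a_0\in A^e$ if $n\ge 1$). Its operators are $$b(a_0,\dots,a_n)=\sum_{j=0}^{n-1}(-1)^j(a_0,\dots,a_ja_{j+1},\dots,a_n)+(-1)^n(a_na_0,a_1,\dots,a_{n-1})+\sum_{j=0}^n(-1)^{j+1}(a_0,\dots,a_j,W,a_{j+1},\dots,a_n)$$ (for $n=0$ the first two terms are absent), and $$B(a_0,\dots,a_n)=\sum_{j=0}^n(-1)^{nj}(e,a_{n-j+1},\dots,a_n,a_0,\dots,a_{n-j})\ \text{ if } a_0\in A,\qquad B(e,a_1,\dots,a_n)=0.$$ Put $\Gamma(a_0,\dots,a_n)=-\frac n2(a_0,\dots,a_n)$, $U(a_0,\dots,a_n)=(Wa_0,a_1,\dots,a_n)$, and $$V(a_0,\dots,a_n)=\sum_{0\le p\le j\le n}(-1)^{nj+p}(e,v_{j,p})\ \text{ if } a_0\in A,\qquad V(e,a_1,\dots,a_n)=0,$$ where $v_{j,p}$ is the word $(a_{n-j+1},\dots,a_n,a_0,\dots,a_{n-j})$ with the letter $W$ inserted after its first $p$ letters. Let $$\nabla_u=\frac{d}{du}+\frac{U}{u^2}+\frac{V+\Gamma}{u}.$$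 **Twisted de Rham complex.** Consider $(\Omega^\bullet(A),-dW\wedge,d)$ with $$\nabla_u^{DR}=\frac{d}{du}+\frac{\Gamma}{u}+\frac{W}{u^2},\qquad \Gamma|_{\Omega^p(A)}=-\frac p2\,\mathrm{id}.$$ **Proposition.** Both $(\mathrm{Hoch}^\Pi(A,W),b,B,\nabla_u)$ and $(\Omega^\bullet(A),-dW\wedge,d,\nabla_u^{DR})$ are mixed complexes with $u$-connections. The Hochschild–Kostant–Rosenberg map $$\varepsilon:\mathrm{Hoch}^\Pi(A,W)\to\Omega^\bullet(A),\qquad \varepsilon(a_0,\dots,a_n)=\frac1{n!}\,a_0\,da_1\wedge\dots\wedge da_n$$ (where $e$ acts as $1$) is a quasi-isomorphism of mixed complexes $$(\mathrm{Hoch}^\Pi(A,W),b,B)\to(\Omega^\bullet(A),-dW\wedge,d)$$ and is weakly compatible with the $u$-connections: with the homotopy $$H=-\frac{W\,d}{2u^2}\,\varepsilon,$$ the pair $(\varepsilon,H)$ is a weak morphism. -/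

import Mathlib

/-!
`ℤ/2`-graded mixed complexes with `u`-connections, the Hochschild complex of the second kind of the
curved algebra `(A, W)`, the twisted de Rham mixed complex, and the Hochschild-Kostant-Rosenberg map.
-/

noncomputable section

open scoped TensorProduct

namespace HKR

/-! ### Laurent series with coefficients in a module -/

section Laurent

variable (k : Type*) [Field k]

/-- `C((u)) = colim_m u^{-m} C[[u]]`: Laurent series with coefficients in `C`, a module
over the field `k((u)) = LaurentSeries k`. -/
abbrev Laurent (C : Type*) [AddCommGroup C] [Module k C] : Type _ := HahnModule ℤ k C

/-- The element `r * u ^ m` of `k((u))`. -/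
abbrev uMonomial (m : ℤ) (r : k) : LaurentSeries k := HahnSeries.single m r

variable {C C' : Type*} [AddCommGroup C] [Module k C] [AddCommGroup C'] [Module k C']

/-- The coefficient of `u ^ m`. -/
def uCoeff (m : ℤ) (x : Laurent k C) : C := ((HahnModule.of k).symm x).coeff m

variable {k}

/-- The `k((u))`-linear extension `f((u)) : C((u)) → C'((u))` of `f`, acting coefficientwise. -/
def laurentMap (f : C →ₗ[k] C') : Laurent k C →ₗ[LaurentSeries k] Laurent k C' where
  toFun x := HahnModule.of k (((HahnModule.of k).symm x).map f)
  map_add' x y := by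
    apply HahnModule.ext
    funext m
    simp
  map_smul' r x := by
    apply HahnModule.ext
    funext m
    have hs : ((HahnModule.of k).symm
        (HahnModule.of k (((HahnModule.of k).symm x).map f))).support ⊆
        ((HahnModule.of k).symm x).support := by
      intro i hi
      simp only [Equiv.symm_apply_apply, HahnSeries.mem_support, HahnSeries.map_coeff] at hi ⊢
      intro h0
      exact hi (by rw [h0, map_zero])
    simp only [RingHom.id_apply]
    rw [HahnModule.coeff_smul_right ((HahnModule.of k).symm x).isPWO_support hs]
    simp only [Equiv.symm_apply_apply, HahnSeries.map_coeff, HahnModule.coeff_smul, map_sum,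
      map_smul]

/-- Formal differentiation `d/du` on `C((u))`. -/
def uDeriv : Laurent k C →ₗ[k] Laurent k C where
  toFun x := HahnModule.of k (LaurentSeries.derivative k ((HahnModule.of k).symm x))
  map_add' x y := by
    apply HahnModule.ext
    funext m
    simp
  map_smul' r x :=
    (LaurentSeries.derivative k (V := C)).map_smul r ((HahnModule.of k).symm x)

end Laurent

/-! ### Mixed complexes, quasi-isomorphisms, connections, weak morphisms -/

section Mixed

variable {k : Type*} [Field k]
variable {C C' : Type*} [AddCommGroup C] [Module k C] [AddCommGroup C'] [Module k C']

/-- `(C, b, B)` is a mixed complex, where `C` is `ℤ/2`-graded by `𝒞`. -/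
structure IsMixedComplex (𝒞 : ZMod 2 → Submodule k C) (b B : C →ₗ[k] C) : Prop where
  isInternal : DirectSum.IsInternal 𝒞
  b_odd : ∀ i, ∀ x ∈ 𝒞 i, b x ∈ 𝒞 (i + 1)
  B_odd : ∀ i, ∀ x ∈ 𝒞 i, B x ∈ 𝒞 (i + 1)
  b_sq : b ∘ₗ b = 0
  B_sq : B ∘ₗ B = 0
  anticomm : b ∘ₗ B + B ∘ₗ b = 0

/-- `f` is a morphism of mixed complexes `(C, b, B) → (C', b', B')`. -/
structure IsMixedMorphism (𝒞 : ZMod 2 → Submodule k C) (b B : C →ₗ[k] C)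
    (𝒞' : ZMod 2 → Submodule k C') (b' B' : C' →ₗ[k] C') (f : C →ₗ[k] C') : Prop where
  even : ∀ i, ∀ x ∈ 𝒞 i, f x ∈ 𝒞' i
  comm_b : b' ∘ₗ f = f ∘ₗ b
  comm_B : B' ∘ₗ f = f ∘ₗ B

/-- The (total) cohomology `ker b / im b` of a square-zero endomorphism `b`. -/
abbrev Cohomology (b : C →ₗ[k] C) : Type _ :=
  LinearMap.ker b ⧸ (LinearMap.range b).submoduleOf (LinearMap.ker b)

/-- The map on cohomology induced by a map commuting with the differentials. -/
def cohomologyMap (b : C →ₗ[k] C) (b' : C' →ₗ[k] C') (f : C →ₗ[k] C')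
    (h : b' ∘ₗ f = f ∘ₗ b) : Cohomology b →ₗ[k] Cohomology b' :=
  Submodule.mapQ _ _
    (f.restrict (p := LinearMap.ker b) (q := LinearMap.ker b') (by
      intro x hx
      have := LinearMap.congr_fun h x
      simp only [LinearMap.comp_apply] at this
      rw [LinearMap.mem_ker] at hx ⊢
      rw [this, hx, map_zero]))
    (by
      rintro ⟨x, hx⟩ ⟨y, hy⟩
      exact ⟨f y, by
        have := LinearMap.congr_fun h y
        simp only [LinearMap.comp_apply] at this
        rw [this, hy]
        rfl⟩)

/-- `f` is a quasi-isomorphism of complexes `(C, b) → (C', b')`. -/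
def IsQuasiIso (b : C →ₗ[k] C) (b' : C' →ₗ[k] C') (f : C →ₗ[k] C') : Prop :=
  ∃ h : b' ∘ₗ f = f ∘ₗ b, Function.Bijective (cohomologyMap b b' f h)

/-- The differential `b + u B` on `C((u))`. -/
def totalDiff (b B : C →ₗ[k] C) : Laurent k C →ₗ[LaurentSeries k] Laurent k C :=
  laurentMap b + uMonomial k 1 1 • laurentMap B

/-- `∇` is a `u`-connection on `(C, b, B)`: it is `d/du` plus a `k((u))`-linear operator, and
`[∇, b + uB] = (1/2u) (b + uB)`. -/
structure IsUConnection (b B : C →ₗ[k] C) (nabla : Laurent k C →ₗ[k] Laurent k C) : Prop where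
  form : ∃ T : Laurent k C →ₗ[LaurentSeries k] Laurent k C, ∀ x, nabla x = uDeriv x + T x
  commutator : ∀ x, nabla (totalDiff b B x) - totalDiff b B (nabla x) =
    uMonomial k (-1) (1 / 2) • totalDiff b B x

/-- `(f, H)` is a weak morphism `(C, b, B, ∇) → (C', b', B', ∇')`: `f` is a morphism of mixed
complexes and the odd `k((u))`-linear operator `H` satisfies
`∇' f((u)) - f((u)) ∇ = (b' + uB') H + H (b + uB)`. -/
structure IsWeakMorphism (𝒞 : ZMod 2 → Submodule k C) (b B : C →ₗ[k] C)
    (nabla : Laurent k C →ₗ[k] Laurent k C)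
    (𝒞' : ZMod 2 → Submodule k C') (b' B' : C' →ₗ[k] C')
    (nabla' : Laurent k C' →ₗ[k] Laurent k C')
    (f : C →ₗ[k] C') (H : Laurent k C →ₗ[LaurentSeries k] Laurent k C') : Prop where
  morphism : IsMixedMorphism 𝒞 b B 𝒞' b' B' f
  odd : ∀ i x, (∀ m, uCoeff k m x ∈ 𝒞 i) → ∀ m, uCoeff k m (H x) ∈ 𝒞' (i + 1)
  homotopy : ∀ x, nabla' (laurentMap f x) - laurentMap f (nabla x) =
    totalDiff b' B' (H x) + H (totalDiff b B x)

end Mixed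

/-! ### The Hochschild complex of the second kind of `(A, W)`

All of `A` is even, the differential of the curved algebra is zero, the curvature is `W`. Put
`A^e = A ⊕ k e`, where `e` is a formally added identity. The Hochschild complex of the second kind
is `A ⊕ ∏_{n ≥ 1} A^e ⊗ A^{⊗ n}`. Since `A^e ⊗ A^{⊗ n} = A^{⊗ (n+1)} ⊕ e ⊗ A^{⊗ n}`, it is the
product of

* the tensors `(a_0, …, a_n)`, `n ≥ 0`, of Hochschild degree `n`;
* the tensors `(e, a_0, …, a_n)`, `n ≥ 0`, of Hochschild degree `n + 1`.

The formulas below are the usual ones for tensors `(x_0, …, x_n)` with `x_0 ∈ A^e`, written out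
in these two cases. -/

section Hochschild

variable (k : Type*) [Field k] (A : Type*) [CommRing A] [Algebra k A]

/-- The tensor power `A^{⊗ (n+1)}`, spanned by the words `(a_0, …, a_n)`. -/
abbrev Word (n : ℕ) : Type _ := ⨂[k] _ : Fin (n + 1), A

/-- The space underlying the Hochschild complex of the second kind: an element is a pair `(x, y)`
where `x n` is a combination of words `(a_0, …, a_n)` and `y n` stands for a combination of
words `(e, a_0, …, a_n)`. -/
abbrev HochPi : Type _ := (∀ n, Word k A n) × (∀ n, Word k A n)

/-- The words of Hochschild degree congruent to `i` modulo `2`. -/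
def hochParity (i : ZMod 2) : Submodule k (HochPi k A) where
  carrier := {x | (∀ n : ℕ, (n : ZMod 2) ≠ i → x.1 n = 0) ∧
    ∀ n : ℕ, ((n + 1 : ℕ) : ZMod 2) ≠ i → x.2 n = 0}
  zero_mem' := ⟨fun _ _ => rfl, fun _ _ => rfl⟩
  add_mem' := fun {x y} hx hy =>
    ⟨fun n hn => by simp [hx.1 n hn, hy.1 n hn], fun n hn => by simp [hx.2 n hn, hy.2 n hn]⟩
  smul_mem' := fun r x hx =>
    ⟨fun n hn => by simp [hx.1 n hn], fun n hn => by simp [hx.2 n hn]⟩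

variable {A}

lemma exists_contractNth_update {n : ℕ} (j : Fin (n + 1)) (a : Fin (n + 2) → A)
    (p : Fin (n + 2)) : ∃ (q : Fin (n + 1)) (g : A →ₗ[k] A), ∀ z : A,
      Fin.contractNth j.castSucc (· * ·) (Function.update a p z) =
        Function.update (Fin.contractNth j.castSucc (· * ·) a) q (g z) := by
  rcases lt_trichotomy (p : ℕ) (j : ℕ) with h | h | h
  · refine ⟨⟨p, by omega⟩, LinearMap.id, fun z => ?_⟩
    funext i
    simp only [Fin.contractNth, Function.update_apply, Fin.ext_iff, Fin.val_castSucc, Fin.val_succ,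
      LinearMap.id_apply]
    split_ifs <;> first | rfl | omega
  · refine ⟨j, LinearMap.mulRight k (a j.succ), fun z => ?_⟩
    funext i
    simp only [Fin.contractNth, Function.update_apply, Fin.ext_iff, Fin.val_castSucc, Fin.val_succ,
      LinearMap.mulRight_apply]
    split_ifs <;> first | rfl | omega | skip
    have : i = j := Fin.ext (by assumption)
    rw [this]
  · rcases Nat.lt_or_ge (j + 1 : ℕ) (p : ℕ) with h' | h'
    · refine ⟨⟨p - 1, by omega⟩, LinearMap.id, fun z => ?_⟩
      funext i
      simp only [Fin.contractNth, Function.update_apply, Fin.ext_iff, Fin.val_castSucc,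
        Fin.val_succ, LinearMap.id_apply]
      split_ifs <;> first | rfl | omega
    · refine ⟨j, LinearMap.mulLeft k (a j.castSucc), fun z => ?_⟩
      funext i
      simp only [Fin.contractNth, Function.update_apply, Fin.ext_iff, Fin.val_castSucc,
        Fin.val_succ, LinearMap.mulLeft_apply]
      split_ifs <;> first | rfl | omega | skip
      have : i = j := Fin.ext (by assumption)
      rw [this]

/-- `(a_0, …, a_{n+1}) ↦ (a_0, …, a_j a_{j+1}, …, a_{n+1})`. -/
def merge {n : ℕ} (j : Fin (n + 1)) : Word k A (n + 1) →ₗ[k] Word k A n :=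
  PiTensorProduct.lift
    { toFun := fun a => PiTensorProduct.tprod k (Fin.contractNth j.castSucc (· * ·) a)
      map_update_add' := by
        intro inst a p x y
        rw [Subsingleton.elim inst (instDecidableEqFin _)]
        obtain ⟨q, g, h⟩ := exists_contractNth_update k j a p
        rw [h, h, h, map_add, MultilinearMap.map_update_add]
      map_update_smul' := by
        intro inst a p r x
        rw [Subsingleton.elim inst (instDecidableEqFin _)]
        obtain ⟨q, g, h⟩ := exists_contractNth_update k j a p
        rw [h, h, map_smul, MultilinearMap.map_update_smul] }

/-- `(a_0, …, a_n) ↦ (a_{n-j+1}, …, a_n, a_0, …, a_{n-j})`, rotation by `j` places. -/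
def rotate {n : ℕ} (j : Fin (n + 1)) : Word k A n →ₗ[k] Word k A n :=
  (PiTensorProduct.reindex k (fun _ : Fin (n + 1) => A) (Equiv.addRight j)).toLinearMap

/-- Insertion of the element `w` so that it becomes the letter at place `p`
(places are numbered from `0`). -/
def insertAt (w : A) {n : ℕ} (p : Fin (n + 2)) : Word k A n →ₗ[k] Word k A (n + 1) :=
  PiTensorProduct.lift
    ((PiTensorProduct.tprod k (s := fun _ : Fin (n + 2) => A)).curryMid p w)

@[simp]
lemma merge_tprod {n : ℕ} (j : Fin (n + 1)) (a : Fin (n + 2) → A) :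
    merge k j (PiTensorProduct.tprod k a) =
      PiTensorProduct.tprod k (Fin.contractNth j.castSucc (· * ·) a) :=
  PiTensorProduct.lift.tprod a

@[simp]
lemma rotate_tprod {n : ℕ} (j : Fin (n + 1)) (a : Fin (n + 1) → A) :
    rotate k j (PiTensorProduct.tprod k a) = PiTensorProduct.tprod k fun i => a (i - j) := by
  rw [rotate, LinearEquiv.coe_coe, PiTensorProduct.reindex_tprod]
  simp [sub_eq_add_neg]

@[simp]
lemma insertAt_tprod (w : A) {n : ℕ} (p : Fin (n + 2)) (a : Fin (n + 1) → A) :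
    insertAt k w p (PiTensorProduct.tprod k a) =
      PiTensorProduct.tprod k (p.insertNth (α := fun _ => A) w a) :=
  PiTensorProduct.lift.tprod a

variable {k}

/-- Apply `φ n` in every degree `n`. -/
def level (φ : ∀ n, Word k A n →ₗ[k] Word k A n) : (∀ n, Word k A n) →ₗ[k] ∀ n, Word k A n :=
  LinearMap.pi fun n => φ n ∘ₗ LinearMap.proj n

/-- A family of maps lowering the length of words by one, on products. -/
def lower (φ : ∀ n, Word k A (n + 1) →ₗ[k] Word k A n) :
    (∀ n, Word k A n) →ₗ[k] ∀ n, Word k A n :=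
  LinearMap.pi fun n => φ n ∘ₗ LinearMap.proj (n + 1)

/-- A family of maps raising the length of words by one, on products. -/
def raise (φ : ∀ n, Word k A n →ₗ[k] Word k A (n + 1)) :
    (∀ n, Word k A n) →ₗ[k] ∀ n, Word k A n :=
  LinearMap.pi fun n => match n with
    | 0 => 0
    | m + 1 => φ m ∘ₗ LinearMap.proj m

variable (k A)

/-- The projection to the words with first letter in `A`. -/
abbrev fstPart : HochPi k A →ₗ[k] ∀ n, Word k A n := LinearMap.fst k _ _

/-- The projection to the words with first letter `e`. -/
abbrev sndPart : HochPi k A →ₗ[k] ∀ n, Word k A n := LinearMap.snd k _ _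

/-- The part of the Hochschild differential given by the product of `A`:
`(x_0, …, x_n) ↦ ∑_{0 ≤ j < n} (-1)^j (x_0, …, x_j x_{j+1}, …, x_n)
  + (-1)^n (x_n x_0, x_1, …, x_{n-1})` for `n ≥ 1`, and `0` for `n = 0`.
For `x_0 = e` this is
`(e, a_0, …, a_n) ↦ (a_0, …, a_n) + (-1)^{n+1} (a_n, a_0, …, a_{n-1})
  + ∑_{0 ≤ j < n} (-1)^{j+1} (e, a_0, …, a_j a_{j+1}, …, a_n)`. -/
def hochBProduct : HochPi k A →ₗ[k] HochPi k A :=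
  LinearMap.prod
    (lower (fun n => (∑ j : Fin (n + 1), (-1 : k) ^ (j : ℕ) • merge k j)
        + (-1 : k) ^ (n + 1) • (merge k 0 ∘ₗ rotate k 1)) ∘ₗ fstPart k A
      + level (fun n => LinearMap.id + (-1 : k) ^ (n + 1) • rotate k 1)
        ∘ₗ sndPart k A)
    (lower (fun n => ∑ j : Fin (n + 1), (-1 : k) ^ ((j : ℕ) + 1) • merge k j) ∘ₗ sndPart k A)

variable {A}

/-- The part of the Hochschild differential given by the curvature `W`:
`(x_0, …, x_n) ↦ ∑_{0 ≤ j ≤ n} (-1)^{j+1} (x_0, …, x_j, W, x_{j+1}, …, x_n)`. -/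
def hochBCurvature (W : A) : HochPi k A →ₗ[k] HochPi k A :=
  LinearMap.prod
    (raise (fun n => ∑ j : Fin (n + 1), (-1 : k) ^ ((j : ℕ) + 1) • insertAt k W j.succ)
      ∘ₗ fstPart k A)
    (raise (fun n => ∑ p : Fin (n + 2), (-1 : k) ^ ((p : ℕ) + 1) • insertAt k W p) ∘ₗ sndPart k A)

/-- The Hochschild differential of `(A, W)`. -/
def hochb (W : A) : HochPi k A →ₗ[k] HochPi k A := hochBProduct k A + hochBCurvature k W

variable (A)

/-- The Connes differential
`(a_0, …, a_n) ↦ ∑_{0 ≤ j ≤ n} (-1)^{nj} (e, a_{n-j+1}, …, a_n, a_0, …, a_{n-j})`,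
which vanishes on the words with first letter `e`. -/
def hochConnes : HochPi k A →ₗ[k] HochPi k A :=
  LinearMap.prod 0
    (level (fun n => ∑ j : Fin (n + 1), (-1 : k) ^ (n * (j : ℕ)) • rotate k j) ∘ₗ fstPart k A)

/-- `Γ`, the multiplication by `-n/2` in Hochschild degree `n`. -/
def hochGamma : HochPi k A →ₗ[k] HochPi k A :=
  LinearMap.prod
    (level (fun n => (-((n : k) / 2)) • LinearMap.id) ∘ₗ fstPart k A)
    (level (fun n => (-(((n + 1 : ℕ) : k) / 2)) • LinearMap.id) ∘ₗ sndPart k A)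

variable {A}

/-- `U : (x_0, …, x_n) ↦ (W x_0, x_1, …, x_n)`; so `(e, a_0, …, a_n) ↦ (W, a_0, …, a_n)`. -/
def hochU (W : A) : HochPi k A →ₗ[k] HochPi k A :=
  LinearMap.prod
    (level (fun _ => merge k 0 ∘ₗ insertAt k W 0) ∘ₗ fstPart k A
      + raise (fun _ => insertAt k W 0) ∘ₗ sndPart k A)
    0

/-- `V : (a_0, …, a_n) ↦ ∑_{0 ≤ p ≤ j ≤ n} (-1)^{nj+p} (e, v_{j,p})`, where `v_{j,p}` is the word
`(a_{n-j+1}, …, a_n, a_0, …, a_{n-j})` with `W` inserted at place `p`; `V` vanishes on the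
words with first letter `e`. -/
def hochV (W : A) : HochPi k A →ₗ[k] HochPi k A :=
  LinearMap.prod 0
    (raise (fun n => ∑ j : Fin (n + 1), ∑ p ∈ Finset.univ.filter (fun p : Fin (n + 2) => (p : ℕ) ≤ (j : ℕ)),
      (-1 : k) ^ (n * (j : ℕ) + (p : ℕ)) • (insertAt k W p ∘ₗ rotate k j)) ∘ₗ fstPart k A)

/-- The `u`-connection `d/du + U/u² + (V + Γ)/u` on the Hochschild complex of `(A, W)`. -/
def hochNabla (W : A) : Laurent k (HochPi k A) →ₗ[k] Laurent k (HochPi k A) :=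
  uDeriv + (uMonomial k (-2) 1 • laurentMap (hochU k W)
    + uMonomial k (-1) 1 • laurentMap (hochV k W + hochGamma k A)).restrictScalars k

end Hochschild

/-! ### The twisted de Rham mixed complex -/

section DeRham

variable (k : Type*) [Field k] (A : Type*) [CommRing A] [Algebra k A]

/-- `Ω^•(A)`, the exterior algebra over `A` of the module of Kähler differentials. -/
abbrev Forms : Type _ := ExteriorAlgebra A (KaehlerDifferential k A)

variable {A} in
/-- The one-form `da` as an element of `Ω^•(A)`. -/
def dForm (a : A) : Forms k A := ExteriorAlgebra.ι A (KaehlerDifferential.D k A a)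

variable {A} in
lemma dForm_add (a b : A) : dForm k (a + b) = dForm k a + dForm k b := by
  simp [dForm]

variable {A} in
lemma dForm_smul (r : k) (a : A) : dForm k (r • a) = r • dForm k a := by
  rw [dForm, Derivation.map_smul]
  exact ((ExteriorAlgebra.ι A).restrictScalars k).map_smul r _

variable {A} in
lemma dForm_mul (a b : A) : dForm k (a * b) = a • dForm k b + b • dForm k a := by
  simp [dForm]

variable {A} in
lemma dForm_anticomm (a b : A) : dForm k a * dForm k b = -(dForm k b * dForm k a) := by
  rw [eq_neg_iff_add_eq_zero]
  exact ExteriorAlgebra.ι_add_mul_swap _ _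

/-! The de Rham differential `d` is constructed from the algebra homomorphism which sends a form
`ω` to the matrix with rows `(± ω, d ω)` and `(0, ω)`, the sign being the parity of `ω`. On
functions and exact one-forms it is given by `diagFun` and `diagForm`. -/

/-- `a ↦ !![a, da; 0, a]`. -/
def diagFun : A →+* Matrix (Fin 2) (Fin 2) (Forms k A) where
  toFun a := !![algebraMap A _ a, dForm k a; 0, algebraMap A _ a]
  map_one' := by
    ext i j
    fin_cases i <;> fin_cases j <;> simp [dForm]
  map_zero' := by
    ext i j
    fin_cases i <;> fin_cases j <;> simp [dForm]
  map_add' a b := by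
    ext i j
    fin_cases i <;> fin_cases j <;> simp [dForm]
  map_mul' a b := by
    have h : dForm k a * algebraMap A (Forms k A) b = algebraMap A (Forms k A) b * dForm k a :=
      (Algebra.commutes b (dForm k a)).symm
    rw [Matrix.mul_fin_two, dForm_mul, map_mul, Algebra.smul_def, Algebra.smul_def, h]
    simp

/-- The matrices commuting with the matrices `diagFun k A a`. -/
def MatAlg : Type _ := Subalgebra.centralizer k (Set.range (diagFun k A))

instance : Ring (MatAlg k A) :=
  inferInstanceAs (Ring (Subalgebra.centralizer k (Set.range (diagFun k A))))

instance : Algebra k (MatAlg k A) :=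
  inferInstanceAs (Algebra k (Subalgebra.centralizer k (Set.range (diagFun k A))))

/-- The matrix underlying an element of `MatAlg k A`. -/
def MatAlg.mat : MatAlg k A →ₐ[k] Matrix (Fin 2) (Fin 2) (Forms k A) :=
  (Subalgebra.centralizer k (Set.range (diagFun k A))).val

lemma MatAlg.mat_injective : Function.Injective (MatAlg.mat k A) := Subtype.val_injective

lemma MatAlg.mat_commute (a : A) (x : MatAlg k A) :
    diagFun k A a * MatAlg.mat k A x = MatAlg.mat k A x * diagFun k A a :=
  (Subalgebra.mem_centralizer_iff k).1 x.2 _ ⟨a, rfl⟩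

/-- `diagFun` as a map to `MatAlg k A`. -/
def funToMatAlg : A →+* MatAlg k A where
  toFun a := ⟨diagFun k A a, by
    rw [Subalgebra.mem_centralizer_iff]
    rintro _ ⟨b, rfl⟩
    rw [← map_mul, ← map_mul, mul_comm]⟩
  map_one' := Subtype.ext (map_one (diagFun k A))
  map_zero' := Subtype.ext (map_zero (diagFun k A))
  map_add' a b := Subtype.ext (map_add (diagFun k A) a b)
  map_mul' a b := Subtype.ext (map_mul (diagFun k A) a b)

instance : Algebra A (MatAlg k A) :=
  RingHom.toAlgebra' (funToMatAlg k A) fun a x =>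
    MatAlg.mat_injective k A (MatAlg.mat_commute k A a x)

lemma MatAlg.mat_smul (a : A) (x : MatAlg k A) :
    MatAlg.mat k A (a • x) = diagFun k A a * MatAlg.mat k A x := by
  rw [Algebra.smul_def]
  rfl

instance : IsScalarTower k A (MatAlg k A) :=
  IsScalarTower.of_algebraMap_eq fun r => by
    apply MatAlg.mat_injective k A
    rw [AlgHom.commutes]
    change _ = diagFun k A (algebraMap k A r)
    ext i j
    fin_cases i <;> fin_cases j <;>
      simp [diagFun, dForm, Matrix.algebraMap_matrix_apply, IsScalarTower.algebraMap_apply k A (Forms k A)]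

/-- `b ↦ !![-db, 0; 0, db]`. -/
def diagForm (b : A) : MatAlg k A :=
  ⟨!![-dForm k b, 0; 0, dForm k b], by
    rw [Subalgebra.mem_centralizer_iff]
    rintro _ ⟨a, rfl⟩
    have h : dForm k b * algebraMap A (Forms k A) a = algebraMap A (Forms k A) a * dForm k b :=
      (Algebra.commutes a (dForm k b)).symm
    change !![_, _; _, _] * _ = _ * !![_, _; _, _]
    rw [Matrix.mul_fin_two, Matrix.mul_fin_two, neg_mul, h, dForm_anticomm k a b]
    simp⟩

lemma mat_diagForm (b : A) :
    MatAlg.mat k A (diagForm k A b) = !![-dForm k b, 0; 0, dForm k b] := rfl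

/-- `diagForm` as a derivation. -/
def diagFormDer : Derivation k A (MatAlg k A) :=
  Derivation.mk'
    { toFun := diagForm k A
      map_add' := fun a b => MatAlg.mat_injective k A (by
        rw [map_add]
        ext i j
        fin_cases i <;> fin_cases j <;> simp [mat_diagForm, dForm_add, add_comm])
      map_smul' := fun r a => MatAlg.mat_injective k A (by
        rw [map_smul]
        ext i j
        fin_cases i <;> fin_cases j <;> simp [mat_diagForm, dForm_smul]) }
    fun a b => MatAlg.mat_injective k A (by
      rw [map_add, MatAlg.mat_smul, MatAlg.mat_smul]
      change MatAlg.mat k A (diagForm k A (a * b)) = diagFun k A a * MatAlg.mat k A (diagForm k A b)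
        + diagFun k A b * MatAlg.mat k A (diagForm k A a)
      rw [mat_diagForm, mat_diagForm, mat_diagForm]
      change _ = !![_, _; _, _] * _ + !![_, _; _, _] * _
      rw [Matrix.mul_fin_two, Matrix.mul_fin_two, dForm_mul, Algebra.smul_def, Algebra.smul_def]
      rw [dForm_anticomm k a b]
      ext i j
      (fin_cases i <;> fin_cases j <;> simp); abel)

/-- The `A`-linear extension of `diagForm` to one-forms. -/
def oneFormToMatAlg : KaehlerDifferential k A →ₗ[A] MatAlg k A :=
  (diagFormDer k A).liftKaehlerDifferential

lemma oneFormToMatAlg_D (a : A) :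
    oneFormToMatAlg k A (KaehlerDifferential.D k A a) = diagForm k A a :=
  (diagFormDer k A).liftKaehlerDifferential_comp_D a

lemma diagForm_mul_swap (a b : A) :
    diagForm k A a * diagForm k A b + diagForm k A b * diagForm k A a = 0 :=
  MatAlg.mat_injective k A (by
    rw [map_add, map_mul, map_mul, map_zero, mat_diagForm, mat_diagForm, Matrix.mul_fin_two,
      Matrix.mul_fin_two]
    ext i j
    fin_cases i <;> fin_cases j <;> simp [dForm_anticomm k a b])

lemma oneFormToMatAlg_mul_swap (x y : KaehlerDifferential k A) :
    oneFormToMatAlg k A x * oneFormToMatAlg k A y +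
      oneFormToMatAlg k A y * oneFormToMatAlg k A x = 0 := by
  have hx : x ∈ Submodule.span A (Set.range (KaehlerDifferential.D k A)) := by
    rw [KaehlerDifferential.span_range_derivation]; trivial
  have hy : y ∈ Submodule.span A (Set.range (KaehlerDifferential.D k A)) := by
    rw [KaehlerDifferential.span_range_derivation]; trivial
  induction hx using Submodule.span_induction with
  | mem x hx =>
    obtain ⟨a, rfl⟩ := hx
    induction hy using Submodule.span_induction with
    | mem y hy =>
      obtain ⟨b, rfl⟩ := hy
      rw [oneFormToMatAlg_D, oneFormToMatAlg_D, diagForm_mul_swap]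
    | zero => simp
    | add u v _ _ hu hv =>
      rw [map_add, mul_add, add_mul, add_add_add_comm, hu, hv, add_zero]
    | smul r u _ hu => rw [map_smul, mul_smul_comm, smul_mul_assoc, ← smul_add, hu, smul_zero]
  | zero => simp
  | add u v _ _ hu hv =>
    rw [map_add, mul_add, add_mul, add_add_add_comm, hu, hv, add_zero]
  | smul r u _ hu => rw [map_smul, mul_smul_comm, smul_mul_assoc, ← smul_add, hu, smul_zero]

lemma oneFormToMatAlg_sq (x : KaehlerDifferential k A) :
    oneFormToMatAlg k A x * oneFormToMatAlg k A x = 0 := by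
  have hx : x ∈ Submodule.span A (Set.range (KaehlerDifferential.D k A)) := by
    rw [KaehlerDifferential.span_range_derivation]; trivial
  induction hx using Submodule.span_induction with
  | mem x hx =>
    obtain ⟨a, rfl⟩ := hx
    rw [oneFormToMatAlg_D]
    apply MatAlg.mat_injective k A
    rw [map_mul, map_zero]
    ext i j
    fin_cases i <;> fin_cases j <;> simp [mat_diagForm, Matrix.mul_apply, dForm]
  | zero => simp
  | add u v _ _ hu hv =>
    have := oneFormToMatAlg_mul_swap k A u v
    rw [map_add, mul_add, add_mul, add_mul, hu, hv, zero_add, add_zero, add_comm, this]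
  | smul r u _ hu => rw [map_smul, mul_smul_comm, smul_mul_assoc, hu, smul_zero, smul_zero]

/-- The algebra homomorphism `ω ↦ !![± ω, d ω; 0, ω]`. -/
def formToMatAlg : Forms k A →ₐ[A] MatAlg k A :=
  ExteriorAlgebra.lift A ⟨oneFormToMatAlg k A, oneFormToMatAlg_sq k A⟩

/-- The de Rham differential `d : Ω^•(A) → Ω^•(A)`; see `deRham_algebraMap_mul_prod`. -/
def deRham : Forms k A →ₗ[k] Forms k A where
  toFun ω := MatAlg.mat k A (formToMatAlg k A ω) 0 1
  map_add' ω η := by simp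
  map_smul' r ω := by
    rw [← algebraMap_smul A r ω, map_smul, algebraMap_smul, map_smul]
    rfl

lemma mat_formToMatAlg_dForm_mul (a : A) (ω : Forms k A) :
    MatAlg.mat k A (formToMatAlg k A (dForm k a * ω)) =
      !![-dForm k a, 0; 0, dForm k a] * MatAlg.mat k A (formToMatAlg k A ω) := by
  rw [map_mul, map_mul, formToMatAlg, dForm, ExteriorAlgebra.lift_ι_apply, oneFormToMatAlg_D,
    mat_diagForm]
  rfl

/-- `d (db ∧ ω) = - db ∧ d ω`. -/
lemma deRham_dForm_mul (b : A) (ω : Forms k A) :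
    deRham k A (dForm k b * ω) = -(dForm k b * deRham k A ω) := by
  change MatAlg.mat k A (formToMatAlg k A (dForm k b * ω)) 0 1 = _
  rw [mat_formToMatAlg_dForm_mul]
  simp [Matrix.mul_apply, deRham]

lemma formToMatAlg_one_one (l : List A) :
    MatAlg.mat k A (formToMatAlg k A (l.map (dForm k)).prod) 1 1 = (l.map (dForm k)).prod := by
  induction l with
  | nil => simp
  | cons b l ih =>
    rw [List.map_cons, List.prod_cons, mat_formToMatAlg_dForm_mul, Matrix.mul_apply]
    simp [ih]

lemma deRham_prod (l : List A) : deRham k A (l.map (dForm k)).prod = 0 := by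
  induction l with
  | nil => simp [deRham]
  | cons b l ih => rw [List.map_cons, List.prod_cons, deRham_dForm_mul, ih, mul_zero, neg_zero]

/-- The formula characterizing the de Rham differential:
`d (a_0 da_1 ∧ … ∧ da_n) = da_0 ∧ da_1 ∧ … ∧ da_n`. -/
lemma deRham_algebraMap_mul_prod (a : A) (l : List A) :
    deRham k A (algebraMap A (Forms k A) a * (l.map (dForm k)).prod) =
      dForm k a * (l.map (dForm k)).prod := by
  rw [← Algebra.smul_def]
  change MatAlg.mat k A (formToMatAlg k A (a • (l.map (dForm k)).prod)) 0 1 = _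
  have h := deRham_prod k A l
  change MatAlg.mat k A (formToMatAlg k A (l.map (dForm k)).prod) 0 1 = 0 at h
  rw [map_smul, MatAlg.mat_smul, Matrix.mul_apply, Fin.sum_univ_two, h, formToMatAlg_one_one]
  simp [diagFun]

/-- The forms of degree congruent to `i` modulo `2`. -/
def formParity (i : ZMod 2) : Submodule k (Forms k A) :=
  ⨆ (p : ℕ) (_ : (p : ZMod 2) = i),
    (⋀[A]^p (KaehlerDifferential k A)).restrictScalars k

variable {A} in
/-- The operator `ω ↦ - dW ∧ ω`. -/
def twist (W : A) : Forms k A →ₗ[k] Forms k A := -LinearMap.mulLeft k (dForm k W)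

/-- `Γ`, the multiplication by `-p/2` on `Ω^p(A)`. -/
def formGamma : Forms k A →ₗ[k] Forms k A :=
  ((DirectSum.toModule A ℕ (Forms k A) fun p =>
      algebraMap k A (-((p : k) / 2)) • (⋀[A]^p (KaehlerDifferential k A)).subtype) ∘ₗ
    (DirectSum.decomposeLinearEquiv
      fun p => ⋀[A]^p (KaehlerDifferential k A)).toLinearMap).restrictScalars k

variable {A} in
/-- Multiplication by the function `W` on forms. -/
def mulFun (W : A) : Forms k A →ₗ[k] Forms k A :=
  LinearMap.mulLeft k (algebraMap A (Forms k A) W)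

variable {A} in
/-- The `u`-connection `d/du + Γ/u + W/u²` on the twisted de Rham complex. -/
def formNabla (W : A) : Laurent k (Forms k A) →ₗ[k] Laurent k (Forms k A) :=
  uDeriv + (uMonomial k (-1) 1 • laurentMap (formGamma k A)
    + uMonomial k (-2) 1 • laurentMap (mulFun k W)).restrictScalars k

end DeRham

/-! ### The Hochschild-Kostant-Rosenberg map -/

section Map

variable (k : Type*) [Field k] (A : Type*) [CommRing A] [Algebra k A]

/-- `a ↦ a`, as a `k`-linear map from `A` to `Ω^•(A)`. -/
def funLin : A →ₗ[k] Forms k A := (Algebra.linearMap A (Forms k A)).restrictScalars k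

/-- `a ↦ da`, as a `k`-linear map from `A` to `Ω^•(A)`. -/
def dFormLin : A →ₗ[k] Forms k A :=
  (ExteriorAlgebra.ι A).restrictScalars k ∘ₗ (KaehlerDifferential.D k A).toLinearMap

/-- `(a_0, …, a_n) ↦ (1/n!) a_0 da_1 ∧ … ∧ da_n`. -/
def hkrWord (n : ℕ) : Word k A n →ₗ[k] Forms k A :=
  (1 / (n.factorial : k)) • PiTensorProduct.lift
    ((MultilinearMap.mkPiAlgebraFin k (n + 1) (Forms k A)).compLinearMap
      (Fin.cons (funLin k A) fun _ : Fin n => dFormLin k A))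

/-- `(e, a_0, …, a_n) ↦ (1/(n+1)!) da_0 ∧ … ∧ da_n`. -/
def hkrUnitWord (n : ℕ) : Word k A n →ₗ[k] Forms k A :=
  (1 / ((n + 1).factorial : k)) • PiTensorProduct.lift
    ((MultilinearMap.mkPiAlgebraFin k (n + 1) (Forms k A)).compLinearMap
      fun _ : Fin (n + 1) => dFormLin k A)

lemma hkrWord_tprod (n : ℕ) (a : Fin (n + 1) → A) :
    hkrWord k A n (PiTensorProduct.tprod k a) = (1 / (n.factorial : k)) •
      (algebraMap A (Forms k A) (a 0) *
        ExteriorAlgebra.ιMulti A n fun i => KaehlerDifferential.D k A (a i.succ)) := by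
  rw [hkrWord, LinearMap.smul_apply, PiTensorProduct.lift.tprod,
    MultilinearMap.compLinearMap_apply, MultilinearMap.mkPiAlgebraFin_apply, List.ofFn_succ,
    List.prod_cons, ExteriorAlgebra.ιMulti_apply]
  rfl

lemma hkrUnitWord_tprod (n : ℕ) (a : Fin (n + 1) → A) :
    hkrUnitWord k A n (PiTensorProduct.tprod k a) = (1 / ((n + 1).factorial : k)) •
      ExteriorAlgebra.ιMulti A (n + 1) fun i => KaehlerDifferential.D k A (a i) := by
  rw [hkrUnitWord, LinearMap.smul_apply, PiTensorProduct.lift.tprod,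
    MultilinearMap.compLinearMap_apply, MultilinearMap.mkPiAlgebraFin_apply,
    ExteriorAlgebra.ιMulti_apply]
  rfl

/-- For `A` of finite type, `Ω^n(A) = 0` for all sufficiently large `n`. -/
lemma exists_forms_eq_zero [Algebra.FiniteType k A] :
    ∃ N : ℕ, ∀ n, N ≤ n → ∀ v : Fin n → KaehlerDifferential k A,
      ExteriorAlgebra.ιMulti A n v = 0 := by
  obtain ⟨N, s, hs⟩ := Module.Finite.exists_fin (R := A) (M := KaehlerDifferential k A)
  refine ⟨N + 1, fun n hn v => ?_⟩
  have h1 := exteriorPower.ιMulti_family_span_fixedDegree_of_span A (n := n) hs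
  have h2 : IsEmpty (Set.powersetCard (Fin N) n) := by
    constructor
    rintro ⟨t, ht⟩
    have h3 := Finset.card_le_univ t
    rw [Fintype.card_fin] at h3
    have h4 : t.card = n := ht
    omega
  rw [Set.range_eq_empty, Submodule.span_empty] at h1
  have h5 : ExteriorAlgebra.ιMulti A n v ∈ ⋀[A]^n (KaehlerDifferential k A) :=
    (exteriorPower.ιMulti A n v).2
  rw [← h1] at h5
  exact (Submodule.mem_bot A).1 h5

lemma exists_hkr_eq_zero [Algebra.FiniteType k A] :
    ∃ N : ℕ, ∀ n, N ≤ n → hkrWord k A n = 0 ∧ hkrUnitWord k A n = 0 := by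
  obtain ⟨N, hN⟩ := exists_forms_eq_zero k A
  refine ⟨N, fun n hn => ⟨?_, ?_⟩⟩
  · ext a
    simp only [LinearMap.compMultilinearMap_apply, hkrWord_tprod, hN n hn, mul_zero, smul_zero,
      LinearMap.zero_apply]
  · ext a
    simp only [LinearMap.compMultilinearMap_apply, hkrUnitWord_tprod, hN (n + 1) (by omega),
      smul_zero, LinearMap.zero_apply]

lemma hkr_support_finite [Algebra.FiniteType k A] (x : HochPi k A) :
    (Function.support fun n => hkrWord k A n (x.1 n) + hkrUnitWord k A n (x.2 n)).Finite := by
  obtain ⟨N, hN⟩ := exists_hkr_eq_zero k A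
  refine (Set.finite_lt_nat N).subset fun n hn => ?_
  by_contra h
  simp only [Set.mem_ofPred_eq, not_lt] at h
  exact hn (by simp [(hN n h).1, (hN n h).2])

/-- The Hochschild-Kostant-Rosenberg map `ε(x_0, …, x_n) = (1/n!) x_0 dx_1 ∧ … ∧ dx_n`
(where `x_0 = e` acts as `1`). On the infinite product over all degrees only finitely many terms of
the sum are nonzero, since `Ω^n(A) = 0` for large `n`; see `exists_hkr_eq_zero`. -/
def hkr [Algebra.FiniteType k A] : HochPi k A →ₗ[k] Forms k A where
  toFun x := ∑ᶠ n, (hkrWord k A n (x.1 n) + hkrUnitWord k A n (x.2 n))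
  map_add' x y := by
    rw [← finsum_add_distrib (hkr_support_finite k A x) (hkr_support_finite k A y)]
    refine finsum_congr fun n => ?_
    simp only [Prod.fst_add, Prod.snd_add, Pi.add_apply, map_add]
    abel
  map_smul' r x := by
    rw [RingHom.id_apply, smul_finsum' r (hkr_support_finite k A x)]
    refine finsum_congr fun n => ?_
    simp only [Prod.smul_fst, Prod.smul_snd, Pi.smul_apply, map_smul, smul_add]

variable {A}

/-- The homotopy `H = - (W d / (2 u²)) ε`. -/
def hkrHomotopy [Algebra.FiniteType k A] (W : A) :
    Laurent k (HochPi k A) →ₗ[LaurentSeries k] Laurent k (Forms k A) :=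
  uMonomial k (-2) (-(1 / 2)) • laurentMap (mulFun k W ∘ₗ deRham k A ∘ₗ hkr k A)

end Map

end HKR

end

noncomputable section

open scoped TensorProduct

namespace HKR

/-! ### Operators on words -/

section Words

/-! Split the Hochschild complex into two columns, the words `x` with first letter in `A` and the
words `y` with first letter `e`. Let t be the signed rotation, b₀ (`cyc`) and b' (`bar`) the cyclic
and the bar differential, N the norm, β (`curv`) the alternating sum of all insertions of W and β'
(`curv'`) the same sum without the insertion in front. Then b(x, y) = (b₀x + β'x + (1-t)y, -b'y -
βy) and B(x, y) = (0, Nx). So the mixed complex identities are b₀(1-t) = (1-t)b' and Nb₀ = b'N,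
their analogues β'(1-t) = (1-t)β and Nβ' = βN, and (b₀+β')² = (b'+β)² = 0, where commutativity of
`A` makes W central.

For the connection, [U, b] = 0, and a Cartan formula says that [U, B] + [V, b] is the part of b
coming from the curvature; it rests on the telescoping sums `vee_sub_tau`, `vee_sub_tau_vee`,
`vee_curv'` and `bar_vee`. Since Γ counts degrees, [Γ, ·] is 1/2 on the product part of b and -1/2
on the curvature part, so together they give b/2. The map ε commutes with b, B, U (which becomes
multiplication by W) and Γ, while εV = ½ dW ∧ dε; the homotopy H absorbs this last term.

For the quasi-isomorphism, the e-column is contractible even with curvature. On the other column the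
equations with b₀ + β' are solved degree by degree (`IsPerturbation`); the infinite product is what
allows this process to continue forever. Everything reduces to the uncurved statement that b₀-cycles
realize all forms and that a b₀-cycle killed by ε is a boundary. The first is explicit: -β' with W
replaced by an arbitrary letter c preserves cycles and multiplies the form by dc
(`exists_cycle_hkrWord`).

The second is proved by counting generators (`hkrInjective_of_smooth`). Locally on A there is a
localization L, étale over a polynomial ring in d variables. The bar resolution is flat over A ⊗ A
and stays exact over L ⊗ L. The d elements 1 ⊗ xᵢ - xᵢ ⊗ 1 form a weakly regular sequence in L ⊗ L,
annihilate the homology with any coefficients, and L is a direct factor of the quotient by them.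
Dividing out one of them makes H_{n+1} an extension of the old H_n by the old H_{n+1}, so by
Pascal's rule H_n over L has at most (d choose n) generators. It surjects onto the n-forms of L, a
free module of that same rank, and by the Orzech property such a surjection is injective. Clearing
denominators shows that the ideal of those a for which a·z is a boundary lies in no maximal ideal.
-/

lemma insertNth_val {A : Type*} {n : ℕ} (p : Fin (n + 2)) (w : A) (b : ℕ → A) (i : Fin (n + 2)) :
    p.insertNth (α := fun _ => A) w (fun i : Fin (n + 1) => b i) i =
      if (i : ℕ) < p then b i else if (i : ℕ) = p then w else b (i - 1) := by
  rcases lt_trichotomy i p with h | h | h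
  · rw [if_pos (show (i : ℕ) < p from h), Fin.insertNth_apply_below h]
    simp
  · subst h
    simp
  · have h' : (p : ℕ) < i := h
    rw [if_neg (by omega), if_neg (by omega), Fin.insertNth_apply_above h]
    simp

variable {k : Type*} [Field k] {A : Type*} [CommRing A] [Algebra k A]

lemma contractNth_val {n : ℕ} (j : Fin (n + 1)) (b : ℕ → A) (i : Fin (n + 1)) :
    Fin.contractNth j.castSucc (· * ·) (fun i : Fin (n + 2) => b i) i =
      if (i : ℕ) < j then b i else if (i : ℕ) = j then b i * b (i + 1) else b (i + 1) := by
  simp only [Fin.contractNth, Fin.val_castSucc, Fin.val_succ]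

lemma val_sub_one {n : ℕ} (i : Fin (n + 1)) :
    ((i - 1 : Fin (n + 1)) : ℕ) = if (i : ℕ) = 0 then n else i - 1 := by
  rw [Fin.coe_sub_one]
  simp only [Fin.ext_iff, Fin.val_zero]

variable (k) in
/-- The word `(b 0, …, b n)`. -/
def word (n : ℕ) (b : ℕ → A) : Word k A n := PiTensorProduct.tprod k fun i => b i

/-- With letters indexed by `ℕ` rather than `Fin`, identities between words become case distinctions
on natural numbers, which `omega` settles. -/
lemma exists_eq_val {n : ℕ} (a : Fin (n + 1) → A) : ∃ b : ℕ → A, a = fun i : Fin (n + 1) => b i :=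
  by
  -- The value `0` beyond the end of the word is never read.
  refine ⟨fun m => if h : m < n + 1 then a ⟨m, h⟩ else 0, funext fun i => ?_⟩
  change a i = if h : (i : ℕ) < n + 1 then a ⟨i, h⟩ else 0
  rw [dif_pos i.2]

lemma word_congr {n : ℕ} {b c : ℕ → A} (h : ∀ i ≤ n, b i = c i) : word k n b = word k n c := by
  rw [word, word]
  congr 1
  exact funext fun i => h i (Nat.le_of_lt_succ i.2)

lemma word_ext {M : Type*} [AddCommMonoid M] [Module k M] {n : ℕ} {f g : Word k A n →ₗ[k] M}
    (h : ∀ b, f (word k n b) = g (word k n b)) : f = g := by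
  ext a
  obtain ⟨b, rfl⟩ := exists_eq_val a
  exact h b

lemma merge_word {n : ℕ} (j : Fin (n + 1)) (b : ℕ → A) :
    merge k j (word k (n + 1) b) = word k n fun i =>
      if i < j then b i else if i = j then b i * b (i + 1) else b (i + 1) := by
  rw [word, merge_tprod, word]
  exact congrArg _ (funext fun i => contractNth_val j b i)

lemma insertAt_word (w : A) {n : ℕ} (p : Fin (n + 2)) (b : ℕ → A) :
    insertAt k w p (word k n b) = word k (n + 1) fun i =>
      if i < p then b i else if i = p then w else b (i - 1) := by
  rw [word, insertAt_tprod, word]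
  exact congrArg _ (funext fun i => insertNth_val p w b i)

lemma rotate_one_word {n : ℕ} (b : ℕ → A) :
    rotate k 1 (word k n b) = word k n fun i => if i = 0 then b n else b (i - 1) := by
  rw [word, rotate_tprod, word]
  congr 1
  funext i
  rw [val_sub_one, apply_ite b]

variable (k) in
/-- The letter `a`, as a word of length one. -/
def letter (a : A) : Word k A 0 := word k 0 fun _ => a

variable (k) in
/-- `(a_0, …, a_n) ↦ (a, a_0, …, a_n)`. -/
def cons (a : A) {n : ℕ} : Word k A n →ₗ[k] Word k A (n + 1) := insertAt k a 0

variable (k) in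
/-- `(a_0, …, a_n) ↦ (a_0, …, a_n, a)`. -/
def snoc (a : A) {n : ℕ} : Word k A n →ₗ[k] Word k A (n + 1) := insertAt k a (Fin.last _)

variable (k) in
/-- `(a_0, …, a_n) ↦ (a a_0, a_1, …, a_n)`. -/
def mulFirst (a : A) {n : ℕ} : Word k A n →ₗ[k] Word k A n := merge k 0 ∘ₗ insertAt k a 0

variable (k) in
/-- `(a_0, …, a_n) ↦ (a_0, …, a_{n-1}, a_n a)`. -/
def mulLast (a : A) {n : ℕ} : Word k A n →ₗ[k] Word k A n :=
  merge k (Fin.last n) ∘ₗ insertAt k a (Fin.last _)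

lemma cons_word (w : A) {n : ℕ} (b : ℕ → A) :
    cons k w (word k n b) = word k (n + 1) fun i => if i = 0 then w else b (i - 1) := by
  rw [cons, insertAt_word]
  refine word_congr fun i hi => ?_
  rw [Fin.val_zero, if_neg (Nat.not_lt_zero i)]

lemma snoc_word (w : A) {n : ℕ} (b : ℕ → A) :
    snoc k w (word k n b) = word k (n + 1) fun i => if i = n + 1 then w else b i := by
  rw [snoc, insertAt_word]
  refine word_congr fun i hi => ?_
  rw [Fin.val_last]
  split_ifs <;> first | rfl | omega

lemma mulFirst_word (w : A) {n : ℕ} (b : ℕ → A) :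
    mulFirst k w (word k n b) = word k n fun i => if i = 0 then w * b i else b i := by
  rw [mulFirst, LinearMap.comp_apply, insertAt_word, merge_word]
  refine word_congr fun i hi => ?_
  simp only [Fin.val_zero]
  split_ifs <;> first | omega | simp_all

lemma mulLast_word (w : A) {n : ℕ} (b : ℕ → A) :
    mulLast k w (word k n b) = word k n fun i => if i = n then b i * w else b i := by
  rw [mulLast, LinearMap.comp_apply, insertAt_word, merge_word]
  refine word_congr fun i hi => ?_
  simp only [Fin.val_last]
  split_ifs <;> first | omega | rfl

lemma word_succ {n : ℕ} (b : ℕ → A) :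
    word k (n + 1) b = cons k (b 0) (word k n fun i => b (i + 1)) := by
  rw [cons_word]
  refine word_congr fun i hi => ?_
  split_ifs with h
  · rw [h]
  · rw [Nat.sub_add_cancel (Nat.pos_of_ne_zero h)]

lemma word_succ_snoc {n : ℕ} (b : ℕ → A) :
    word k (n + 1) b = snoc k (b (n + 1)) (word k n b) := by
  rw [snoc_word]
  refine word_congr fun i hi => ?_
  split_ifs with h
  · rw [h]
  · rfl

lemma word_zero (b : ℕ → A) : word k 0 b = letter k (b 0) :=
  word_congr fun i hi => by rw [Nat.le_zero.1 hi]

section Ext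

variable {M : Type*} [AddCommMonoid M] [Module k M]

lemma word_ext_zero {f g : Word k A 0 →ₗ[k] M} (h : ∀ a, f (letter k a) = g (letter k a)) :
    f = g :=
  word_ext fun b => by rw [word_zero, h]

/-- Peeling off one letter is the induction principle of the whole calculus: the operators obey
short recursions along `cons` and `snoc`, which replace manipulations of double sums. -/
lemma word_ext_cons {n : ℕ} {f g : Word k A (n + 1) →ₗ[k] M}
    (h : ∀ a w, f (cons k a w) = g (cons k a w)) : f = g :=
  word_ext fun b => by rw [word_succ, h]

lemma word_ext_snoc {n : ℕ} {f g : Word k A (n + 1) →ₗ[k] M}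
    (h : ∀ a w, f (snoc k a w) = g (snoc k a w)) : f = g :=
  word_ext fun b => by rw [word_succ_snoc, h]

end Ext

lemma cons_letter (a b : A) : cons k a (letter k b) = snoc k b (letter k a) := by
  rw [letter, letter, cons_word, snoc_word]
  refine word_congr fun i hi => ?_
  split_ifs <;> first | rfl | omega

@[simp]
lemma mulFirst_letter (a b : A) : mulFirst k a (letter k b) = letter k (a * b) := by
  rw [letter, mulFirst_word, letter]
  exact word_congr fun i hi => by simp [Nat.le_zero.1 hi]

@[simp]
lemma mulLast_letter (a b : A) : mulLast k a (letter k b) = letter k (b * a) := by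
  rw [letter, mulLast_word, letter]
  exact word_congr fun i hi => by simp [Nat.le_zero.1 hi]

lemma mulFirst_cons (a b : A) {n : ℕ} (w : Word k A n) :
    mulFirst k a (cons k b w) = cons k (a * b) w := by
  have : mulFirst k a ∘ₗ cons k b = (cons k (a * b) : Word k A n →ₗ[k] _) := by
    refine word_ext fun x => ?_
    simp only [LinearMap.comp_apply, cons_word, mulFirst_word]
    refine word_congr fun i hi => ?_
    split_ifs <;> first | rfl | omega | simp_all [mul_assoc]
  exact LinearMap.congr_fun this w

lemma mulFirst_snoc (a b : A) {n : ℕ} (w : Word k A n) :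
    mulFirst k a (snoc k b w) = snoc k b (mulFirst k a w) := by
  have : mulFirst k a ∘ₗ snoc k b = (snoc k b ∘ₗ mulFirst k a : Word k A n →ₗ[k] _) := by
    refine word_ext fun x => ?_
    simp only [LinearMap.comp_apply, snoc_word, mulFirst_word]
    refine word_congr fun i hi => ?_
    split_ifs <;> first | rfl | omega | simp_all [mul_assoc]
  exact LinearMap.congr_fun this w

lemma mulLast_snoc (a b : A) {n : ℕ} (w : Word k A n) :
    mulLast k a (snoc k b w) = snoc k (b * a) w := by
  have : mulLast k a ∘ₗ snoc k b = (snoc k (b * a) : Word k A n →ₗ[k] _) := by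
    refine word_ext fun x => ?_
    simp only [LinearMap.comp_apply, snoc_word, mulLast_word]
    refine word_congr fun i hi => ?_
    split_ifs <;> first | rfl | omega | simp_all [mul_assoc]
  exact LinearMap.congr_fun this w

lemma mulLast_cons (a b : A) {n : ℕ} (w : Word k A n) :
    mulLast k a (cons k b w) = cons k b (mulLast k a w) := by
  have : mulLast k a ∘ₗ cons k b = (cons k b ∘ₗ mulLast k a : Word k A n →ₗ[k] _) := by
    refine word_ext fun x => ?_
    simp only [LinearMap.comp_apply, cons_word, mulLast_word]
    refine word_congr fun i hi => ?_
    split_ifs <;> first | rfl | omega | simp_all [mul_assoc]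
  exact LinearMap.congr_fun this w

lemma cons_snoc (a b : A) {n : ℕ} (w : Word k A n) :
    cons k a (snoc k b w) = snoc k b (cons k a w) := by
  have : cons k a ∘ₗ snoc k b = (snoc k b ∘ₗ cons k a : Word k A n →ₗ[k] _) := by
    refine word_ext fun x => ?_
    simp only [LinearMap.comp_apply, cons_word, snoc_word]
    refine word_congr fun i hi => ?_
    split_ifs <;> first | rfl | omega | simp_all [mul_assoc]
  exact LinearMap.congr_fun this w

lemma mulFirst_mulFirst (a b : A) {n : ℕ} (w : Word k A n) :
    mulFirst k a (mulFirst k b w) = mulFirst k (a * b) w := by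
  have : mulFirst k a ∘ₗ mulFirst k b = (mulFirst k (a * b) : Word k A n →ₗ[k] _) := by
    refine word_ext fun x => ?_
    simp only [LinearMap.comp_apply, mulFirst_word]
    refine word_congr fun i hi => ?_
    split_ifs <;> first | rfl | omega | simp_all [mul_assoc]
  exact LinearMap.congr_fun this w

lemma mulLast_mulLast (a b : A) {n : ℕ} (w : Word k A n) :
    mulLast k a (mulLast k b w) = mulLast k (a * b) w := by
  have : mulLast k a ∘ₗ mulLast k b = (mulLast k (a * b) : Word k A n →ₗ[k] _) := by
    refine word_ext fun x => ?_
    simp only [LinearMap.comp_apply, mulLast_word]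
    refine word_congr fun i hi => ?_
    split_ifs <;> first | rfl | omega | simp_all [mul_comm a b, mul_assoc]
  exact LinearMap.congr_fun this w

lemma mulFirst_mulLast (a b : A) {n : ℕ} (w : Word k A n) :
    mulFirst k a (mulLast k b w) = mulLast k b (mulFirst k a w) := by
  have : mulFirst k a ∘ₗ mulLast k b = (mulLast k b ∘ₗ mulFirst k a : Word k A n →ₗ[k] _) := by
    refine word_ext fun x => ?_
    simp only [LinearMap.comp_apply, mulFirst_word, mulLast_word]
    refine word_congr fun i hi => ?_
    split_ifs <;> first | rfl | omega | simp_all [mul_assoc]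
  exact LinearMap.congr_fun this w

@[simp]
lemma mulFirst_one {n : ℕ} (w : Word k A n) : mulFirst k (1 : A) w = w := by
  have : mulFirst k (1 : A) = (LinearMap.id : Word k A n →ₗ[k] _) :=
    word_ext fun x => by simp [mulFirst_word]
  exact LinearMap.congr_fun this w

@[simp]
lemma mulLast_one {n : ℕ} (w : Word k A n) : mulLast k (1 : A) w = w := by
  have : mulLast k (1 : A) = (LinearMap.id : Word k A n →ₗ[k] _) :=
    word_ext fun x => by simp [mulLast_word]
  exact LinearMap.congr_fun this w

lemma insertAt_add (a b : A) {n : ℕ} (p : Fin (n + 2)) (w : Word k A n) :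
    insertAt k (a + b) p w = insertAt k a p w + insertAt k b p w := by
  have : insertAt k (a + b) p = insertAt k a p + insertAt k b p := by
    ext x
    simp only [LinearMap.compMultilinearMap_apply, LinearMap.add_apply, insertAt, PiTensorProduct.lift.tprod, map_add]
  exact LinearMap.congr_fun this w

lemma insertAt_smul (r : k) (a : A) {n : ℕ} (p : Fin (n + 2)) (w : Word k A n) :
    insertAt k (r • a) p w = r • insertAt k a p w := by
  have : insertAt k (r • a) p = r • insertAt k a p := by
    ext x
    simp only [LinearMap.compMultilinearMap_apply, LinearMap.smul_apply, insertAt, PiTensorProduct.lift.tprod, map_smul]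
  exact LinearMap.congr_fun this w

/-! Rotations, faces and insertions with their signs. -/

variable (k A) in
/-- The signed rotation `(a_0, …, a_n) ↦ (-1)^n (a_n, a_0, …, a_{n-1})`. -/
def tau (n : ℕ) : Word k A n →ₗ[k] Word k A n := (-1 : k) ^ n • rotate k 1

variable (k A) in
/-- The signed faces: `(-1)^j` times the `j`-th face for `j ≤ n`, and
`(a_0, …, a_{n+1}) ↦ (-1)^{n+1} (a_{n+1} a_0, a_1, …, a_n)` for other `j`. -/
def face (n j : ℕ) : Word k A (n + 1) →ₗ[k] Word k A n :=
  if h : j < n + 1 then (-1 : k) ^ j • merge k ⟨j, h⟩ else merge k 0 ∘ₗ tau k A (n + 1)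

/-- The signed insertions of `w`. -/
def ins (w : A) (n p : ℕ) : Word k A n →ₗ[k] Word k A (n + 1) :=
  if h : p < n + 2 then (-1 : k) ^ p • insertAt k w ⟨p, h⟩ else 0

lemma face_of_lt {n j : ℕ} (h : j < n + 1) : face k A n j = (-1 : k) ^ j • merge k ⟨j, h⟩ :=
  dif_pos h

lemma ins_of_lt (w : A) {n p : ℕ} (h : p < n + 2) :
    ins (k := k) w n p = (-1 : k) ^ p • insertAt k w ⟨p, h⟩ := dif_pos h

lemma face_zero (n : ℕ) : face k A n 0 = merge k 0 := by
  rw [face_of_lt (Nat.succ_pos n), pow_zero, one_smul]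
  rfl

lemma face_last (n : ℕ) : face k A n (n + 1) = merge k 0 ∘ₗ tau k A (n + 1) :=
  dif_neg (lt_irrefl _)

lemma ins_zero (w : A) (n : ℕ) : ins (k := k) w n 0 = cons k w := by
  rw [ins_of_lt w (Nat.succ_pos _), pow_zero, one_smul]
  rfl

lemma rotate_one_merge {n j : ℕ} (hj : j + 1 < n + 1) :
    merge k (A := A) ⟨j + 1, hj⟩ ∘ₗ rotate k 1 = rotate k 1 ∘ₗ merge k ⟨j, by omega⟩ := by
  refine word_ext fun b => ?_
  simp only [LinearMap.comp_apply, merge_word, rotate_one_word]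
  refine word_congr fun i hi => ?_
  split_ifs <;> first | contradiction | omega | rfl | (congr 1; omega) | (refine congrArg₂ (· * ·) (congrArg b ?_) (congrArg b ?_) <;> omega)

/-- Two rotations bring the last two letters to the front, where `merge k 0` glues them. -/
lemma rotate_rotate_merge (n : ℕ) :
    (merge k 0 ∘ₗ rotate k 1) ∘ₗ rotate k 1 =
      (rotate k 1 ∘ₗ merge k (Fin.last n) : Word k A (n + 1) →ₗ[k] Word k A n) := by
  refine word_ext fun b => ?_
  simp only [LinearMap.comp_apply, merge_word, rotate_one_word, Fin.val_zero, Fin.val_last]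
  refine word_congr fun i hi => ?_
  split_ifs <;> first | contradiction | omega | rfl | (congr 1; omega) | (refine congrArg₂ (· * ·) (congrArg b ?_) (congrArg b ?_) <;> omega)

lemma rotate_one_insertAt (w : A) {n p : ℕ} (hp : p + 1 < n + 2) :
    insertAt k w ⟨p + 1, hp⟩ ∘ₗ rotate k 1 =
      rotate k 1 ∘ₗ insertAt k w (n := n) ⟨p, by omega⟩ := by
  refine word_ext fun b => ?_
  simp only [LinearMap.comp_apply, insertAt_word, rotate_one_word]
  refine word_congr fun i hi => ?_
  split_ifs <;> first | contradiction | omega | rfl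

lemma rotate_one_snoc (w : A) {n : ℕ} :
    rotate k 1 ∘ₗ snoc k w = (cons k w : Word k A n →ₗ[k] _) := by
  refine word_ext fun b => ?_
  simp only [LinearMap.comp_apply, cons_word, snoc_word, rotate_one_word]
  refine word_congr fun i hi => ?_
  split_ifs <;> first | contradiction | omega | rfl

end Words

/-! ### Cyclic calculus: rotations, faces and insertions -/

section Calculus

variable {k : Type*} [Field k] {A : Type*} [CommRing A] [Algebra k A]

lemma rotate_zero (n : ℕ) : (rotate k 0 : Word k A n →ₗ[k] Word k A n) = LinearMap.id := by
  ext a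
  simp only [LinearMap.compMultilinearMap_apply, rotate_tprod, LinearMap.id_apply]
  exact congrArg _ (funext fun l => congrArg a (sub_zero l))

lemma rotate_comp_rotate {n : ℕ} (i j : Fin (n + 1)) :
    rotate k i ∘ₗ rotate k j = (rotate k (j + i) : Word k A n →ₗ[k] Word k A n) := by
  ext a
  simp only [LinearMap.compMultilinearMap_apply, LinearMap.comp_apply, rotate_tprod]
  exact congrArg _ (funext fun l => congrArg a ((sub_sub l i j).trans (congrArg (l - ·) (add_comm i j))))

lemma rotate_one_pow {n : ℕ} (j : Fin (n + 1)) :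
    (rotate k 1 : Module.End k (Word k A n)) ^ (j : ℕ) = rotate k j := by
  cases n with
  | zero =>
    rw [Subsingleton.elim (α := Fin 1) j 0, rotate_zero]
    rfl
  | succ n =>
    induction j using Fin.induction with
    | zero =>
      rw [rotate_zero]
      rfl
    | succ j ih =>
      rw [Fin.val_succ, pow_succ', ← Fin.val_castSucc, ih, Module.End.mul_eq_comp,
        rotate_comp_rotate, Fin.coeSucc_eq_succ]

lemma rotate_one_pow_card (n : ℕ) :
    (rotate k 1 : Module.End k (Word k A n)) ^ (n + 1) = 1 := by
  have := rotate_one_pow (k := k) (A := A) (Fin.last n)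
  rw [Fin.val_last] at this
  rw [pow_succ', this, Module.End.mul_eq_comp, rotate_comp_rotate, Fin.last_add_one, rotate_zero]
  rfl

lemma tau_pow (n j : ℕ) :
    tau k A n ^ j = (-1 : k) ^ (n * j) • (rotate k 1 : Module.End k (Word k A n)) ^ j := by
  rw [tau, smul_pow, ← pow_mul]

lemma tau_pow_card (n : ℕ) : tau k A n ^ (n + 1) = 1 := by
  rw [tau_pow, rotate_one_pow_card, (Nat.even_mul_succ_self n).neg_one_pow, one_smul]

lemma tau_zero (x : Word k A 0) : tau k A 0 x = x := by
  have := tau_pow_card (k := k) (A := A) 0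
  exact LinearMap.congr_fun ((pow_one _).symm.trans this) x

lemma tau_apply {n : ℕ} (x : Word k A n) : tau k A n x = (-1 : k) ^ n • rotate k 1 x := rfl

lemma tau_pow_succ_apply {n : ℕ} (j : ℕ) (x : Word k A n) :
    (tau k A n ^ (j + 1)) x = tau k A n ((tau k A n ^ j) x) := by
  rw [pow_succ']
  rfl

lemma tau_pow_succ_apply' {n : ℕ} (j : ℕ) (x : Word k A n) :
    (tau k A n ^ (j + 1)) x = (tau k A n ^ j) (tau k A n x) := by
  rw [pow_succ]
  rfl

/-- The signs built into `tau` and `face` make rotation shift the index of a face with no sign left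
over; for `j = n` the shifted face is the one which wraps around. -/
lemma face_succ_tau {n j : ℕ} (hj : j ≤ n) (x : Word k A (n + 1)) :
    face k A n (j + 1) (tau k A (n + 1) x) = tau k A n (face k A n j x) := by
  rcases Nat.lt_or_ge j n with h | h
  · have := LinearMap.congr_fun (rotate_one_merge (k := k) (A := A) (Nat.succ_lt_succ h)) x
    simp only [LinearMap.comp_apply] at this
    rw [face_of_lt (Nat.succ_lt_succ h), face_of_lt (Nat.lt_succ_of_lt h), tau_apply, tau_apply,
      LinearMap.smul_apply, LinearMap.smul_apply, map_smul, this, map_smul, smul_smul, smul_smul]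
    congr 1
    rw [Nat.succ_eq_add_one]
    ring
  · obtain rfl : j = n := le_antisymm hj h
    have := LinearMap.congr_fun (rotate_rotate_merge (k := k) (A := A) j) x
    simp only [LinearMap.comp_apply] at this
    rw [face_last, face_of_lt (Nat.lt_succ_self j), LinearMap.comp_apply, tau_apply, tau_apply,
      tau_apply, LinearMap.smul_apply, map_smul, map_smul, map_smul, this, map_smul, smul_smul,
      smul_smul]
    change _ = ((-1) ^ j * (-1) ^ j : k) • rotate k 1 (merge k (Fin.last j) x)
    congr 1
    ring

lemma ins_succ_tau (w : A) {n p : ℕ} (hp : p ≤ n) (x : Word k A n) :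
    ins w n (p + 1) (tau k A n x) = tau k A (n + 1) (ins w n p x) := by
  have := LinearMap.congr_fun (rotate_one_insertAt (k := k) w (n := n) (p := p) (by omega)) x
  simp only [LinearMap.comp_apply] at this
  rw [ins_of_lt w (by omega : p + 1 < n + 2), ins_of_lt w (by omega : p < n + 2), tau_apply,
    tau_apply, LinearMap.smul_apply, LinearMap.smul_apply, map_smul, this, map_smul, smul_smul,
    smul_smul]
  congr 1
  ring

lemma ins_last (w : A) {n : ℕ} (x : Word k A n) :
    ins w n (n + 1) x = (-1 : k) ^ (n + 1) • snoc k w x := by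
  rw [ins_of_lt w (Nat.lt_succ_self _)]
  rfl

lemma tau_snoc (w : A) {n : ℕ} (x : Word k A n) :
    tau k A (n + 1) (snoc k w x) = (-1 : k) ^ (n + 1) • cons k w x := by
  rw [tau_apply, ← rotate_one_snoc]
  rfl

lemma tau_ins_last (w : A) {n : ℕ} (x : Word k A n) :
    tau k A (n + 1) (ins w n (n + 1) x) = cons k w x := by
  rw [ins_last, map_smul, tau_snoc, smul_smul, ← pow_add, Even.neg_one_pow ⟨_, rfl⟩, one_smul]

lemma merge_succ_cons (a : A) {n j : ℕ} (hj : j + 1 < n + 2) (x : Word k A (n + 1)) :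
    merge k ⟨j + 1, hj⟩ (cons k a x) = cons k a (merge k ⟨j, by omega⟩ x) := by
  have : merge k ⟨j + 1, hj⟩ ∘ₗ cons k a = cons k a ∘ₗ merge k (A := A) (n := n) ⟨j, by omega⟩ := by
    refine word_ext fun b => ?_
    simp only [LinearMap.comp_apply, merge_word, cons_word]
    refine word_congr fun i hi => ?_
    split_ifs <;> first
      | contradiction
      | omega
      | rfl
      | (congr 1; omega)
      | (refine congrArg₂ (· * ·) (congrArg b ?_) (congrArg b ?_) <;> omega)
  exact LinearMap.congr_fun this x

lemma merge_zero_cons (a : A) {n : ℕ} (x : Word k A n) :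
    merge k 0 (cons k a x) = mulFirst k a x := rfl

lemma merge_snoc (a : A) {n j : ℕ} (hj : j < n + 1) (x : Word k A (n + 1)) :
    merge k ⟨j, by omega⟩ (snoc k a x) = snoc k a (merge k ⟨j, hj⟩ x) := by
  have : merge k ⟨j, by omega⟩ ∘ₗ snoc k a = snoc k a ∘ₗ merge k (A := A) ⟨j, hj⟩ := by
    refine word_ext fun b => ?_
    simp only [LinearMap.comp_apply, merge_word, snoc_word]
    refine word_congr fun i hi => ?_
    split_ifs <;> first | contradiction | omega | rfl
  exact LinearMap.congr_fun this x

lemma insertAt_succ_cons (w a : A) {n p : ℕ} (hp : p + 1 < n + 3) (x : Word k A n) :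
    insertAt k w ⟨p + 1, hp⟩ (cons k a x) = cons k a (insertAt k w ⟨p, by omega⟩ x) := by
  have : insertAt k w ⟨p + 1, hp⟩ ∘ₗ cons k a =
      cons k a ∘ₗ insertAt k w (n := n) ⟨p, by omega⟩ := by
    refine word_ext fun b => ?_
    simp only [LinearMap.comp_apply, insertAt_word, cons_word]
    refine word_congr fun i hi => ?_
    split_ifs <;> first | contradiction | omega | rfl
  exact LinearMap.congr_fun this x

lemma insertAt_snoc (w a : A) {n p : ℕ} (hp : p < n + 2) (x : Word k A n) :
    insertAt k w ⟨p, by omega⟩ (snoc k a x) = snoc k a (insertAt k w ⟨p, hp⟩ x) := by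
  have : insertAt k w ⟨p, by omega⟩ ∘ₗ snoc k a = snoc k a ∘ₗ insertAt k w (n := n) ⟨p, hp⟩ := by
    refine word_ext fun b => ?_
    simp only [LinearMap.comp_apply, insertAt_word, snoc_word]
    refine word_congr fun i hi => ?_
    split_ifs <;> first | contradiction | omega | rfl
  exact LinearMap.congr_fun this x

lemma face_succ_cons (a : A) {n j : ℕ} (hj : j ≤ n) (x : Word k A (n + 1)) :
    face k A (n + 1) (j + 1) (cons k a x) = -cons k a (face k A n j x) := by
  rw [face_of_lt (by omega), face_of_lt (by omega), LinearMap.smul_apply, LinearMap.smul_apply,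
    merge_succ_cons, map_smul, pow_succ, mul_neg_one, neg_smul]

lemma face_snoc (a : A) {n j : ℕ} (hj : j ≤ n) (x : Word k A (n + 1)) :
    face k A (n + 1) j (snoc k a x) = snoc k a (face k A n j x) := by
  rw [face_of_lt (by omega), face_of_lt (Nat.lt_succ_of_le hj), LinearMap.smul_apply,
    LinearMap.smul_apply, merge_snoc a (Nat.lt_succ_of_le hj), map_smul]

lemma face_last_snoc (a : A) {n : ℕ} (x : Word k A n) :
    face k A n n (snoc k a x) = (-1 : k) ^ n • mulLast k a x := by
  rw [face_of_lt (Nat.lt_succ_self n)]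
  rfl

lemma ins_succ_cons (w a : A) {n p : ℕ} (hp : p ≤ n + 1) (x : Word k A n) :
    ins w (n + 1) (p + 1) (cons k a x) = -cons k a (ins w n p x) := by
  rw [ins_of_lt w (by omega), ins_of_lt w (by omega), LinearMap.smul_apply, LinearMap.smul_apply,
    insertAt_succ_cons, map_smul, pow_succ, mul_neg_one, neg_smul]

lemma ins_snoc (w a : A) {n p : ℕ} (hp : p ≤ n + 1) (x : Word k A n) :
    ins w (n + 1) p (snoc k a x) = snoc k a (ins w n p x) := by
  rw [ins_of_lt w (by omega), ins_of_lt w (Nat.lt_succ_of_le hp), LinearMap.smul_apply,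
    LinearMap.smul_apply, insertAt_snoc w a (Nat.lt_succ_of_le hp), map_smul]

/-! The differentials. -/

variable (k A) in
/-- The bar differential `∑_{j ≤ n} (-1)^j d_j`. -/
def bar (n : ℕ) : Word k A (n + 1) →ₗ[k] Word k A n := ∑ j ∈ Finset.range (n + 1), face k A n j

variable (k A) in
/-- The Hochschild differential on words. -/
def cyc (n : ℕ) : Word k A (n + 1) →ₗ[k] Word k A n := ∑ j ∈ Finset.range (n + 2), face k A n j

/-- The alternating sum of all insertions of `w`. -/
def curv (w : A) (n : ℕ) : Word k A n →ₗ[k] Word k A (n + 1) :=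
  ∑ p ∈ Finset.range (n + 2), ins w n p

variable (k A) in
/-- The norm `∑_{i ≤ n} τ^i`. -/
def norm (n : ℕ) : Word k A n →ₗ[k] Word k A n := ∑ i ∈ Finset.range (n + 1), tau k A n ^ i

lemma bar_apply {n : ℕ} (x : Word k A (n + 1)) :
    bar k A n x = ∑ j ∈ Finset.range (n + 1), face k A n j x := by
  rw [bar, LinearMap.sum_apply]

lemma cyc_apply {n : ℕ} (x : Word k A (n + 1)) :
    cyc k A n x = ∑ j ∈ Finset.range (n + 2), face k A n j x := by
  rw [cyc, LinearMap.sum_apply]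

lemma curv_apply (w : A) {n : ℕ} (x : Word k A n) :
    curv w n x = ∑ p ∈ Finset.range (n + 2), ins w n p x := by
  rw [curv, LinearMap.sum_apply]

lemma norm_apply {n : ℕ} (x : Word k A n) :
    norm k A n x = ∑ i ∈ Finset.range (n + 1), (tau k A n ^ i) x := by
  rw [norm, LinearMap.sum_apply]

lemma cyc_eq {n : ℕ} (x : Word k A (n + 1)) :
    cyc k A n x = bar k A n x + merge k 0 (tau k A (n + 1) x) := by
  rw [cyc_apply, Finset.sum_range_succ, ← bar_apply, face_last]
  rfl

lemma bar_cons_zero (a : A) (x : Word k A 0) : bar k A 0 (cons k a x) = mulFirst k a x := by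
  rw [bar_apply, Finset.sum_range_one, face_zero, merge_zero_cons]

lemma bar_cons (a : A) {n : ℕ} (x : Word k A (n + 1)) :
    bar k A (n + 1) (cons k a x) = mulFirst k a x - cons k a (bar k A n x) := by
  rw [bar_apply, Finset.sum_range_succ', face_zero, merge_zero_cons, bar_apply, map_sum,
    Finset.sum_congr rfl fun j hj =>
      face_succ_cons a (Nat.le_of_lt_succ (Finset.mem_range.1 hj)) x,
    Finset.sum_neg_distrib]
  abel

lemma bar_snoc_zero (a : A) (x : Word k A 0) : bar k A 0 (snoc k a x) = mulLast k a x := by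
  rw [bar_apply, Finset.sum_range_one, face_last_snoc, pow_zero, one_smul]

lemma bar_snoc (a : A) {n : ℕ} (x : Word k A (n + 1)) :
    bar k A (n + 1) (snoc k a x) =
      snoc k a (bar k A n x) + (-1 : k) ^ (n + 1) • mulLast k a x := by
  rw [bar_apply, Finset.sum_range_succ, face_last_snoc, bar_apply, map_sum,
    Finset.sum_congr rfl fun j hj => face_snoc a (Nat.le_of_lt_succ (Finset.mem_range.1 hj)) x]

lemma bar_mulFirst (a : A) {n : ℕ} (x : Word k A (n + 1)) :
    bar k A n (mulFirst k a x) = mulFirst k a (bar k A n x) := by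
  have : bar k A n ∘ₗ mulFirst k a = mulFirst k a ∘ₗ bar k A n := by
    refine word_ext_cons fun b y => ?_
    simp only [LinearMap.comp_apply, mulFirst_cons]
    cases n with
    | zero => rw [bar_cons_zero, bar_cons_zero, mulFirst_mulFirst]
    | succ n => rw [bar_cons, bar_cons, map_sub, mulFirst_mulFirst, mulFirst_cons]
  exact LinearMap.congr_fun this x

lemma bar_mulLast (a : A) {n : ℕ} (x : Word k A (n + 1)) :
    bar k A n (mulLast k a x) = mulLast k a (bar k A n x) := by
  have : bar k A n ∘ₗ mulLast k a = mulLast k a ∘ₗ bar k A n := by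
    refine word_ext_snoc fun b y => ?_
    simp only [LinearMap.comp_apply, mulLast_snoc]
    cases n with
    | zero => rw [bar_snoc_zero, bar_snoc_zero, mulLast_mulLast, mul_comm]
    | succ n =>
      rw [bar_snoc, bar_snoc, map_add, map_smul, mulLast_mulLast, mulLast_snoc, mul_comm b a]
  exact LinearMap.congr_fun this x

/-- In the recursion `bar_cons` the two mixed terms cancel because b' commutes with multiplication
of the first letter. -/
lemma bar_bar {n : ℕ} (x : Word k A (n + 2)) : bar k A n (bar k A (n + 1) x) = 0 := by
  have : bar k A n ∘ₗ bar k A (n + 1) = 0 := by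
    clear x
    induction n with
    | zero =>
      refine word_ext_cons fun a y => ?_
      rw [LinearMap.comp_apply, bar_cons, map_sub, bar_cons_zero, bar_mulFirst, sub_self]
      rfl
    | succ n ih =>
      refine word_ext_cons fun a y => ?_
      have h := LinearMap.congr_fun ih y
      simp only [LinearMap.comp_apply, LinearMap.zero_apply] at h ⊢
      rw [bar_cons, map_sub, bar_cons, h, bar_mulFirst, map_zero, sub_zero, sub_self]
  exact LinearMap.congr_fun this x

lemma curv_letter (w a : A) :
    curv w 0 (letter k a) = cons k w (letter k a) - snoc k w (letter k a) := by
  rw [curv_apply, Finset.sum_range_succ, Finset.sum_range_one, ins_zero, ins_last]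
  simp [sub_eq_add_neg]

lemma curv_cons (w a : A) {n : ℕ} (x : Word k A n) :
    curv w (n + 1) (cons k a x) = cons k w (cons k a x) - cons k a (curv w n x) := by
  rw [curv_apply, Finset.sum_range_succ', ins_zero, curv_apply, map_sum,
    Finset.sum_congr rfl fun j hj =>
      ins_succ_cons w a (Nat.le_of_lt_succ (Finset.mem_range.1 hj)) x,
    Finset.sum_neg_distrib]
  abel

lemma curv_snoc (w a : A) {n : ℕ} (x : Word k A n) :
    curv w (n + 1) (snoc k a x) =
      snoc k a (curv w n x) + (-1 : k) ^ n • snoc k w (snoc k a x) := by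
  rw [curv_apply, Finset.sum_range_succ, ins_last, curv_apply, map_sum,
    Finset.sum_congr rfl fun j hj => ins_snoc w a (Nat.le_of_lt_succ (Finset.mem_range.1 hj)) x,
    pow_add (-1 : k) n 2]
  simp

lemma curv_mulFirst (w a : A) {n : ℕ} (x : Word k A n) :
    curv w n (mulFirst k a x) =
      mulFirst k a (curv w n x) + cons k w (mulFirst k a x) - cons k (a * w) x := by
  have : curv w n ∘ₗ mulFirst k a =
      mulFirst k a ∘ₗ curv w n + cons k w ∘ₗ mulFirst k a - cons k (a * w) := by
    cases n with
    | zero =>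
      refine word_ext_zero fun b => ?_
      simp only [LinearMap.comp_apply, LinearMap.add_apply, LinearMap.sub_apply, mulFirst_letter,
        curv_letter, map_sub, mulFirst_cons, mulFirst_snoc]
      abel
    | succ n =>
      refine word_ext_cons fun b y => ?_
      simp only [LinearMap.comp_apply, LinearMap.add_apply, LinearMap.sub_apply, mulFirst_cons,
        curv_cons, map_sub]
      abel
  exact LinearMap.congr_fun this x

lemma curv_curv (w : A) {n : ℕ} (x : Word k A n) : curv w (n + 1) (curv w n x) = 0 := by
  have : curv w (n + 1) ∘ₗ curv w n = (0 : Word k A n →ₗ[k] _) := by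
    clear x
    induction n with
    | zero =>
      refine word_ext_zero fun a => ?_
      simp only [LinearMap.comp_apply, curv_letter, map_sub, curv_cons, curv_snoc, pow_zero,
        one_smul, LinearMap.zero_apply, cons_snoc]
      abel
    | succ n ih =>
      refine word_ext_cons fun a y => ?_
      have h := LinearMap.congr_fun ih y
      simp only [LinearMap.comp_apply, LinearMap.zero_apply] at h ⊢
      rw [curv_cons, map_sub, curv_cons, curv_cons, curv_cons, h, map_sub, map_zero]
      abel
  exact LinearMap.congr_fun this x

lemma bar_curv_zero (w : A) (x : Word k A 0) : bar k A 0 (curv w 0 x) = 0 := by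
  have : bar k A 0 ∘ₗ curv w 0 = 0 := by
    refine word_ext_zero fun a => ?_
    rw [LinearMap.comp_apply, curv_letter, map_sub, bar_cons_zero, bar_snoc_zero, mulFirst_letter,
      mulLast_letter, mul_comm, sub_self]
    rfl
  exact LinearMap.congr_fun this x

/-- Along the recursion on the first letter `a` everything cancels formally except two words with
first letter `w * a` and `a * w`; commutativity of `A` identifies them. -/
lemma bar_curv (w : A) {n : ℕ} (x : Word k A (n + 1)) :
    bar k A (n + 1) (curv w (n + 1) x) + curv w n (bar k A n x) = 0 := by
  have : bar k A (n + 1) ∘ₗ curv w (n + 1) + curv w n ∘ₗ bar k A n = 0 := by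
    clear x
    induction n with
    | zero =>
      refine word_ext_cons fun a y => ?_
      simp only [LinearMap.comp_apply, LinearMap.add_apply, LinearMap.zero_apply]
      rw [curv_cons, map_sub, bar_cons, bar_cons, bar_cons_zero, curv_mulFirst, mulFirst_cons,
        bar_curv_zero, map_zero, mul_comm]
      abel
    | succ n ih =>
      refine word_ext_cons fun a y => ?_
      have h := LinearMap.congr_fun ih y
      simp only [LinearMap.comp_apply, LinearMap.add_apply, LinearMap.zero_apply] at h ⊢
      rw [curv_cons, map_sub, bar_cons, bar_cons, bar_cons, map_sub, map_sub, curv_mulFirst,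
        mulFirst_cons, eq_neg_of_add_eq_zero_left h, curv_cons, map_neg, mul_comm]
      abel
  exact LinearMap.congr_fun this x

/-! The cyclic identities. -/

lemma cyc_tau {n : ℕ} (x : Word k A (n + 1)) :
    cyc k A n (tau k A (n + 1) x) = tau k A n (bar k A n x) + merge k 0 (tau k A (n + 1) x) := by
  rw [cyc_apply, Finset.sum_range_succ', face_zero, bar_apply, map_sum,
    Finset.sum_congr rfl fun j hj =>
      face_succ_tau (Nat.le_of_lt_succ (Finset.mem_range.1 hj)) x]

/-- Rotation carries the faces of b' to the faces of b₀ other than the first. Hence b₀x and b₀(tx)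
share the term `merge k 0 (tau x)`, which drops out of the difference. -/
lemma cyc_sub_tau {n : ℕ} (x : Word k A (n + 1)) :
    cyc k A n (x - tau k A (n + 1) x) = bar k A n x - tau k A n (bar k A n x) := by
  rw [map_sub, cyc_tau, cyc_eq]
  abel

lemma curv_eq (w : A) {n : ℕ} (x : Word k A n) :
    curv w n x = ∑ p ∈ Finset.range (n + 1), ins w n (p + 1) x + cons k w x := by
  rw [curv_apply, Finset.sum_range_succ', ins_zero]

/-- The analogue of `cyc_sub_tau` for insertions: rotation shifts the place of an insertion by one,
and the last insertion becomes the insertion in front of the unrotated word. -/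
lemma curv_sub_tau (w : A) {n : ℕ} (x : Word k A n) :
    curv w n (x - tau k A n x) - cons k w (x - tau k A n x) =
      curv w n x - tau k A (n + 1) (curv w n x) := by
  have h1 : curv w n (tau k A n x) - cons k w (tau k A n x) =
      tau k A (n + 1) (curv w n x) - cons k w x := by
    rw [curv_eq, add_sub_cancel_right, curv_apply w x, Finset.sum_range_succ _ (n + 1), map_add, tau_ins_last,
      add_sub_cancel_right, map_sum]
    exact Finset.sum_congr rfl fun p hp =>
      ins_succ_tau w (Nat.le_of_lt_succ (Finset.mem_range.1 hp)) x
  rw [map_sub, map_sub, sub_sub_sub_comm, h1]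
  abel

lemma tau_norm {n : ℕ} (x : Word k A n) : tau k A n (norm k A n x) = norm k A n x := by
  have h := Finset.sum_range_succ' (fun i => (tau k A n ^ i) x) (n + 1)
  rw [Finset.sum_range_succ, tau_pow_card, pow_zero, add_left_inj] at h
  rw [norm_apply, map_sum, h]
  exact Finset.sum_congr rfl fun i _ => (tau_pow_succ_apply i x).symm

lemma norm_tau {n : ℕ} (x : Word k A n) : norm k A n (tau k A n x) = norm k A n x := by
  conv_rhs => rw [← tau_norm]
  rw [norm_apply, norm_apply, map_sum]
  exact Finset.sum_congr rfl fun i _ => by rw [← tau_pow_succ_apply, ← tau_pow_succ_apply']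

lemma norm_tau_pow {n : ℕ} (i : ℕ) (x : Word k A n) :
    norm k A n ((tau k A n ^ i) x) = norm k A n x := by
  induction i with
  | zero => rfl
  | succ i ih => rw [tau_pow_succ_apply, norm_tau, ih]

lemma face_tau_pow {n j : ℕ} (hj : j ≤ n + 1) (x : Word k A (n + 1)) :
    face k A n j ((tau k A (n + 1) ^ j) x) = (tau k A n ^ j) (merge k 0 x) := by
  induction j with
  | zero => rw [face_zero]; rfl
  | succ j ih => rw [tau_pow_succ_apply, face_succ_tau (by omega), ih (by omega),
      ← tau_pow_succ_apply]

lemma ins_tau_pow (w : A) {n p : ℕ} (hp : p ≤ n + 1) (x : Word k A n) :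
    ins w n p ((tau k A n ^ p) x) = (tau k A (n + 1) ^ p) (cons k w x) := by
  induction p with
  | zero => rw [ins_zero]; rfl
  | succ p ih => rw [tau_pow_succ_apply, ins_succ_tau w (by omega), ih (by omega),
      ← tau_pow_succ_apply]

lemma tau_pow_norm {n : ℕ} (i : ℕ) (x : Word k A n) :
    (tau k A n ^ i) (norm k A n x) = norm k A n x := by
  induction i with
  | zero => rfl
  | succ i ih => rw [tau_pow_succ_apply, ih, tau_norm]

lemma norm_apply_reflect {n : ℕ} (x : Word k A n) :
    norm k A n x = ∑ i ∈ Finset.range (n + 1), (tau k A n ^ (n - i)) x := by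
  rw [norm_apply, ← Finset.sum_range_reflect]
  rfl

lemma tau_pow_apply_add {n : ℕ} (i j : ℕ) (x : Word k A n) :
    (tau k A n ^ (i + j)) x = (tau k A n ^ i) ((tau k A n ^ j) x) := by
  rw [pow_add]
  rfl

lemma tau_pow_card_apply {n : ℕ} (x : Word k A n) : (tau k A n ^ (n + 1)) x = x := by
  rw [tau_pow_card]
  rfl

/-- Each face is conjugate to the first one by powers of t (`face_tau_pow`). Here N absorbs the
rotations on the right, in `norm_cyc` those on the left, and b'N and Nb₀ meet in N ∘ `merge k 0` ∘
N. -/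
lemma bar_norm {n : ℕ} (x : Word k A (n + 1)) :
    bar k A n (norm k A (n + 1) x) = norm k A n (merge k 0 (norm k A (n + 1) x)) := by
  rw [bar_apply, norm_apply (merge k 0 _)]
  refine Finset.sum_congr rfl fun j hj => ?_
  rw [← face_tau_pow (Finset.mem_range.1 hj).le, tau_pow_norm]

lemma norm_cyc {n : ℕ} (x : Word k A (n + 1)) :
    norm k A n (cyc k A n x) = norm k A n (merge k 0 (norm k A (n + 1) x)) := by
  -- The extra t in front of the inner norm makes the exponents run through `n + 2 - j`, the inverse
  -- of `t ^ j` on words of `n + 2` letters.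
  rw [← tau_norm x, norm_apply_reflect x, map_sum, cyc_apply, map_sum, map_sum, map_sum]
  refine Finset.sum_congr rfl fun j hj => ?_
  have hj' : j ≤ n + 1 := Nat.le_of_lt_succ (Finset.mem_range.1 hj)
  rw [← tau_pow_succ_apply, ← norm_tau_pow j (merge k 0 _), ← face_tau_pow hj', ← tau_pow_apply_add,
    (by omega : j + (n + 1 - j + 1) = n + 1 + 1), tau_pow_card_apply]

lemma norm_cyc_eq {n : ℕ} (x : Word k A (n + 1)) :
    norm k A n (cyc k A n x) = bar k A n (norm k A (n + 1) x) := by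
  rw [norm_cyc, bar_norm]

lemma curv_norm (w : A) {n : ℕ} (x : Word k A n) :
    curv w n (norm k A n x) = norm k A (n + 1) (cons k w (norm k A n x)) := by
  rw [curv_apply, norm_apply (cons k w _)]
  refine Finset.sum_congr rfl fun j hj => ?_
  rw [← ins_tau_pow w (Nat.le_of_lt_succ (Finset.mem_range.1 hj)), tau_pow_norm]

/-- As for faces, both sides equal N ∘ `cons k w` ∘ N. -/
lemma norm_curv_eq (w : A) {n : ℕ} (x : Word k A n) :
    norm k A (n + 1) (curv w n x - cons k w x) = curv w n (norm k A n x) := by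
  rw [curv_norm, curv_eq, add_sub_cancel_right, norm_apply_reflect x, map_sum, map_sum, map_sum]
  refine Finset.sum_congr rfl fun j hj => ?_
  have hj' : j ≤ n := Nat.le_of_lt_succ (Finset.mem_range.1 hj)
  rw [← norm_tau_pow (j + 1) (cons k w _), ← ins_tau_pow w (by omega), ← tau_pow_apply_add,
    (by omega : j + 1 + (n - j) = n + 1), tau_pow_card_apply]

/-! The Hochschild differential and the first letter. -/

lemma merge_tau_cons (a : A) {n : ℕ} (x : Word k A n) :
    merge k 0 (tau k A (n + 1) (cons k a x)) = -mulFirst k a (tau k A n x) := by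
  have : merge k 0 ∘ₗ rotate k 1 ∘ₗ cons k a =
      (mulFirst k a ∘ₗ rotate k 1 : Word k A n →ₗ[k] Word k A n) := by
    refine word_ext fun b => ?_
    simp only [LinearMap.comp_apply, merge_word, cons_word, rotate_one_word, mulFirst_word,
      Fin.val_zero]
    refine word_congr fun i hi => ?_
    split_ifs <;> first | contradiction | omega | rfl | simp_all [mul_comm]
  have h := LinearMap.congr_fun this x
  simp only [LinearMap.comp_apply] at h
  rw [tau_apply, tau_apply, map_smul, map_smul, h, pow_succ, mul_neg_one, neg_smul]

lemma cyc_cons_zero (a : A) (x : Word k A 0) : cyc k A 0 (cons k a x) = 0 := by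
  rw [cyc_eq, bar_cons_zero, merge_tau_cons, tau_zero, add_neg_cancel]

/-- This recursion expresses b₀ through 1-t and b'. It reduces the identities of b₀ and β' to those
of b' and β and to the relations with 1-t. -/
lemma cyc_cons (a : A) {n : ℕ} (x : Word k A (n + 1)) :
    cyc k A (n + 1) (cons k a x) =
      mulFirst k a (x - tau k A (n + 1) x) - cons k a (bar k A n x) := by
  rw [cyc_eq, bar_cons, merge_tau_cons, map_sub]
  abel

lemma cyc_mulFirst (a : A) {n : ℕ} (x : Word k A (n + 1)) :
    cyc k A n (mulFirst k a x) = mulFirst k a (cyc k A n x) := by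
  have : cyc k A n ∘ₗ mulFirst k a = mulFirst k a ∘ₗ cyc k A n := by
    refine word_ext_cons fun b y => ?_
    simp only [LinearMap.comp_apply, mulFirst_cons]
    cases n with
    | zero => rw [cyc_cons_zero, cyc_cons_zero, map_zero]
    | succ n =>
      rw [cyc_cons, cyc_cons, map_sub (mulFirst k a), mulFirst_mulFirst, mulFirst_cons]
  exact LinearMap.congr_fun this x

lemma cyc_cyc {n : ℕ} (x : Word k A (n + 2)) : cyc k A n (cyc k A (n + 1) x) = 0 := by
  have : cyc k A n ∘ₗ cyc k A (n + 1) = 0 := by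
    refine word_ext_cons fun a y => ?_
    rw [LinearMap.comp_apply, cyc_cons, map_sub, cyc_mulFirst, cyc_sub_tau, LinearMap.zero_apply]
    cases n with
    | zero => rw [cyc_cons_zero, tau_zero, sub_self, map_zero, sub_zero]
    | succ n => rw [cyc_cons, bar_bar, map_zero, sub_zero, sub_self]
  exact LinearMap.congr_fun this x

/-- `∑_{j ≤ n} (-1)^{j+1} (a_0, …, a_j, w, a_{j+1}, …, a_n)`. -/
def curv' (w : A) (n : ℕ) : Word k A n →ₗ[k] Word k A (n + 1) := curv w n - cons k w

lemma curv'_apply (w : A) {n : ℕ} (x : Word k A n) : curv' w n x = curv w n x - cons k w x := rfl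

lemma curv'_letter (w a : A) : curv' w 0 (letter k a) = -cons k a (letter k w) := by
  rw [curv'_apply, curv_letter, cons_letter a w]
  abel

lemma curv'_cons (w a : A) {n : ℕ} (x : Word k A n) :
    curv' w (n + 1) (cons k a x) = -cons k a (curv w n x) := by
  rw [curv'_apply, curv_cons]
  abel

lemma curv'_mulFirst (w a : A) {n : ℕ} (x : Word k A n) :
    curv' w n (mulFirst k a x) = mulFirst k a (curv' w n x) := by
  rw [curv'_apply, curv'_apply, curv_mulFirst, map_sub, mulFirst_cons]
  abel

lemma curv'_curv' (w : A) {n : ℕ} (x : Word k A n) : curv' w (n + 1) (curv' w n x) = 0 := by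
  have : curv' w (n + 1) ∘ₗ curv' w n = (0 : Word k A n →ₗ[k] _) := by
    cases n with
    | zero =>
      refine word_ext_zero fun a => ?_
      rw [LinearMap.comp_apply, curv'_letter, map_neg, curv'_cons, curv_letter, cons_letter,
        sub_self, map_zero, neg_zero, neg_zero]
      rfl
    | succ n =>
      refine word_ext_cons fun a y => ?_
      rw [LinearMap.comp_apply, curv'_cons, map_neg, curv'_cons, curv_curv, map_zero, neg_zero,
        neg_zero]
      rfl
  exact LinearMap.congr_fun this x

lemma cyc_curv'_zero (w : A) (x : Word k A 0) : cyc k A 0 (curv' w 0 x) = 0 := by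
  have : cyc k A 0 ∘ₗ curv' w 0 = 0 := by
    refine word_ext_zero fun a => ?_
    rw [LinearMap.comp_apply, curv'_letter, map_neg, cyc_cons_zero, neg_zero]
    rfl
  exact LinearMap.congr_fun this x

lemma curv'_sub_tau (w : A) {n : ℕ} (x : Word k A n) :
    curv' w n (x - tau k A n x) = curv w n x - tau k A (n + 1) (curv w n x) :=
  curv_sub_tau w x

/-- After `cyc_cons` and `curv'_cons`, the terms with 1-t match by β'(1-t) = (1-t)β and the terms
behind the first letter by b'β + βb' = 0. -/
lemma cyc_curv' (w : A) {n : ℕ} (x : Word k A (n + 1)) :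
    cyc k A (n + 1) (curv' w (n + 1) x) + curv' w n (cyc k A n x) = 0 := by
  have : cyc k A (n + 1) ∘ₗ curv' w (n + 1) + curv' w n ∘ₗ cyc k A n = 0 := by
    refine word_ext_cons fun a y => ?_
    simp only [LinearMap.comp_apply, LinearMap.add_apply, LinearMap.zero_apply]
    rw [curv'_cons, map_neg, cyc_cons, ← curv'_sub_tau]
    cases n with
    | zero => rw [cyc_cons_zero, tau_zero, sub_self, bar_curv_zero]; simp
    | succ n =>
      rw [cyc_cons, map_sub (curv' w (n + 1)) (mulFirst k a _), curv'_mulFirst, curv'_cons,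
        eq_neg_of_add_eq_zero_left (bar_curv w y), map_neg]
      abel
  exact LinearMap.congr_fun this x

end Calculus

/-! ### The Cartan homotopy `V` -/

section Contraction

variable {k : Type*} [Field k] {A : Type*} [CommRing A] [Algebra k A]

/-- The sum of all `v_{j,p}`, with signs. -/
def vee (w : A) (n : ℕ) : Word k A n →ₗ[k] Word k A (n + 1) :=
  ∑ l ∈ Finset.range (n + 1), ∑ p ∈ Finset.range (l + 1), ins w n p ∘ₗ (tau k A n ^ l)

lemma vee_apply (w : A) {n : ℕ} (x : Word k A n) :
    vee w n x = ∑ l ∈ Finset.range (n + 1), ∑ p ∈ Finset.range (l + 1),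
      ins w n p ((tau k A n ^ l) x) := by
  rw [vee, LinearMap.sum_apply]
  refine Finset.sum_congr rfl fun l _ => ?_
  rw [LinearMap.sum_apply]
  rfl

lemma vee_sub_tau (w : A) {n : ℕ} (x : Word k A n) :
    vee w n (x - tau k A n x) = norm k A (n + 1) (cons k w x) - curv w n x := by
  -- The outer sum cut off after `m` terms telescopes, leaving the diagonal terms `ins l (t ^ l x) =
  -- t ^ l (w, x)` and one boundary sum. At `m = n + 1` that sum is taken at x itself, since `t ^ (n
  -- + 1) = 1`.
  have h1 : ∀ m ≤ n + 1, ∑ l ∈ Finset.range m, ∑ p ∈ Finset.range (l + 1),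
      ins w n p ((tau k A n ^ l) (x - tau k A n x)) =
      ∑ l ∈ Finset.range m, (tau k A (n + 1) ^ l) (cons k w x) -
        ∑ p ∈ Finset.range m, ins w n p ((tau k A n ^ m) x) := by
    intro m hm
    induction m with
    | zero => simp
    | succ m ih =>
      rw [Finset.sum_range_succ, ih (by omega), Finset.sum_range_succ _ m]
      simp only [map_sub, ← tau_pow_succ_apply', Finset.sum_sub_distrib]
      rw [Finset.sum_range_succ (fun l => (tau k A (n + 1) ^ l) (cons k w x)),
        Finset.sum_range_succ (fun p => ins w n p ((tau k A n ^ (m + 1)) x)),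
        ins_tau_pow w (by omega)]
      abel
  rw [vee_apply, h1 _ le_rfl, tau_pow_card_apply, norm_apply, Finset.sum_range_succ _ (n + 1),
    curv_apply, Finset.sum_range_succ _ (n + 1), ← ins_tau_pow w le_rfl, tau_pow_card_apply]
  abel

lemma vee_sub_tau_vee (w : A) {n : ℕ} (x : Word k A n) :
    vee w n x - tau k A (n + 1) (vee w n x) = cons k w (norm k A n x) - curv' w n x := by
  -- Applying t to row `l` gives row `l + 1` without its insertion in front; what remains are these
  -- insertions and one boundary row.
  have h1 : ∀ m ≤ n + 1, ∑ l ∈ Finset.range m, ∑ p ∈ Finset.range (l + 1),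
      ins w n p ((tau k A n ^ l) x) - tau k A (n + 1) (∑ l ∈ Finset.range m,
        ∑ p ∈ Finset.range (l + 1), ins w n p ((tau k A n ^ l) x)) =
      ∑ l ∈ Finset.range m, cons k w ((tau k A n ^ l) x) -
        ∑ p ∈ Finset.range m, ins w n (p + 1) ((tau k A n ^ m) x) := by
    intro m hm
    induction m with
    | zero => simp
    | succ m ih =>
      have h2 : tau k A (n + 1) (∑ p ∈ Finset.range (m + 1), ins w n p ((tau k A n ^ m) x)) =
          ∑ p ∈ Finset.range (m + 1), ins w n (p + 1) ((tau k A n ^ (m + 1)) x) := by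
        rw [map_sum]
        refine Finset.sum_congr rfl fun p hp => ?_
        have := Finset.mem_range.1 hp
        rw [tau_pow_succ_apply, ins_succ_tau w (by omega)]
      rw [Finset.sum_range_succ, map_add, add_sub_add_comm, ih (by omega), h2,
        Finset.sum_range_succ' (fun p => ins w n p ((tau k A n ^ m) x)), ins_zero,
        Finset.sum_range_succ (fun l => cons k w ((tau k A n ^ l) x))]
      abel
  rw [vee_apply, h1 _ le_rfl, tau_pow_card_apply, norm_apply, map_sum, curv'_apply, curv_eq]
  abel

lemma insertAt_insertAt (w : A) {n j p : ℕ} (hjp : j ≤ p) (hp : p < n + 2) (x : Word k A n) :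
    insertAt k w ⟨j, by omega⟩ (insertAt k w ⟨p, hp⟩ x) =
      insertAt k w ⟨p + 1, by omega⟩ (insertAt k w ⟨j, by omega⟩ x) := by
  have : insertAt k w ⟨j, by omega⟩ ∘ₗ insertAt k w (n := n) ⟨p, hp⟩ =
      insertAt k w ⟨p + 1, by omega⟩ ∘ₗ insertAt k w ⟨j, by omega⟩ := by
    refine word_ext fun b => ?_
    simp only [LinearMap.comp_apply, insertAt_word]
    refine word_congr fun i hi => ?_
    split_ifs <;> first | contradiction | omega | rfl
  exact LinearMap.congr_fun this x

lemma ins_ins (w : A) {n j p : ℕ} (hjp : j ≤ p) (hp : p ≤ n + 1) (x : Word k A n) :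
    ins w (n + 1) j (ins w n p x) = -ins w (n + 1) (p + 1) (ins w n j x) := by
  rw [ins_of_lt w (by omega : j < n + 1 + 2), ins_of_lt w (by omega : p < n + 2),
    ins_of_lt w (by omega : p + 1 < n + 1 + 2), ins_of_lt w (by omega : j < n + 2)]
  simp only [LinearMap.smul_apply, map_smul, smul_smul]
  rw [insertAt_insertAt w hjp (by omega), ← neg_smul]
  congr 1
  ring

lemma curv_ins (w : A) {n p : ℕ} (hp : p ≤ n + 1) (x : Word k A n) :
    curv w (n + 1) (ins w n p x) =
      -ins w (n + 1) (p + 1) (∑ j ∈ Finset.range (p + 1), ins w n j x) -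
        ins w (n + 1) p (curv w n x - ∑ j ∈ Finset.range p, ins w n j x) := by
  have h1 : curv w n x - ∑ j ∈ Finset.range p, ins w n j x =
      ∑ j ∈ Finset.Ico p (n + 2), ins w n j x := by
    rw [curv_apply, ← Finset.sum_range_add_sum_Ico _ (by omega : p ≤ n + 2), add_sub_cancel_left]
  rw [h1, curv_apply, ← Finset.sum_range_add_sum_Ico _ (by omega : p + 1 ≤ n + 1 + 2),
    sub_eq_add_neg, map_sum, map_sum, ← Finset.sum_neg_distrib, ← Finset.sum_neg_distrib,
    ← Finset.sum_Ico_add']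
  congr 1
  · refine Finset.sum_congr rfl fun j hj => ?_
    exact ins_ins w (Nat.le_of_lt_succ (Finset.mem_range.1 hj)) hp x
  · refine Finset.sum_congr rfl fun j hj => ?_
    rw [Finset.mem_Ico] at hj
    rw [ins_ins w hj.1 (by omega), neg_neg]

/-- Two insertions anticommute after a shift of index (`ins_ins`), so the sum over `p` telescopes.
-/
lemma sum_curv_ins (w : A) {n l : ℕ} (hl : l ≤ n + 1) (x : Word k A n) :
    ∑ p ∈ Finset.range (l + 1), curv w (n + 1) (ins w n p x) =
      -ins w (n + 1) (l + 1) (∑ j ∈ Finset.range (l + 1), ins w n j x) -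
        ∑ p ∈ Finset.range (l + 1), ins w (n + 1) p (curv w n x) := by
  induction l with
  | zero =>
    rw [Finset.sum_range_one, curv_ins w hl, Finset.sum_range_one, Finset.sum_range_one,
      Finset.sum_range_zero, sub_zero]
  | succ l ih =>
    rw [Finset.sum_range_succ, ih (by omega), curv_ins w hl, Finset.sum_range_succ _ (l + 1),
      map_sub]
    rw [Finset.sum_range_succ (fun p => ins w (n + 1) p (curv w n x)) (l + 1)]
    abel

lemma tau_sum_ins (w : A) {n m : ℕ} (hm : m ≤ n + 1) (x : Word k A n) :
    tau k A (n + 1) (∑ j ∈ Finset.range m, ins w n j x) =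
      ∑ j ∈ Finset.range (m + 1), ins w n j (tau k A n x) - cons k w (tau k A n x) := by
  rw [Finset.sum_range_succ', ins_zero, add_sub_cancel_right, map_sum]
  refine Finset.sum_congr rfl fun j hj => ?_
  have := Finset.mem_range.1 hj
  rw [ins_succ_tau w (by omega)]

lemma curv'_tau (w : A) {n : ℕ} (x : Word k A n) :
    curv' w n (tau k A n x) = tau k A (n + 1) (curv w n x) - cons k w x := by
  have := curv'_sub_tau w x
  rw [map_sub, curv'_apply w x] at this
  rw [← sub_eq_zero] at this ⊢
  rw [← neg_eq_zero, ← this]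
  abel

/-- Of the insertions in `curv' w n x`, those which are not rotated past the end become insertions
of `t ^ (l + 1) x` at places greater than `l + 1`. The others restart at the front, and the step in
which w itself passes the end does not rotate x, so they become insertions of `t ^ l x` at places at
most `l`. -/
lemma tau_pow_curv' (w : A) {n l : ℕ} (hl : l ≤ n) (x : Word k A n) :
    (tau k A (n + 1) ^ (l + 1)) (curv' w n x) +
        ∑ j ∈ Finset.range (l + 1 + 1), ins w n j ((tau k A n ^ (l + 1)) x) =
      curv w n ((tau k A n ^ (l + 1)) x) +
        ∑ j ∈ Finset.range (l + 1), ins w n j ((tau k A n ^ l) x) := by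
  induction l with
  | zero =>
    have h := curv'_tau w x
    have h2 : tau k A (n + 1) (curv' w n x) = tau k A (n + 1) (curv w n x) -
        tau k A (n + 1) (cons k w x) := by rw [curv'_apply, map_sub]
    rw [zero_add, pow_one, pow_one, pow_zero, Finset.sum_range_one, Finset.sum_range_succ,
      Finset.sum_range_one, ins_zero, h2, ins_succ_tau w (Nat.zero_le n), ins_zero]
    rw [curv'_apply] at h
    change _ = _ + cons k w x
    rw [sub_eq_iff_eq_add] at h
    rw [h]
    abel
  | succ l ih =>
    have h := congrArg (tau k A (n + 1)) (ih (by omega))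
    rw [map_add, map_add, tau_sum_ins w (by omega), tau_sum_ins w (by omega),
      ← tau_pow_succ_apply, ← tau_pow_succ_apply, ← tau_pow_succ_apply] at h
    have h3 := curv'_tau w ((tau k A n ^ (l + 1)) x)
    rw [← tau_pow_succ_apply, curv'_apply, eq_comm, sub_eq_iff_eq_add] at h3
    rw [h3] at h
    rw [← sub_eq_zero] at h ⊢
    rw [← h]
    abel

lemma vee_curv' (w : A) {n : ℕ} (x : Word k A n) :
    vee w (n + 1) (curv' w n x) + curv w (n + 1) (vee w n x) = 0 := by
  -- The first double sum has one more row than the second because `vee w (n + 1)` runs over the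
  -- rotations of words with one more letter. At `m = n + 1` the inner sum over `j` is all of `curv
  -- w n x` and the right hand side vanishes.
  have h1 : ∀ m ≤ n + 1, ∑ l ∈ Finset.range (m + 1), ∑ p ∈ Finset.range (l + 1),
      ins w (n + 1) p ((tau k A (n + 1) ^ l) (curv' w n x)) +
        ∑ l ∈ Finset.range m, ∑ p ∈ Finset.range (l + 1),
          curv w (n + 1) (ins w n p ((tau k A n ^ l) x)) =
      ∑ p ∈ Finset.range (m + 1), ins w (n + 1) p (curv w n ((tau k A n ^ m) x)
        - ∑ j ∈ Finset.range (m + 1), ins w n j ((tau k A n ^ m) x)) := by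
    intro m hm
    induction m with
    | zero =>
      simp [curv'_apply, ins_zero]
    | succ m ih =>
      rw [Finset.sum_range_succ _ (m + 1), Finset.sum_range_succ (fun l =>
          ∑ p ∈ Finset.range (l + 1), curv w (n + 1) (ins w n p ((tau k A n ^ l) x))) m,
        add_add_add_comm, ih (by omega), sum_curv_ins w (by omega), eq_sub_of_add_eq (tau_pow_curv' w (by omega : m ≤ n) x)]
      simp only [map_sub, map_add, Finset.sum_sub_distrib, Finset.sum_add_distrib]
      rw [Finset.sum_range_succ (fun p => ins w (n + 1) p (∑ j ∈ Finset.range (m + 1),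
        ins w n j ((tau k A n ^ m) x))) (m + 1)]
      abel
  have h2 := h1 _ le_rfl
  rw [vee_apply, vee_apply, map_sum]
  simp only [map_sum]
  rw [h2, ← curv_apply, sub_self]
  simp

lemma merge_insertAt_of_lt (w : A) {n j p : ℕ} (hjp : j + 2 ≤ p) (hp : p < n + 3)
    (x : Word k A (n + 1)) :
    merge k ⟨j, by omega⟩ (insertAt k w ⟨p, hp⟩ x) =
      insertAt k w ⟨p - 1, by omega⟩ (merge k (n := n) ⟨j, by omega⟩ x) := by
  have : merge k ⟨j, by omega⟩ ∘ₗ insertAt k w (n := n + 1) ⟨p, hp⟩ =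
      insertAt k w ⟨p - 1, by omega⟩ ∘ₗ merge k ⟨j, by omega⟩ := by
    refine word_ext fun b => ?_
    simp only [LinearMap.comp_apply, insertAt_word, merge_word]
    refine word_congr fun i hi => ?_
    split_ifs <;> first
      | contradiction
      | omega
      | rfl
      | (congr 1; omega)
  exact LinearMap.congr_fun this x

lemma merge_insertAt_of_gt (w : A) {n j p : ℕ} (hjp : p + 1 ≤ j) (hj : j < n + 2)
    (x : Word k A (n + 1)) :
    merge k ⟨j, hj⟩ (insertAt k w ⟨p, by omega⟩ x) =
      insertAt k w ⟨p, by omega⟩ (merge k (n := n) ⟨j - 1, by omega⟩ x) := by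
  have : merge k ⟨j, hj⟩ ∘ₗ insertAt k w (n := n + 1) ⟨p, by omega⟩ =
      insertAt k w ⟨p, by omega⟩ ∘ₗ merge k ⟨j - 1, by omega⟩ := by
    refine word_ext fun b => ?_
    simp only [LinearMap.comp_apply, insertAt_word, merge_word]
    refine word_congr fun i hi => ?_
    split_ifs <;> first
      | contradiction
      | omega
      | rfl
      | (congr 1; omega)
      | (refine congrArg₂ (· * ·) (congrArg b ?_) (congrArg b ?_) <;> omega)
  exact LinearMap.congr_fun this x

lemma merge_insertAt_succ (w : A) {n j : ℕ} (hj : j < n + 1) (x : Word k A n) :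
    merge k ⟨j, hj⟩ (insertAt k w ⟨j + 1, by omega⟩ x) =
      merge k ⟨j, hj⟩ (insertAt k w ⟨j, by omega⟩ x) := by
  have : merge k ⟨j, hj⟩ ∘ₗ insertAt k w (n := n) ⟨j + 1, by omega⟩ =
      merge k ⟨j, hj⟩ ∘ₗ insertAt k w ⟨j, by omega⟩ := by
    refine word_ext fun b => ?_
    simp only [LinearMap.comp_apply, insertAt_word, merge_word]
    refine word_congr fun i hi => ?_
    split_ifs <;> first | contradiction | omega | rfl | exact mul_comm _ _
  exact LinearMap.congr_fun this x

lemma face_ins_of_lt (w : A) {n j p : ℕ} (hjp : j + 2 ≤ p) (hp : p ≤ n + 2)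
    (x : Word k A (n + 1)) :
    face k A (n + 1) j (ins w (n + 1) p x) = -ins w n (p - 1) (face k A n j x) := by
  rw [face_of_lt (by omega), face_of_lt (by omega), ins_of_lt w (by omega),
    ins_of_lt w (by omega)]
  simp only [LinearMap.smul_apply, map_smul, smul_smul]
  rw [merge_insertAt_of_lt w hjp (by omega), ← neg_smul]
  congr 1
  obtain ⟨q, rfl⟩ : ∃ q, p = q + 1 := ⟨p - 1, by omega⟩
  rw [Nat.add_sub_cancel]
  ring

lemma face_ins_of_gt (w : A) {n j p : ℕ} (hjp : p ≤ j) (hj : j ≤ n)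
    (x : Word k A (n + 1)) :
    face k A (n + 1) (j + 1) (ins w (n + 1) p x) = -ins w n p (face k A n j x) := by
  rw [face_of_lt (by omega), face_of_lt (by omega), ins_of_lt w (by omega),
    ins_of_lt w (by omega)]
  simp only [LinearMap.smul_apply, map_smul, smul_smul]
  rw [merge_insertAt_of_gt w (by omega) (by omega), ← neg_smul]
  congr 1
  ring

/-- Multiplying w into its right or left neighbour gives the same letter, with opposite signs. This
cancellation makes `sum_bar_ins` telescope. -/
lemma face_ins_succ (w : A) {n j : ℕ} (hj : j ≤ n) (x : Word k A n) :
    face k A n j (ins w n (j + 1) x) = -face k A n j (ins w n j x) := by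
  rw [face_of_lt (by omega), ins_of_lt w (by omega), ins_of_lt w (by omega)]
  simp only [LinearMap.smul_apply, map_smul, smul_smul]
  rw [merge_insertAt_succ w (by omega), ← neg_smul]
  congr 1
  ring

lemma bar_ins_zero (w : A) {n : ℕ} (x : Word k A (n + 1)) :
    bar k A (n + 1) (ins w (n + 1) 0 x) = face k A (n + 1) 0 (ins w (n + 1) 0 x) -
      ins w n 0 (bar k A n x) := by
  rw [bar_apply, Finset.sum_range_succ', bar_apply, map_sum, sub_eq_add_neg,
    ← Finset.sum_neg_distrib]
  refine (add_comm _ _).trans ?_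
  congr 1
  refine Finset.sum_congr rfl fun j hj => ?_
  rw [face_ins_of_gt w (Nat.zero_le j) (Nat.le_of_lt_succ (Finset.mem_range.1 hj))]

lemma bar_ins_succ (w : A) {n p : ℕ} (hp : p ≤ n) (x : Word k A (n + 1)) :
    bar k A (n + 1) (ins w (n + 1) (p + 1) x) =
      -ins w n p (∑ j ∈ Finset.range p, face k A n j x) - face k A (n + 1) p (ins w (n + 1) p x)
        + face k A (n + 1) (p + 1) (ins w (n + 1) (p + 1) x) -
        ins w n (p + 1) (bar k A n x - ∑ j ∈ Finset.range (p + 1), face k A n j x) := by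
  have h1 : bar k A n x - ∑ j ∈ Finset.range (p + 1), face k A n j x =
      ∑ j ∈ Finset.Ico (p + 1) (n + 1), face k A n j x := by
    rw [bar_apply, ← Finset.sum_range_add_sum_Ico _ (by omega : p + 1 ≤ n + 1),
      add_sub_cancel_left]
  rw [h1, bar_apply, ← Finset.sum_range_add_sum_Ico _ (by omega : p + 2 ≤ n + 1 + 1),
    Finset.sum_range_succ, Finset.sum_range_succ, face_ins_succ w (by omega : p ≤ n + 1),
    sub_eq_add_neg _ (ins w n (p + 1) _), map_sum, map_sum, ← Finset.sum_neg_distrib,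
    ← Finset.sum_neg_distrib, ← Finset.sum_Ico_add' (fun j => face k A (n + 1) j
      (ins w (n + 1) (p + 1) x)) (p + 1) (n + 1) 1, ← sub_eq_add_neg (Finset.sum _ _) (face k A _ _ _)]
  congr 1
  · congr 2
    refine Finset.sum_congr rfl fun j hj => ?_
    have := Finset.mem_range.1 hj
    rw [face_ins_of_lt w (by omega) (by omega), Nat.add_sub_cancel]
  · refine Finset.sum_congr rfl fun j hj => ?_
    rw [Finset.mem_Ico] at hj
    rw [face_ins_of_gt w hj.1 (by omega)]

lemma sum_bar_ins (w : A) {n l : ℕ} (hl : l ≤ n + 1) (x : Word k A (n + 1)) :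
    ∑ p ∈ Finset.range (l + 1), bar k A (n + 1) (ins w (n + 1) p x) =
      face k A (n + 1) l (ins w (n + 1) l x) + ins w n l (∑ j ∈ Finset.range l, face k A n j x) -
        ∑ p ∈ Finset.range (l + 1), ins w n p (bar k A n x) := by
  induction l with
  | zero =>
    rw [Finset.sum_range_one, bar_ins_zero, Finset.sum_range_zero, map_zero, add_zero,
      Finset.sum_range_one]
  | succ l ih =>
    rw [Finset.sum_range_succ, ih (by omega), bar_ins_succ w (by omega), map_sub]
    rw [Finset.sum_range_succ (fun p => ins w n p (bar k A n x)) (l + 1)]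
    abel

lemma tau_sum_face {n m : ℕ} (hm : m ≤ n + 1) (x : Word k A (n + 1)) :
    tau k A n (∑ j ∈ Finset.range m, face k A n j x) =
      ∑ j ∈ Finset.range (m + 1), face k A n j (tau k A (n + 1) x) -
        merge k 0 (tau k A (n + 1) x) := by
  rw [Finset.sum_range_succ', face_zero, add_sub_cancel_right, map_sum]
  refine Finset.sum_congr rfl fun j hj => ?_
  have := Finset.mem_range.1 hj
  rw [face_succ_tau (by omega)]

lemma tau_bar {n : ℕ} (x : Word k A (n + 1)) :
    tau k A n (bar k A n x) = bar k A n (tau k A (n + 1) x) +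
      merge k 0 ((tau k A (n + 1) ^ 2) x) - merge k 0 (tau k A (n + 1) x) := by
  rw [eq_sub_iff_add_eq, ← cyc_tau, cyc_eq, pow_two]
  rfl

/-- The counterpart of `tau_pow_curv'` for faces: faces which wrap around the end lag one rotation
behind or ahead of the others, whence the two different powers of t. -/
lemma tau_pow_cyc {n l : ℕ} (hl : l ≤ n) (x : Word k A (n + 1)) :
    (tau k A n ^ l) (cyc k A n x) =
      bar k A n ((tau k A (n + 1) ^ l) x) -
        ∑ j ∈ Finset.range l, face k A n j ((tau k A (n + 1) ^ l) x) +
        ∑ j ∈ Finset.range (l + 1), face k A n j ((tau k A (n + 1) ^ (l + 1)) x) := by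
  induction l with
  | zero =>
    rw [zero_add, pow_zero, pow_zero, pow_one, Finset.sum_range_zero, sub_zero,
      Finset.sum_range_one, face_zero]
    exact cyc_eq x
  | succ l ih =>
    rw [tau_pow_succ_apply, ih (by omega), map_add, map_sub, tau_sum_face (by omega),
      tau_sum_face (by omega), tau_bar, ← tau_pow_succ_apply, ← tau_pow_succ_apply,
      ← tau_pow_apply_add, add_comm 2 l]
    abel

lemma face_ins_tau_pow (w : A) {n l : ℕ} (hl : l ≤ n) (x : Word k A n) :
    face k A n l (ins w n l ((tau k A n ^ l) x)) = (tau k A n ^ l) (mulFirst k w x) := by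
  rw [ins_tau_pow w (by omega), face_tau_pow (by omega), merge_zero_cons]

lemma bar_vee_zero (w : A) (x : Word k A 0) : bar k A 0 (vee w 0 x) = mulFirst k w x := by
  have h : vee w 0 x = cons k w x := by
    rw [vee_apply]
    simp [ins_zero]
  rw [h]
  exact bar_cons_zero w x

/-- In each row `l` of b'V only the face multiplying w into the letter on its right survives the
telescoping; it equals `t ^ l (mulFirst k w x)`, and these sum to the norm. The remaining boundary
terms cancel against `vee w n (cyc k A n x)`. -/
lemma bar_vee (w : A) {n : ℕ} (x : Word k A (n + 1)) :
    bar k A (n + 1) (vee w (n + 1) x) + vee w n (cyc k A n x) =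
      norm k A (n + 1) (mulFirst k w x) := by
  have h1 : ∀ m ≤ n + 1, ∑ l ∈ Finset.range m, ∑ p ∈ Finset.range (l + 1),
        bar k A (n + 1) (ins w (n + 1) p ((tau k A (n + 1) ^ l) x)) +
      ∑ l ∈ Finset.range m, ∑ p ∈ Finset.range (l + 1),
        ins w n p ((tau k A n ^ l) (cyc k A n x)) =
      ∑ l ∈ Finset.range m, (tau k A (n + 1) ^ l) (mulFirst k w x) +
        ∑ p ∈ Finset.range m,
          ins w n p (∑ j ∈ Finset.range m, face k A n j ((tau k A (n + 1) ^ m) x)) := by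
    intro m hm
    induction m with
    | zero => simp
    | succ m ih =>
      rw [Finset.sum_range_succ (fun l => ∑ p ∈ Finset.range (l + 1),
          bar k A (n + 1) (ins w (n + 1) p ((tau k A (n + 1) ^ l) x))) m,
        Finset.sum_range_succ (fun l => ∑ p ∈ Finset.range (l + 1),
          ins w n p ((tau k A n ^ l) (cyc k A n x))) m,
        add_add_add_comm, ih (by omega), sum_bar_ins w (by omega), tau_pow_cyc (by omega), face_ins_tau_pow w (by omega),
        Finset.sum_range_succ (fun l => (tau k A (n + 1) ^ l) (mulFirst k w x)) m]
      simp only [map_sub, map_add, Finset.sum_sub_distrib, Finset.sum_add_distrib]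
      rw [Finset.sum_range_succ (fun p => ins w n p (∑ j ∈ Finset.range m,
        face k A n j ((tau k A (n + 1) ^ m) x))) m]
      abel
  have h2 := h1 _ le_rfl
  rw [vee_apply, vee_apply, map_sum, norm_apply, Finset.sum_range_succ (fun l => bar k A (n + 1)
      (∑ p ∈ Finset.range (l + 1), ins w (n + 1) p ((tau k A (n + 1) ^ l) x))) (n + 1)]
  simp only [map_sum (bar k A (n + 1))]
  rw [sum_bar_ins w le_rfl, face_ins_tau_pow w le_rfl, add_right_comm, h2, ← bar_apply,
    Finset.sum_range_succ (fun l => (tau k A (n + 1) ^ l) (mulFirst k w x)) (n + 1),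
    Finset.sum_range_succ (fun p => ins w n p (bar k A n ((tau k A (n + 1) ^ (n + 1)) x)))
      (n + 1)]
  abel

end Contraction

/-! ### Coefficients of Laurent series -/

section LaurentCoefficients

variable {k : Type*} [Field k] {C C' : Type*} [AddCommGroup C] [Module k C]
  [AddCommGroup C'] [Module k C']

lemma laurent_ext {x y : Laurent k C} (h : ∀ m, uCoeff k m x = uCoeff k m y) : x = y :=
  HahnModule.ext _ _ (funext h)

lemma uCoeff_add (m : ℤ) (x y : Laurent k C) : uCoeff k m (x + y) = uCoeff k m x + uCoeff k m y :=
  rfl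

lemma uCoeff_sub (m : ℤ) (x y : Laurent k C) : uCoeff k m (x - y) = uCoeff k m x - uCoeff k m y :=
  rfl

lemma uCoeff_laurentMap (f : C →ₗ[k] C') (m : ℤ) (x : Laurent k C) :
    uCoeff k m (laurentMap f x) = f (uCoeff k m x) := rfl

lemma uCoeff_uDeriv (m : ℤ) (x : Laurent k C) :
    uCoeff k m (uDeriv x) = (m + 1) • uCoeff k (m + 1) x :=
  by
  change ((LaurentSeries.derivative k) ((HahnModule.of k).symm x)).coeff m = _
  rw [LaurentSeries.derivative_apply, LaurentSeries.hasseDeriv_coeff, Nat.cast_one, Ring.choose_one_right]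
  rfl

lemma uCoeff_uMonomial_smul (m j : ℤ) (r : k) (x : Laurent k C) :
    uCoeff k m (uMonomial k j r • x) = r • uCoeff k (m - j) x := by
  have h := HahnModule.coeff_single_smul_vadd (R := k) (V := C) (Γ := ℤ) (Γ' := ℤ) (r := r) (x := x)
    (a := m - j) (b := j)
  rw [vadd_eq_add, add_sub_cancel] at h
  exact h

lemma uCoeff_totalDiff (b B : C →ₗ[k] C) (m : ℤ) (x : Laurent k C) :
    uCoeff k m (totalDiff b B x) = b (uCoeff k m x) + B (uCoeff k (m - 1) x) := by
  rw [totalDiff, LinearMap.add_apply, LinearMap.smul_apply, uCoeff_add, uCoeff_uMonomial_smul,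
    uCoeff_laurentMap, uCoeff_laurentMap, one_smul]

/-- The hypotheses are the coefficients of u⁻², u⁻¹ and u⁰ in [d/du + U/u² + V/u, b + uB] = (b +
uB)/2u. The summand `B x` in `h₃` comes from differentiating uB. -/
lemma isUConnection_of_commutators {b B U V : C →ₗ[k] C} (h₁ : ∀ x, U (b x) = b (U x))
    (h₂ : ∀ x, U (B x) - B (U x) + V (b x) - b (V x) = (1 / 2 : k) • b x)
    (h₃ : ∀ x, V (B x) - B (V x) + B x = (1 / 2 : k) • B x) :
    IsUConnection b B (uDeriv + (uMonomial k (-2) 1 • laurentMap U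
      + uMonomial k (-1) 1 • laurentMap V).restrictScalars k) where
  form := ⟨uMonomial k (-2) 1 • laurentMap U + uMonomial k (-1) 1 • laurentMap V, fun _ => rfl⟩
  commutator x := by
    refine laurent_ext fun m => ?_
    simp only [LinearMap.add_apply, LinearMap.restrictScalars_apply, LinearMap.smul_apply,
      uCoeff_add, uCoeff_sub, uCoeff_totalDiff, uCoeff_uMonomial_smul, uCoeff_laurentMap,
      uCoeff_uDeriv, map_add, map_zsmul, map_smul, one_smul]
    have e₁ : m - 1 - -2 = m + 1 := by ring
    have e₂ : m - 1 - -1 = m := by ring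
    have e₃ : m - -2 = m + 2 := by ring
    have e₄ : m - -1 = m + 1 := by ring
    have e₅ : m + 2 - 1 = m + 1 := by ring
    have e₆ : m + 1 - 1 = m := by ring
    have e₇ : m - 1 + 1 = m := by ring
    simp only [e₁, e₂, e₃, e₄, e₅, e₆, e₇]
    have h₂' := h₂ (uCoeff k (m + 1) x)
    have h₃' := h₃ (uCoeff k m x)
    rw [smul_add (1 / 2 : k), ← h₂', ← h₃', h₁]
    module

end LaurentCoefficients

/-! ### The operators on the two columns of the Hochschild complex -/

section Operators

variable {k : Type*} [Field k] {A : Type*} [CommRing A] [Algebra k A] (W : A)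

lemma bar_eq_sum (n : ℕ) :
    bar k A n = ∑ j : Fin (n + 1), (-1 : k) ^ (j : ℕ) • merge k j := by
  rw [bar, Finset.sum_range]
  exact Finset.sum_congr rfl fun j _ => face_of_lt j.2

lemma cyc_eq_sum (n : ℕ) :
    cyc k A n = (∑ j : Fin (n + 1), (-1 : k) ^ (j : ℕ) • merge k j)
        + (-1 : k) ^ (n + 1) • (merge k 0 ∘ₗ rotate k 1) := by
  refine LinearMap.ext fun x => ?_
  rw [cyc_eq, tau_apply, map_smul, bar_eq_sum]
  rfl

lemma curv_eq_sum (n : ℕ) :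
    curv (k := k) W n = ∑ j : Fin (n + 2), (-1 : k) ^ (j : ℕ) • insertAt k W j := by
  rw [curv, Finset.sum_range]
  exact Finset.sum_congr rfl fun j _ => ins_of_lt W j.2

lemma curv'_eq_sum (n : ℕ) :
    curv' (k := k) W n = ∑ j : Fin (n + 1), (-1 : k) ^ ((j : ℕ) + 1) • insertAt k W j.succ := by
  rw [curv', curv_eq_sum, Fin.sum_univ_succ]
  simp [cons]

lemma norm_eq_sum (n : ℕ) :
    norm k A n = ∑ j : Fin (n + 1), (-1 : k) ^ (n * (j : ℕ)) • rotate k j := by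
  rw [norm, Finset.sum_range]
  exact Finset.sum_congr rfl fun j _ => by rw [tau_pow, rotate_one_pow]

lemma vee_eq_sum (n : ℕ) :
    vee (k := k) W n =
      ∑ j : Fin (n + 1), ∑ p ∈ Finset.univ.filter (fun p : Fin (n + 2) => (p : ℕ) ≤ (j : ℕ)),
        (-1 : k) ^ (n * (j : ℕ) + (p : ℕ)) • (insertAt k W p ∘ₗ rotate k j) := by
  rw [vee, Finset.sum_range]
  refine Finset.sum_congr rfl fun j _ => ?_
  refine Finset.sum_bij' (fun p _ => (Fin.ofNat (n + 2) p)) (fun p _ => (p : ℕ)) ?_ ?_ ?_ ?_ ?_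
  · intro p hp
    have := Finset.mem_range.1 hp
    simp [Nat.mod_eq_of_lt (by omega : p < n + 2)]
    omega
  · intro p hp
    simpa [Nat.lt_succ_iff] using hp
  · intro p hp
    have := Finset.mem_range.1 hp
    simp [Nat.mod_eq_of_lt (by omega : p < n + 2)]
  · intro p hp
    simp
  · intro p hp
    have := Finset.mem_range.1 hp
    have h2 : p < n + 2 := by omega
    have h3 : Fin.ofNat (n + 2) p = ⟨p, h2⟩ := Fin.ext (Nat.mod_eq_of_lt h2)
    rw [ins_of_lt W h2, tau_pow, rotate_one_pow, LinearMap.smul_comp, LinearMap.comp_smul,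
      smul_smul, pow_add, h3]
    rw [mul_comm]

lemma neg_tau {n : ℕ} (x : Word k A n) :
    -tau k A n x = ((-1 : k) ^ (n + 1) • rotate k 1 : Word k A n →ₗ[k] _) x := by
  rw [tau_apply, LinearMap.smul_apply, pow_succ, mul_neg_one, neg_smul]

lemma neg_bar_eq_sum (n : ℕ) :
    -bar k A n = ∑ j : Fin (n + 1), (-1 : k) ^ ((j : ℕ) + 1) • merge k j := by
  rw [bar_eq_sum, ← Finset.sum_neg_distrib]
  exact Finset.sum_congr rfl fun j _ => by rw [pow_succ]; module

lemma neg_curv_eq_sum (n : ℕ) :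
    -curv (k := k) W n = ∑ j : Fin (n + 2), (-1 : k) ^ ((j : ℕ) + 1) • insertAt k W j := by
  rw [curv_eq_sum, ← Finset.sum_neg_distrib]
  exact Finset.sum_congr rfl fun j _ => by rw [pow_succ]; module

variable (x : HochPi k A)

lemma hochb_fst_zero :
    (hochb k W x).1 0 = cyc k A 0 (x.1 1) + (x.2 0 - tau k A 0 (x.2 0)) := by
  -- The added zero is the value of `raise` in degree 0; with it the two sides agree definitionally.
  rw [cyc_eq_sum, ← add_zero (_ + _), sub_eq_add_neg, neg_tau]
  rfl

lemma hochb_fst_succ (n : ℕ) :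
    (hochb k W x).1 (n + 1) = cyc k A (n + 1) (x.1 (n + 2)) + curv' W n (x.1 n) +
      (x.2 (n + 1) - tau k A (n + 1) (x.2 (n + 1))) := by
  rw [cyc_eq_sum, sub_eq_add_neg, neg_tau, curv'_eq_sum, add_right_comm]
  rfl

lemma hochb_snd_zero : (hochb k W x).2 0 = -bar k A 0 (x.2 1) := by
  rw [← add_zero (-_), ← LinearMap.neg_apply, neg_bar_eq_sum]
  rfl

lemma hochb_snd_succ (n : ℕ) :
    (hochb k W x).2 (n + 1) = -bar k A (n + 1) (x.2 (n + 2)) - curv W n (x.2 n) := by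
  rw [sub_eq_add_neg, ← LinearMap.neg_apply, ← LinearMap.neg_apply, neg_bar_eq_sum,
    neg_curv_eq_sum]
  rfl

lemma hochConnes_fst : (hochConnes k A x).1 = 0 := rfl

lemma hochConnes_snd (n : ℕ) : (hochConnes k A x).2 n = norm k A n (x.1 n) := by
  rw [norm_eq_sum]; rfl

lemma hochV_fst : (hochV k W x).1 = 0 := rfl

lemma hochV_snd_zero : (hochV k W x).2 0 = 0 := rfl

lemma hochV_snd_succ (n : ℕ) : (hochV k W x).2 (n + 1) = vee W n (x.1 n) := by
  rw [vee_eq_sum]; rfl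

lemma hochU_fst_zero : (hochU k W x).1 0 = mulFirst k W (x.1 0) := add_zero _

lemma hochU_fst_succ (n : ℕ) :
    (hochU k W x).1 (n + 1) = mulFirst k W (x.1 (n + 1)) + cons k W (x.2 n) := rfl

lemma hochU_snd : (hochU k W x).2 = 0 := rfl

lemma hochGamma_fst (n : ℕ) : (hochGamma k A x).1 n = (-((n : k) / 2)) • x.1 n := rfl

lemma hochGamma_snd (n : ℕ) : (hochGamma k A x).2 n = (-(((n + 1 : ℕ) : k) / 2)) • x.2 n := rfl

end Operators

/-! ### The Hochschild complex as a mixed complex with connection -/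

section MixedComplex

variable {k : Type*} [Field k] {A : Type*} [CommRing A] [Algebra k A] (W : A)

lemma hochPi_ext {x y : HochPi k A} (h₁ : ∀ n, x.1 n = y.1 n) (h₂ : ∀ n, x.2 n = y.2 n) : x = y :=
  Prod.ext (funext h₁) (funext h₂)

lemma hochb_hochb (x : HochPi k A) : hochb k W (hochb k W x) = 0 := by
  refine hochPi_ext (fun n => ?_) (fun n => ?_)
  · rcases n with _ | _ | n
    · simp only [hochb_fst_zero, hochb_fst_succ, hochb_snd_zero, map_add, cyc_cyc, cyc_curv'_zero,
        cyc_sub_tau, map_neg, Prod.fst_zero, Pi.zero_apply]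
      abel
    · simp only [hochb_fst_zero, hochb_fst_succ, hochb_snd_succ, map_add, cyc_cyc,
        cyc_sub_tau, curv'_sub_tau, map_neg, Prod.fst_zero, Pi.zero_apply]
      rw [eq_neg_of_add_eq_zero_left (cyc_curv' W (x.1 1)), map_sub, map_neg]
      abel
    · simp only [hochb_fst_succ, hochb_snd_succ, map_add, cyc_cyc,
        cyc_sub_tau, curv'_sub_tau, map_neg, Prod.fst_zero, Pi.zero_apply, curv'_curv']
      rw [eq_neg_of_add_eq_zero_left (cyc_curv' W (x.1 (n + 2))), map_sub, map_neg]
      abel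
  · rcases n with _ | _ | n
    · simp only [hochb_snd_zero, hochb_snd_succ, map_sub, map_neg, bar_bar, bar_curv_zero]
      simp
    · simp only [hochb_snd_zero, hochb_snd_succ, map_sub, map_neg, bar_bar,
        eq_neg_of_add_eq_zero_left (bar_curv W _)]
      simp
    · simp only [hochb_snd_succ, map_sub, map_neg, bar_bar, curv_curv,
        eq_neg_of_add_eq_zero_left (bar_curv W _)]
      simp

lemma hochConnes_hochConnes (x : HochPi k A) : hochConnes k A (hochConnes k A x) = 0 := by
  refine hochPi_ext (fun n => rfl) (fun n => ?_)
  rw [hochConnes_snd, hochConnes_fst, Pi.zero_apply, map_zero]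
  rfl

lemma sub_tau_norm {n : ℕ} (x : Word k A n) : norm k A n x - tau k A n (norm k A n x) = 0 := by
  rw [tau_norm, sub_self]

lemma norm_sub_tau {n : ℕ} (x : Word k A n) : norm k A n (x - tau k A n x) = 0 := by
  rw [map_sub, norm_tau, sub_self]

lemma norm_curv' {n : ℕ} (x : Word k A n) :
    norm k A (n + 1) (curv' W n x) = curv W n (norm k A n x) := norm_curv_eq W x

lemma hochb_hochConnes (x : HochPi k A) :
    hochb k W (hochConnes k A x) + hochConnes k A (hochb k W x) = 0 := by
  refine hochPi_ext (fun n => ?_) (fun n => ?_)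
  · rcases n with _ | n
    · simp [hochb_fst_zero, hochConnes_fst, hochConnes_snd, sub_tau_norm]
    · simp [hochb_fst_succ, hochConnes_fst, hochConnes_snd, sub_tau_norm]
  · rcases n with _ | n
    · simp only [Prod.snd_add, Pi.add_apply, hochb_snd_zero, hochConnes_snd, hochb_fst_zero,
        map_add, norm_cyc_eq, norm_sub_tau]
      simp
    · simp only [Prod.snd_add, Pi.add_apply, hochb_snd_succ, hochConnes_snd, hochb_fst_succ,
        map_add, norm_cyc_eq, norm_sub_tau, norm_curv']
      simp

lemma hochU_hochb (x : HochPi k A) : hochU k W (hochb k W x) = hochb k W (hochU k W x) := by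
  refine hochPi_ext (fun n => ?_) (fun n => ?_)
  · rcases n with _ | _ | n
    · simp only [hochU_fst_zero, hochb_fst_zero, hochU_fst_succ, hochU_snd, map_add, map_sub,
        cyc_mulFirst, cyc_cons_zero, tau_zero]
      simp
    · simp only [hochU_fst_zero, hochb_fst_zero, hochU_fst_succ, hochb_fst_succ, hochU_snd,
        hochb_snd_zero, map_add, map_sub, cyc_mulFirst, cyc_cons, curv'_mulFirst]
      simp
      abel
    · simp only [hochU_fst_succ, hochb_fst_succ, hochU_snd,
        hochb_snd_succ, map_add, map_sub, cyc_mulFirst, cyc_cons, curv'_mulFirst, curv'_cons]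
      simp
      abel
  · rcases n with _ | n
    · simp [hochU_snd, hochb_snd_zero]
    · simp [hochU_snd, hochb_snd_succ]

/-- The commutators of U with B and of V with b add up to the curvature part of b: `vee_sub_tau_vee`
gives it on words with first letter in `A`, the other three identities for `vee` on words with first
letter `e`. The commutator with Γ is half the product part minus half the curvature part, so the
total is b/2. -/
lemma hochConnes_commutators (h2 : (2 : k) ≠ 0) (x : HochPi k A) :
    hochU k W (hochConnes k A x) - hochConnes k A (hochU k W x) +
      (hochV k W + hochGamma k A) (hochb k W x) - hochb k W ((hochV k W + hochGamma k A) x) =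
        (1 / 2 : k) • hochb k W x := by
  refine hochPi_ext (fun n => ?_) (fun n => ?_)
  · rcases n with _ | _ | n
    · simp only [LinearMap.add_apply, map_add, Prod.fst_add, Prod.fst_sub, Pi.add_apply,
        Pi.sub_apply, hochU_fst_zero, hochConnes_fst, hochV_fst, hochGamma_fst, hochb_fst_zero,
        Prod.smul_fst, Pi.smul_apply, hochV_snd_zero, hochGamma_snd, Pi.zero_apply, map_zero,
        map_smul]
      push_cast
      match_scalars <;> field_simp <;> ring
    · simp only [LinearMap.add_apply, map_add, Prod.fst_add, Prod.fst_sub, Pi.add_apply,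
        Pi.sub_apply, hochU_fst_succ, hochConnes_fst, hochV_fst, hochGamma_fst, hochb_fst_succ,
        Prod.smul_fst, Pi.smul_apply, hochV_snd_succ, hochGamma_snd, Pi.zero_apply, map_zero,
        map_smul, hochConnes_snd]
      have h := vee_sub_tau_vee W (x.1 0)
      rw [eq_comm, sub_eq_iff_eq_add] at h
      rw [h]
      push_cast
      match_scalars <;> field_simp <;> ring
    · simp only [LinearMap.add_apply, map_add, Prod.fst_add, Prod.fst_sub, Pi.add_apply,
        Pi.sub_apply, hochU_fst_succ, hochConnes_fst, hochV_fst, hochGamma_fst, hochb_fst_succ,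
        Prod.smul_fst, Pi.smul_apply, hochV_snd_succ, hochGamma_snd, Pi.zero_apply, map_zero,
        map_smul, hochConnes_snd]
      have h := vee_sub_tau_vee W (x.1 (n + 1))
      rw [eq_comm, sub_eq_iff_eq_add] at h
      rw [h]
      push_cast
      match_scalars <;> field_simp <;> ring
  · rcases n with _ | _ | n
    · simp only [LinearMap.add_apply, map_add, Prod.snd_add, Prod.snd_sub, Pi.add_apply,
        Pi.sub_apply, hochU_fst_zero, hochU_snd, hochConnes_snd, hochV_snd_zero, hochGamma_snd,
        hochb_snd_zero, hochV_snd_succ,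
        Prod.smul_snd, Pi.smul_apply, Pi.zero_apply, map_zero, map_smul, bar_vee_zero]
      have : norm k A 0 (mulFirst k W (x.1 0)) = mulFirst k W (x.1 0) := by
        rw [norm_apply]; simp
      rw [this]
      push_cast
      match_scalars <;> field_simp <;> ring
    · simp only [LinearMap.add_apply, map_add, Prod.snd_add, Prod.snd_sub, Pi.add_apply,
        Pi.sub_apply, hochU_fst_succ, hochU_snd, hochConnes_snd, hochV_snd_zero, hochGamma_snd,
        hochb_fst_zero, hochb_snd_succ, hochV_snd_succ, vee_sub_tau,
        Prod.smul_snd, Pi.smul_apply, Pi.zero_apply, map_zero, map_smul]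
      rw [show norm k A (0 + 1) (mulFirst k W (x.1 (0 + 1))) = _ from (bar_vee W (x.1 1)).symm]
      push_cast
      match_scalars <;> field_simp <;> ring
    · simp only [LinearMap.add_apply, map_add, Prod.snd_add, Prod.snd_sub, Pi.add_apply,
        Pi.sub_apply, hochU_fst_succ, hochU_snd, hochConnes_snd, hochGamma_snd,
        hochb_fst_succ, hochb_snd_succ, hochV_snd_succ, vee_sub_tau,
        Prod.smul_snd, Pi.smul_apply, Pi.zero_apply, map_zero, map_smul]
      rw [← bar_vee W (x.1 (n + 2)), eq_neg_of_add_eq_zero_left (vee_curv' W (x.1 n))]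
      push_cast
      match_scalars <;> field_simp <;> ring

/-- Both V and B vanish on the e-column and take values in it, so V contributes nothing; B raises
the degree by one, so [Γ, B] = -B/2. -/
lemma hochGamma_hochConnes (h2 : (2 : k) ≠ 0) (x : HochPi k A) :
    (hochV k W + hochGamma k A) (hochConnes k A x) -
      hochConnes k A ((hochV k W + hochGamma k A) x) + hochConnes k A x =
        (1 / 2 : k) • hochConnes k A x := by
  refine hochPi_ext (fun n => ?_) (fun n => ?_)
  · simp only [LinearMap.add_apply, map_add, Prod.fst_add, Prod.fst_sub, Pi.add_apply,
      Pi.sub_apply, hochConnes_fst, hochV_fst, hochGamma_fst, Prod.smul_fst, Pi.smul_apply,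
      Pi.zero_apply, smul_zero, add_zero, sub_zero]
  · have h : ((hochV k W) (hochConnes k A x)).2 n = 0 := by
      rcases n with _ | n
      · rfl
      · rw [hochV_snd_succ, hochConnes_fst, Pi.zero_apply, map_zero]
    simp only [LinearMap.add_apply, map_add, Prod.snd_add, Prod.snd_sub, Pi.add_apply,
      Pi.sub_apply, hochConnes_snd, hochV_fst, hochGamma_fst, hochGamma_snd, Prod.smul_snd,
      Pi.smul_apply, Pi.zero_apply, map_zero, map_smul, h]
    push_cast
    match_scalars
    field_simp
    ring

lemma isMixedComplex_hoch :
    IsMixedComplex (hochParity k A) (hochb k W) (hochConnes k A) where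
  isInternal := by
    have hd : ∀ i : ZMod 2, i = 0 ∨ i = 1 := by decide
    rw [DirectSum.isInternal_submodule_iff_isCompl (i := 0) (j := 1) _ (by decide)
      (by ext i; simpa using hd i)]
    constructor
    · rw [Submodule.disjoint_def]
      intro x h₀ h₁
      refine hochPi_ext (fun n => ?_) (fun n => ?_)
      · rcases hd (n : ZMod 2) with h | h
        · exact h₁.1 n (by rw [h]; decide)
        · exact h₀.1 n (by rw [h]; decide)
      · rcases hd ((n + 1 : ℕ) : ZMod 2) with h | h
        · exact h₁.2 n (by rw [h]; decide)
        · exact h₀.2 n (by rw [h]; decide)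
    · rw [codisjoint_iff, Submodule.eq_top_iff']
      intro x
      refine Submodule.mem_sup.2 ⟨(fun n => if (n : ZMod 2) = 0 then x.1 n else 0,
        fun n => if ((n + 1 : ℕ) : ZMod 2) = 0 then x.2 n else 0), ⟨fun n hn => if_neg hn,
        fun n hn => if_neg hn⟩, (fun n => if (n : ZMod 2) = 0 then 0 else x.1 n,
        fun n => if ((n + 1 : ℕ) : ZMod 2) = 0 then 0 else x.2 n), ⟨fun n hn => if_pos ?_,
        fun n hn => if_pos ?_⟩, ?_⟩
      · exact (hd _).resolve_right hn
      · exact (hd _).resolve_right hn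
      · refine hochPi_ext (fun n => ?_) (fun n => ?_)
        · simp only [Prod.fst_add, Pi.add_apply]
          split_ifs <;> simp
        · simp only [Prod.snd_add, Pi.add_apply]
          split_ifs <;> simp
  b_odd i x hx := by
    have h2 : (2 : ZMod 2) = 0 := rfl
    refine ⟨fun n hn => ?_, fun n hn => ?_⟩
    · rcases n with _ | n
      · rw [hochb_fst_zero, hx.1 1 fun h => hn ?_, hx.2 0 fun h => hn ?_]
        · simp
        · rw [← h]; push_cast; linear_combination -h2
        · rw [← h]; push_cast; linear_combination -h2
      · rw [hochb_fst_succ, hx.1 (n + 2) fun h => hn ?_, hx.1 n fun h => hn ?_,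
          hx.2 (n + 1) fun h => hn ?_]
        · simp
        · rw [← h]; push_cast; linear_combination -h2
        · rw [← h]; push_cast; linear_combination
        · rw [← h]; push_cast; linear_combination -h2
    · rcases n with _ | n
      · rw [hochb_snd_zero, hx.2 1 fun h => hn ?_]
        · simp
        · rw [← h]; push_cast; linear_combination -h2
      · rw [hochb_snd_succ, hx.2 (n + 2) fun h => hn ?_, hx.2 n fun h => hn ?_]
        · simp
        · rw [← h]; push_cast; linear_combination
        · rw [← h]; push_cast; linear_combination -h2
  B_odd i x hx := by
    refine ⟨fun n hn => rfl, fun n hn => ?_⟩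
    rw [hochConnes_snd, hx.1 n fun h => hn ?_]
    · simp
    · rw [← h]; push_cast; rfl
  b_sq := LinearMap.ext (hochb_hochb W)
  B_sq := LinearMap.ext hochConnes_hochConnes
  anticomm := LinearMap.ext (hochb_hochConnes W)

lemma isUConnection_hoch (h2 : (2 : k) ≠ 0) :
    IsUConnection (hochb k W) (hochConnes k A) (hochNabla k W) :=
  isUConnection_of_commutators (hochU_hochb W) (hochConnes_commutators W h2)
    (hochGamma_hochConnes W h2)

end MixedComplex

/-! ### The twisted de Rham complex -/

section DeRham

variable {k : Type*} [Field k] {A : Type*} [CommRing A] [Algebra k A]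

lemma forms_mem_span (ω : Forms k A) :
    ω ∈ Submodule.span A (Set.range fun l : List A => (l.map (dForm k)).prod) := by
  induction ω using CliffordAlgebra.left_induction with
  | algebraMap r =>
    rw [Algebra.algebraMap_eq_smul_one]
    exact Submodule.smul_mem _ _ (Submodule.subset_span ⟨[], rfl⟩)
  | add x y hx hy => exact Submodule.add_mem _ hx hy
  | ι_mul ω m hω =>
    have hm : m ∈ Submodule.span A (Set.range (KaehlerDifferential.D k A)) := by
      rw [KaehlerDifferential.span_range_derivation]; trivial
    induction hm using Submodule.span_induction with
    | mem m hm =>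
      obtain ⟨a, rfl⟩ := hm
      induction hω using Submodule.span_induction with
      | mem ω hω =>
        obtain ⟨l, rfl⟩ := hω
        exact Submodule.subset_span ⟨a :: l, rfl⟩
      | zero => rw [mul_zero]; exact Submodule.zero_mem _
      | add u v _ _ hu hv => rw [mul_add]; exact Submodule.add_mem _ hu hv
      | smul r u _ hu => rw [mul_smul_comm]; exact Submodule.smul_mem _ _ hu
    | zero => rw [map_zero, zero_mul]; exact Submodule.zero_mem _
    | add u v _ _ hu hv => rw [map_add, add_mul]; exact Submodule.add_mem _ hu hv
    | smul r u _ hu => rw [map_smul, smul_mul_assoc]; exact Submodule.smul_mem _ _ hu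

/-- The maps are only `k`-linear although the products of exact one-forms span over `A`; the
function `a` must therefore be part of the test forms. -/
lemma forms_ext {M : Type*} [AddCommGroup M] [Module k M] {f g : Forms k A →ₗ[k] M}
    (h : ∀ (a : A) (l : List A), f (algebraMap A (Forms k A) a * (l.map (dForm k)).prod) =
      g (algebraMap A (Forms k A) a * (l.map (dForm k)).prod)) : f = g := by
  refine LinearMap.ext fun ω => ?_
  induction forms_mem_span ω using Submodule.closure_induction with
  | zero => rw [map_zero, map_zero]
  | add x y _ _ hx hy => rw [map_add, map_add, hx, hy]
  | smul_mem r x hx =>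
    obtain ⟨l, rfl⟩ := hx
    simpa only [Algebra.smul_def] using h r l

lemma deRham_deRham (ω : Forms k A) : deRham k A (deRham k A ω) = 0 := by
  have : deRham k A ∘ₗ deRham k A = 0 := by
    refine forms_ext fun a l => ?_
    rw [LinearMap.comp_apply, deRham_algebraMap_mul_prod]
    exact deRham_prod k A (a :: l)
  exact LinearMap.congr_fun this ω

lemma deRham_algebraMap_mul (a : A) (ω : Forms k A) :
    deRham k A (algebraMap A (Forms k A) a * ω) =
      dForm k a * ω + algebraMap A (Forms k A) a * deRham k A ω := by
  have : deRham k A ∘ₗ LinearMap.mulLeft k (algebraMap A (Forms k A) a) =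
      LinearMap.mulLeft k (dForm k a) +
        LinearMap.mulLeft k (algebraMap A (Forms k A) a) ∘ₗ deRham k A := by
    refine forms_ext fun b l => ?_
    simp only [LinearMap.comp_apply, LinearMap.add_apply, LinearMap.mulLeft_apply]
    rw [deRham_algebraMap_mul_prod, ← mul_assoc, ← map_mul, deRham_algebraMap_mul_prod, dForm_mul,
      add_mul, Algebra.smul_def, Algebra.smul_def, mul_assoc, add_comm, Algebra.commutes b, mul_assoc]
  exact LinearMap.congr_fun this ω

lemma dForm_mul_dForm (a : A) : dForm k a * dForm k a = 0 :=
  ExteriorAlgebra.ι_sq_zero _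

lemma dForm_mul_algebraMap_mul (a b : A) (ω : Forms k A) :
    dForm k a * (algebraMap A (Forms k A) b * ω) = algebraMap A (Forms k A) b * (dForm k a * ω) := by
  rw [← mul_assoc, ← Algebra.commutes, mul_assoc]

/-- The forms of degree `p`, as a subspace over `k`. -/
abbrev formDegree (k : Type*) [Field k] (A : Type*) [CommRing A] [Algebra k A] (p : ℕ) :
    Submodule k (Forms k A) :=
  (⋀[A]^p (KaehlerDifferential k A)).restrictScalars k

lemma mem_formDegree_iff {p : ℕ} {ω : Forms k A} :
    ω ∈ formDegree k A p ↔ ω ∈ ⋀[A]^p (KaehlerDifferential k A) := Iff.rfl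

lemma dForm_mul_mem {p : ℕ} (a : A) {ω : Forms k A} (h : ω ∈ formDegree k A p) :
    dForm k a * ω ∈ formDegree k A (p + 1) := by
  rw [mem_formDegree_iff] at h ⊢
  rw [add_comm]
  have h1 : dForm k a ∈ ⋀[A]^1 (KaehlerDifferential k A) := by
    rw [ExteriorAlgebra.exteriorPower, pow_one]
    exact ⟨_, rfl⟩
  exact SetLike.mul_mem_graded h1 h

lemma algebraMap_mul_mem {p : ℕ} (a : A) {ω : Forms k A} (h : ω ∈ formDegree k A p) :
    algebraMap A (Forms k A) a * ω ∈ formDegree k A p := by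
  rw [mem_formDegree_iff, ← Algebra.smul_def] at *
  exact Submodule.smul_mem _ _ h

lemma algebraMap_mem (a : A) : algebraMap A (Forms k A) a ∈ formDegree k A 0 := by
  rw [mem_formDegree_iff, ExteriorAlgebra.exteriorPower, pow_zero, Submodule.mem_one]
  exact ⟨a, rfl⟩

lemma prod_mem (l : List A) : (l.map (dForm k)).prod ∈ formDegree k A l.length := by
  induction l with
  | nil => 
    have h := algebraMap_mem (k := k) (1 : A)
    rwa [map_one] at h
  | cons a l ih => exact dForm_mul_mem a ih

/-- Forms of degree `p` are spanned by products of functions and exact one-forms. -/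
lemma formDegree_induction {p : ℕ} {P : Forms k A → Prop} (zero : P 0)
    (add : ∀ x y, P x → P y → P (x + y))
    (mul_prod : ∀ (a : A) (l : List A), l.length = p →
      P (algebraMap A (Forms k A) a * (l.map (dForm k)).prod))
    {ω : Forms k A} (hω : ω ∈ formDegree k A p) : P ω := by
  rw [mem_formDegree_iff, ← exteriorPower.ιMulti_span_fixedDegree_of_span_eq_top A p _
    (KaehlerDifferential.span_range_derivation k A)] at hω
  induction hω using Submodule.closure_induction with
  | zero => exact zero
  | add x y _ _ hx hy => exact add x y hx hy
  | smul_mem r x hx =>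
    obtain ⟨v, hv, rfl⟩ := hx
    choose b hb using fun i => hv (Set.mem_range_self i)
    have h := mul_prod r (List.ofFn b) List.length_ofFn
    rw [List.map_ofFn] at h
    rw [Algebra.smul_def, ExteriorAlgebra.ιMulti_apply]
    convert h using 4
    funext i
    exact congrArg _ (hb i).symm

lemma deRham_mem {p : ℕ} {ω : Forms k A} (h : ω ∈ formDegree k A p) :
    deRham k A ω ∈ formDegree k A (p + 1) := by
  refine formDegree_induction (P := fun ω => deRham k A ω ∈ formDegree k A (p + 1)) ?_
    (fun x y hx hy => ?_) (fun a l hl => ?_) h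
  · rw [map_zero]; exact zero_mem _
  · rw [map_add]; exact add_mem hx hy
  · rw [deRham_algebraMap_mul_prod]
    exact dForm_mul_mem a (hl ▸ prod_mem l)

/-- The component of degree `p` of a form. -/
def formComponent (k : Type*) [Field k] (A : Type*) [CommRing A] [Algebra k A] (p : ℕ) :
    Forms k A →ₗ[k] Forms k A :=
  ((⋀[A]^p (KaehlerDifferential k A)).subtype ∘ₗ
    DirectSum.component A ℕ (fun p => ⋀[A]^p (KaehlerDifferential k A)) p ∘ₗ
    (DirectSum.decomposeLinearEquiv
      fun p => ⋀[A]^p (KaehlerDifferential k A)).toLinearMap).restrictScalars k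

lemma formComponent_mem (p : ℕ) (ω : Forms k A) : formComponent k A p ω ∈ formDegree k A p :=
  SetLike.coe_mem (DirectSum.decompose (fun p => ⋀[A]^p (KaehlerDifferential k A)) ω p)

lemma formComponent_of_mem {p : ℕ} {ω : Forms k A} (h : ω ∈ formDegree k A p) :
    formComponent k A p ω = ω :=
  DirectSum.decompose_of_mem_same (fun p => ⋀[A]^p (KaehlerDifferential k A)) h

lemma formComponent_of_mem_ne {p q : ℕ} {ω : Forms k A} (h : ω ∈ formDegree k A p) (hpq : p ≠ q) :
    formComponent k A q ω = 0 :=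
  DirectSum.decompose_of_mem_ne (fun p => ⋀[A]^p (KaehlerDifferential k A)) h hpq

lemma exists_sum_formComponent (ω : Forms k A) :
    ∃ N : ℕ, ∀ M, N ≤ M → ω = ∑ p ∈ Finset.range M, formComponent k A p ω := by
  classical
  let s := (DirectSum.decompose (fun p => ⋀[A]^p (KaehlerDifferential k A)) ω).support
  refine ⟨s.sup id + 1, fun M hM => ?_⟩
  conv_lhs => rw [← DirectSum.sum_support_decompose
    (fun p => ⋀[A]^p (KaehlerDifferential k A)) ω]
  refine Finset.sum_subset (fun p hp => ?_) fun p _ hp => ?_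
  · have : p ≤ s.sup id := Finset.le_sup (f := id) hp
    exact Finset.mem_range.2 (by omega)
  · rw [DFinsupp.notMem_support_iff] at hp
    exact congrArg Subtype.val hp

lemma forms_eq_zero {ω : Forms k A} (h : ∀ p, formComponent k A p ω = 0) : ω = 0 := by
  obtain ⟨N, hN⟩ := exists_sum_formComponent ω
  rw [hN N le_rfl]
  exact Finset.sum_eq_zero fun p _ => h p

/-- Linear maps which agree in every degree are equal. -/
lemma forms_ext_degree {M : Type*} [AddCommGroup M] [Module k M] {f g : Forms k A →ₗ[k] M}
    (h : ∀ p, ∀ ω ∈ formDegree k A p, f ω = g ω) : f = g := by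
  refine LinearMap.ext fun ω => ?_
  obtain ⟨N, hN⟩ := exists_sum_formComponent ω
  rw [hN N le_rfl, map_sum, map_sum]
  exact Finset.sum_congr rfl fun p _ => h p _ (formComponent_mem p ω)

lemma formDegree_le_formParity {p : ℕ} {i : ZMod 2} (h : (p : ZMod 2) = i) :
    formDegree k A p ≤ formParity k A i :=
  le_iSup₂_of_le p h le_rfl

lemma mem_formParity_iff {i : ZMod 2} {ω : Forms k A} :
    ω ∈ formParity k A i ↔ ∀ p : ℕ, (p : ZMod 2) ≠ i → formComponent k A p ω = 0 := by
  constructor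
  · intro h p hp
    have : formParity k A i ≤ LinearMap.ker (formComponent k A p) := by
      refine iSup₂_le fun q hq η hη => ?_
      exact formComponent_of_mem_ne hη (by rintro rfl; exact hp hq)
    exact this h
  · intro h
    obtain ⟨N, hN⟩ := exists_sum_formComponent ω
    rw [hN N le_rfl]
    refine Submodule.sum_mem _ fun p _ => ?_
    by_cases hp : (p : ZMod 2) = i
    · exact formDegree_le_formParity hp (formComponent_mem p ω)
    · rw [h p hp]; exact zero_mem _

lemma map_formParity {f : Forms k A →ₗ[k] Forms k A} {q : ℕ}
    (h : ∀ p, ∀ ω ∈ formDegree k A p, f ω ∈ formDegree k A (p + q)) {i : ZMod 2} {ω : Forms k A}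
    (hω : ω ∈ formParity k A i) : f ω ∈ formParity k A (i + q) := by
  have : formParity k A i ≤ (formParity k A (i + q)).comap f := by
    refine iSup₂_le fun p hp η hη => ?_
    exact formDegree_le_formParity (by rw [← hp]; push_cast; rfl) (h p η hη)
  exact this hω

lemma formGamma_of_mem {p : ℕ} {ω : Forms k A} (h : ω ∈ formDegree k A p) :
    formGamma k A ω = (-((p : k) / 2)) • ω := by
  have h1 : DirectSum.decomposeLinearEquiv (fun p => ⋀[A]^p (KaehlerDifferential k A)) ω =
      DirectSum.lof A ℕ (fun p => ⋀[A]^p (KaehlerDifferential k A)) p ⟨ω, h⟩ :=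
    DirectSum.decompose_of_mem _ h
  change DirectSum.toModule A ℕ (Forms k A) _
    (DirectSum.decomposeLinearEquiv (fun p => ⋀[A]^p (KaehlerDifferential k A)) ω) = _
  rw [h1, DirectSum.toModule_lof, LinearMap.smul_apply, algebraMap_smul]
  rfl

lemma mulFun_apply (W : A) (ω : Forms k A) : mulFun k W ω = algebraMap A (Forms k A) W * ω := rfl

lemma twist_apply (W : A) (ω : Forms k A) : twist k W ω = -(dForm k W * ω) := rfl

lemma formGamma_deRham (ω : Forms k A) :
    formGamma k A (deRham k A ω) = deRham k A (formGamma k A ω) - (1 / 2 : k) • deRham k A ω := by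
  have : formGamma k A ∘ₗ deRham k A =
      deRham k A ∘ₗ formGamma k A - (1 / 2 : k) • deRham k A := by
    refine forms_ext_degree fun p ω h => ?_
    simp only [LinearMap.comp_apply, LinearMap.sub_apply, LinearMap.smul_apply]
    rw [formGamma_of_mem h, formGamma_of_mem (deRham_mem h), map_smul]
    push_cast
    match_scalars
    ring
  exact LinearMap.congr_fun this ω

lemma formGamma_dForm_mul (a : A) (ω : Forms k A) :
    formGamma k A (dForm k a * ω) =
      dForm k a * formGamma k A ω - (1 / 2 : k) • (dForm k a * ω) := by
  have : formGamma k A ∘ₗ LinearMap.mulLeft k (dForm k a) =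
      LinearMap.mulLeft k (dForm k a) ∘ₗ formGamma k A -
        (1 / 2 : k) • LinearMap.mulLeft k (dForm k a) := by
    refine forms_ext_degree fun p ω h => ?_
    simp only [LinearMap.comp_apply, LinearMap.sub_apply, LinearMap.smul_apply,
      LinearMap.mulLeft_apply]
    rw [formGamma_of_mem h, formGamma_of_mem (dForm_mul_mem a h), mul_smul_comm]
    push_cast
    match_scalars
    ring
  exact LinearMap.congr_fun this ω

variable (W : A)

lemma isMixedComplex_forms :
    IsMixedComplex (formParity k A) (twist k W) (deRham k A) where
  isInternal := by
    have hd : ∀ i : ZMod 2, i = 0 ∨ i = 1 := by decide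
    rw [DirectSum.isInternal_submodule_iff_isCompl (i := 0) (j := 1) _ (by decide)
      (by ext i; simpa using hd i)]
    constructor
    · rw [Submodule.disjoint_def]
      intro ω h₀ h₁
      rw [mem_formParity_iff] at h₀ h₁
      refine forms_eq_zero fun p => ?_
      rcases hd (p : ZMod 2) with h | h
      · exact h₁ p (by rw [h]; decide)
      · exact h₀ p (by rw [h]; decide)
    · rw [codisjoint_iff, Submodule.eq_top_iff']
      intro ω
      obtain ⟨N, hN⟩ := exists_sum_formComponent ω
      rw [hN N le_rfl]
      refine Submodule.sum_mem _ fun p _ => ?_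
      rcases hd (p : ZMod 2) with h | h
      · exact Submodule.mem_sup_left (formDegree_le_formParity h (formComponent_mem p ω))
      · exact Submodule.mem_sup_right (formDegree_le_formParity h (formComponent_mem p ω))
  b_odd i ω hω := by
    have := map_formParity (f := twist k W) (q := 1)
      (fun p ω h => neg_mem (dForm_mul_mem W h)) hω
    rwa [Nat.cast_one] at this
  B_odd i ω hω := by
    have := map_formParity (f := deRham k A) (q := 1) (fun p ω h => deRham_mem h) hω
    rwa [Nat.cast_one] at this
  b_sq := LinearMap.ext fun ω => by
    rw [LinearMap.comp_apply, twist_apply, twist_apply, mul_neg, ← mul_assoc, dForm_mul_dForm,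
      zero_mul, neg_zero, neg_zero, LinearMap.zero_apply]
  B_sq := LinearMap.ext deRham_deRham
  anticomm := LinearMap.ext fun ω => by
    rw [LinearMap.add_apply, LinearMap.comp_apply, LinearMap.comp_apply, twist_apply, twist_apply,
      map_neg, deRham_dForm_mul, neg_neg, neg_add_cancel, LinearMap.zero_apply]

/-- The commutator of W with d is -dW∧, which is b itself; since b raises the degree by one, Γ
contributes -b/2, and b/2 is left. -/
lemma isUConnection_forms (h2 : (2 : k) ≠ 0) :
    IsUConnection (twist k W) (deRham k A) (formNabla k W) := by
  have h := isUConnection_of_commutators (b := twist k W) (B := deRham k A) (U := mulFun k W)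
    (V := formGamma k A) (fun ω => ?_) (fun ω => ?_) (fun ω => ?_)
  · rw [add_comm (uMonomial k (-2) 1 • _)] at h
    exact h
  · rw [mulFun_apply, twist_apply, twist_apply, mulFun_apply, dForm_mul_algebraMap_mul, mul_neg]
  · rw [mulFun_apply, twist_apply, twist_apply, mulFun_apply, deRham_algebraMap_mul, map_neg,
      formGamma_dForm_mul]
    match_scalars <;> field_simp <;> ring
  · rw [formGamma_deRham]
    match_scalars <;> field_simp <;> ring

end DeRham

/-! ### The HKR map on words -/

section Map

variable {k : Type*} [Field k] {A : Type*} [CommRing A] [Algebra k A]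

variable (k A) in
/-- `(a_0, …, a_n) ↦ a_0 da_1 ∧ … ∧ da_n`. -/
def kap (n : ℕ) : Word k A n →ₗ[k] Forms k A :=
  PiTensorProduct.lift ((MultilinearMap.mkPiAlgebraFin k (n + 1) (Forms k A)).compLinearMap
      (Fin.cons (funLin k A) fun _ : Fin n => dFormLin k A))

variable (k A) in
/-- `(a_0, …, a_n) ↦ da_0 ∧ … ∧ da_n`. -/
def the (n : ℕ) : Word k A n →ₗ[k] Forms k A :=
  PiTensorProduct.lift ((MultilinearMap.mkPiAlgebraFin k (n + 1) (Forms k A)).compLinearMap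
      fun _ : Fin (n + 1) => dFormLin k A)

lemma hkrWord_eq (n : ℕ) : hkrWord k A n = (1 / (n.factorial : k)) • kap k A n := rfl

lemma hkrUnitWord_eq (n : ℕ) : hkrUnitWord k A n = (1 / ((n + 1).factorial : k)) • the k A n := rfl

lemma the_word {n : ℕ} (b : ℕ → A) :
    the k A n (word k n b) = (List.ofFn fun i : Fin (n + 1) => dForm k (b i)).prod := by
  rw [the, word, PiTensorProduct.lift.tprod, MultilinearMap.compLinearMap_apply,
    MultilinearMap.mkPiAlgebraFin_apply]
  rfl

lemma kap_word {n : ℕ} (b : ℕ → A) :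
    kap k A n (word k n b) = algebraMap A (Forms k A) (b 0) *
      (List.ofFn fun i : Fin n => dForm k (b (i + 1))).prod := by
  rw [kap, word, PiTensorProduct.lift.tprod, MultilinearMap.compLinearMap_apply,
    MultilinearMap.mkPiAlgebraFin_apply, List.ofFn_succ, List.prod_cons]
  rfl

lemma the_letter (a : A) : the k A 0 (letter k a) = dForm k a := by
  rw [letter, the_word]; simp

lemma kap_letter (a : A) : kap k A 0 (letter k a) = algebraMap A (Forms k A) a := by
  rw [letter, kap_word]; simp

lemma the_cons (a : A) {n : ℕ} (x : Word k A n) :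
    the k A (n + 1) (cons k a x) = dForm k a * the k A n x := by
  have : the k A (n + 1) ∘ₗ cons k a = LinearMap.mulLeft k (dForm k a) ∘ₗ the k A n := by
    refine word_ext fun b => ?_
    rw [LinearMap.comp_apply, cons_word, the_word, LinearMap.comp_apply, the_word, List.ofFn_succ,
      List.prod_cons]
    simp
  exact LinearMap.congr_fun this x

lemma kap_cons (a : A) {n : ℕ} (x : Word k A n) :
    kap k A (n + 1) (cons k a x) = algebraMap A (Forms k A) a * the k A n x := by
  have : kap k A (n + 1) ∘ₗ cons k a =
      LinearMap.mulLeft k (algebraMap A (Forms k A) a) ∘ₗ the k A n := by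
    refine word_ext fun b => ?_
    rw [LinearMap.comp_apply, cons_word, kap_word, LinearMap.comp_apply, the_word]
    simp
  exact LinearMap.congr_fun this x

lemma the_snoc (a : A) {n : ℕ} (x : Word k A n) :
    the k A (n + 1) (snoc k a x) = the k A n x * dForm k a := by
  have : the k A (n + 1) ∘ₗ snoc k a = LinearMap.mulRight k (dForm k a) ∘ₗ the k A n := by
    induction n with
    | zero =>
      refine word_ext_zero fun b => ?_
      simp only [LinearMap.comp_apply, LinearMap.mulRight_apply, ← cons_letter, the_cons, the_letter]
    | succ n ih =>
      refine word_ext_cons fun b y => ?_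
      have h := LinearMap.congr_fun (ih y) y
      simp only [LinearMap.comp_apply, LinearMap.mulRight_apply] at h ⊢
      rw [← cons_snoc, the_cons, the_cons, h, mul_assoc]
  exact LinearMap.congr_fun this x

lemma kap_mulFirst (a : A) {n : ℕ} (x : Word k A n) :
    kap k A n (mulFirst k a x) = algebraMap A (Forms k A) a * kap k A n x := by
  have : kap k A n ∘ₗ mulFirst k a =
      LinearMap.mulLeft k (algebraMap A (Forms k A) a) ∘ₗ kap k A n := by
    cases n with
    | zero =>
      refine word_ext_zero fun b => ?_
      simp only [LinearMap.comp_apply, LinearMap.mulLeft_apply, mulFirst_letter, kap_letter, map_mul]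
    | succ n =>
      refine word_ext_cons fun b y => ?_
      simp only [LinearMap.comp_apply, LinearMap.mulLeft_apply, mulFirst_cons, kap_cons, map_mul,
        mul_assoc]
  exact LinearMap.congr_fun this x

lemma the_mem {n : ℕ} (x : Word k A n) : the k A n x ∈ formDegree k A (n + 1) := by
  have : (formDegree k A (n + 1)).mkQ ∘ₗ the k A n = 0 := by
    refine word_ext fun b => ?_
    have h := prod_mem (k := k) (List.ofFn fun i : Fin (n + 1) => b i)
    rw [List.map_ofFn, List.length_ofFn] at h
    rw [LinearMap.comp_apply, the_word, LinearMap.zero_apply, Submodule.mkQ_apply,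
      Submodule.Quotient.mk_eq_zero]
    exact h
  rw [← Submodule.Quotient.mk_eq_zero]
  exact LinearMap.congr_fun this x

lemma kap_mem {n : ℕ} (x : Word k A n) : kap k A n x ∈ formDegree k A n := by
  have : (formDegree k A n).mkQ ∘ₗ kap k A n = 0 := by
    refine word_ext fun b => ?_
    have h := prod_mem (k := k) (List.ofFn fun i : Fin n => b (i + 1))
    rw [List.map_ofFn, List.length_ofFn] at h
    rw [LinearMap.comp_apply, kap_word, LinearMap.zero_apply, Submodule.mkQ_apply,
      Submodule.Quotient.mk_eq_zero]
    exact algebraMap_mul_mem (b 0) h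
  rw [← Submodule.Quotient.mk_eq_zero]
  exact LinearMap.congr_fun this x

lemma deRham_kap {n : ℕ} (x : Word k A n) : deRham k A (kap k A n x) = the k A n x := by
  have h2 : deRham k A ∘ₗ kap k A n = the k A n := by
    refine word_ext fun b => ?_
    rw [LinearMap.comp_apply, kap_word, the_word, List.ofFn_succ, List.prod_cons]
    have := deRham_algebraMap_mul_prod k A (b 0) (List.ofFn fun i : Fin n => b (i + 1))
    rw [List.map_ofFn] at this
    exact this
  exact LinearMap.congr_fun h2 x

lemma deRham_the {n : ℕ} (x : Word k A n) : deRham k A (the k A n x) = 0 := by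
  rw [← deRham_kap, deRham_deRham]

lemma the_mul_dForm (a : A) {n : ℕ} (x : Word k A n) :
    the k A n x * dForm k a = (-1 : k) ^ (n + 1) • (dForm k a * the k A n x) := by
  induction n with
  | zero =>
    have : LinearMap.mulRight k (dForm k a) ∘ₗ the k A 0 =
      (-1 : k) ^ (0 + 1) • LinearMap.mulLeft k (dForm k a) ∘ₗ the k A 0 := by
      refine word_ext_zero fun b => ?_
      simp only [LinearMap.comp_apply, LinearMap.mulRight_apply, LinearMap.smul_apply,
        LinearMap.mulLeft_apply, the_letter]
      rw [dForm_anticomm]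
      simp
    exact LinearMap.congr_fun this x
  | succ n ih =>
    have : LinearMap.mulRight k (dForm k a) ∘ₗ the k A (n + 1) =
      (-1 : k) ^ (n + 1 + 1) • LinearMap.mulLeft k (dForm k a) ∘ₗ the k A (n + 1) := by
      refine word_ext_cons fun b y => ?_
      simp only [LinearMap.comp_apply, LinearMap.mulRight_apply, LinearMap.smul_apply,
        LinearMap.mulLeft_apply, the_cons]
      rw [mul_assoc, ih, ← mul_assoc, dForm_anticomm k a b, pow_succ _ (n + 1), mul_smul_comm,
        ← mul_assoc]
      simp
    exact LinearMap.congr_fun this x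

/-- Moving one of `n + 1` one-forms past the `n` others costs `(-1) ^ n`, which is the sign of the
signed rotation. -/
lemma the_tau {n : ℕ} (x : Word k A n) : the k A n (tau k A n x) = the k A n x := by
  cases n with
  | zero => rw [tau_zero]
  | succ n =>
    have : the k A (n + 1) ∘ₗ tau k A (n + 1) = the k A (n + 1) := by
      refine word_ext_snoc fun a y => ?_
      rw [LinearMap.comp_apply, tau_snoc, map_smul, the_cons, the_snoc, the_mul_dForm]
    exact LinearMap.congr_fun this x

lemma the_tau_pow {n : ℕ} (l : ℕ) (x : Word k A n) :
    the k A n ((tau k A n ^ l) x) = the k A n x := by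
  induction l with
  | zero => rfl
  | succ l ih => rw [tau_pow_succ_apply, the_tau, ih]

lemma the_norm {n : ℕ} (x : Word k A n) :
    the k A n (norm k A n x) = ((n + 1 : ℕ) : k) • the k A n x := by
  rw [norm_apply, map_sum, Finset.sum_congr rfl fun l _ => the_tau_pow l x, Finset.sum_const,
    Finset.card_range, Nat.cast_smul_eq_nsmul]

lemma the_ins (w : A) {n p : ℕ} (hp : p ≤ n + 1) (x : Word k A n) :
    the k A (n + 1) (ins w n p x) = dForm k w * the k A n x := by
  -- Once x is written as a `p`-fold rotation, the insertion at place `p` is a rotation of an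
  -- insertion in front, and `the` does not see rotations.
  have h : x = (tau k A n ^ p) ((tau k A n ^ (n + 1 - p)) x) := by
    rw [← tau_pow_apply_add, Nat.add_sub_cancel' hp, tau_pow_card_apply]
  rw [h, ins_tau_pow w hp, the_tau_pow, the_tau_pow, the_cons, the_tau_pow]

lemma the_curv (w : A) {n : ℕ} (x : Word k A n) :
    the k A (n + 1) (curv w n x) = ((n + 2 : ℕ) : k) • (dForm k w * the k A n x) := by
  rw [curv_apply, map_sum, Finset.sum_congr rfl fun p hp =>
    the_ins w (Nat.le_of_lt_succ (Finset.mem_range.1 hp)) x, Finset.sum_const,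
    Finset.card_range, Nat.cast_smul_eq_nsmul]

lemma the_vee (w : A) {n : ℕ} (x : Word k A n) :
    the k A (n + 1) (vee w n x) =
      (∑ l ∈ Finset.range (n + 1), (l + 1 : k)) • (dForm k w * the k A n x) := by
  rw [vee_apply, map_sum, Finset.sum_smul]
  refine Finset.sum_congr rfl fun l hl => ?_
  have h1 := Finset.mem_range.1 hl
  rw [map_sum, Finset.sum_congr rfl fun p hp => by
    have := Finset.mem_range.1 hp
    exact the_ins w (by omega) _, Finset.sum_const, the_tau_pow, Finset.card_range,
    ← Nat.cast_smul_eq_nsmul k, Nat.cast_add, Nat.cast_one]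

lemma kap_curv' (w : A) {n : ℕ} (x : Word k A n) :
    kap k A (n + 1) (curv' w n x) = -((n + 1 : ℕ) : k) • (dForm k w * kap k A n x) := by
  have : kap k A (n + 1) ∘ₗ curv' w n =
      -((n + 1 : ℕ) : k) • LinearMap.mulLeft k (dForm k w) ∘ₗ kap k A n := by
    cases n with
    | zero =>
      refine word_ext_zero fun a => ?_
      simp only [LinearMap.comp_apply, LinearMap.smul_apply, LinearMap.mulLeft_apply, kap_letter,
        curv'_letter, map_neg, kap_cons, the_letter]
      rw [← Algebra.commutes]
      simp
    | succ n =>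
      refine word_ext_cons fun a y => ?_
      simp only [LinearMap.comp_apply, LinearMap.smul_apply, LinearMap.mulLeft_apply,
        curv'_cons, map_neg, kap_cons, the_curv]
      rw [dForm_mul_algebraMap_mul, mul_smul_comm, neg_smul]
  exact LinearMap.congr_fun this x

lemma kap_tau_cons (a : A) {n : ℕ} (x : Word k A n) :
    kap k A (n + 1) (tau k A (n + 1) (cons k a x)) = -(dForm k a * kap k A n (tau k A n x)) := by
  have : kap k A (n + 1) ∘ₗ tau k A (n + 1) ∘ₗ cons k a =
      -(LinearMap.mulLeft k (dForm k a) ∘ₗ kap k A n ∘ₗ tau k A n) := by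
    cases n with
    | zero =>
      refine word_ext_zero fun b => ?_
      simp only [LinearMap.comp_apply, LinearMap.neg_apply, LinearMap.mulLeft_apply, tau_zero,
        kap_letter, cons_letter, tau_snoc, map_smul]
      rw [← cons_letter, kap_cons, the_letter, ← Algebra.commutes]
      simp
    | succ n =>
      refine word_ext_snoc fun b y => ?_
      simp only [LinearMap.comp_apply, LinearMap.neg_apply, LinearMap.mulLeft_apply,
        cons_snoc, tau_snoc, map_smul, kap_cons, the_cons]
      rw [dForm_mul_algebraMap_mul, pow_succ]
      simp
  exact LinearMap.congr_fun this x

lemma kap_sub_tau_zero (x : Word k A 0) : kap k A 0 (x - tau k A 0 x) = 0 := by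
  rw [tau_zero, sub_self, map_zero]

/-- This is the Leibniz rule: for two letters it reads a db + b da = d(ab). Each further letter
contributes d of a product through `mulFirst`. -/
lemma kap_sub_tau {n : ℕ} (x : Word k A (n + 1)) :
    kap k A (n + 1) (x - tau k A (n + 1) x) = the k A n (bar k A n x) := by
  have : kap k A (n + 1) ∘ₗ (LinearMap.id - tau k A (n + 1)) = the k A n ∘ₗ bar k A n := by
    clear x
    induction n with
    | zero =>
      refine word_ext_cons fun a y => ?_
      simp only [LinearMap.comp_apply, LinearMap.sub_apply, LinearMap.id_apply, map_sub,
        kap_tau_cons, kap_cons, bar_cons_zero, tau_zero]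
      rw [← deRham_kap (mulFirst k a y), kap_mulFirst, deRham_algebraMap_mul, deRham_kap]
      abel
    | succ n ih =>
      refine word_ext_cons fun a y => ?_
      have h := LinearMap.congr_fun ih y
      simp only [LinearMap.comp_apply, LinearMap.sub_apply, LinearMap.id_apply, map_sub] at h
      simp only [LinearMap.comp_apply, LinearMap.sub_apply, LinearMap.id_apply, map_sub,
        kap_tau_cons, kap_cons, bar_cons, the_cons]
      rw [← deRham_kap (mulFirst k a y), kap_mulFirst, deRham_algebraMap_mul, deRham_kap, ← h,
        mul_sub]
      abel
  exact LinearMap.congr_fun this x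

/-- By `cyc_cons` the image of a word with first letter `a` is `a` times the difference of the two
sides of `kap_sub_tau`. -/
lemma kap_cyc {n : ℕ} (x : Word k A (n + 1)) : kap k A n (cyc k A n x) = 0 := by
  have : kap k A n ∘ₗ cyc k A n = 0 := by
    refine word_ext_cons fun a y => ?_
    cases n with
    | zero => rw [LinearMap.comp_apply, cyc_cons_zero, map_zero, LinearMap.zero_apply]
    | succ n =>
      rw [LinearMap.comp_apply, cyc_cons, map_sub, kap_mulFirst, kap_sub_tau, kap_cons, sub_self,
        LinearMap.zero_apply]
  exact LinearMap.congr_fun this x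

lemma cast_ne_zero [CharZero k] (n : ℕ) : ((n + 1 : ℕ) : k) ≠ 0 :=
  Nat.cast_ne_zero.2 n.succ_ne_zero

section

variable [CharZero k]

lemma hkrWord_curv' (w : A) {n : ℕ} (x : Word k A n) :
    hkrWord k A (n + 1) (curv' w n x) = -(dForm k w * hkrWord k A n x) := by
  have h1 := cast_ne_zero (k := k) n
  have h2 : (n.factorial : k) ≠ 0 := Nat.cast_ne_zero.2 n.factorial_ne_zero
  rw [hkrWord_eq, hkrWord_eq, LinearMap.smul_apply, LinearMap.smul_apply, kap_curv', mul_smul_comm,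
    smul_smul, ← neg_smul, Nat.factorial_succ, Nat.cast_mul]
  congr 1
  field_simp

lemma hkrUnitWord_curv (w : A) {n : ℕ} (x : Word k A n) :
    hkrUnitWord k A (n + 1) (curv w n x) = dForm k w * hkrUnitWord k A n x := by
  have h1 := cast_ne_zero (k := k) (n + 1)
  have h2 : ((n + 1).factorial : k) ≠ 0 := Nat.cast_ne_zero.2 (n + 1).factorial_ne_zero
  rw [hkrUnitWord_eq, hkrUnitWord_eq, LinearMap.smul_apply, LinearMap.smul_apply, the_curv,
    mul_smul_comm, smul_smul, Nat.factorial_succ (n + 1), Nat.cast_mul]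
  congr 1
  field_simp

end

lemma hkrWord_cyc {n : ℕ} (x : Word k A (n + 1)) : hkrWord k A n (cyc k A n x) = 0 := by
  rw [hkrWord_eq, LinearMap.smul_apply, kap_cyc, smul_zero]

lemma hkrWord_sub_tau_zero (x : Word k A 0) : hkrWord k A 0 (x - tau k A 0 x) = 0 := by
  rw [hkrWord_eq, LinearMap.smul_apply, kap_sub_tau_zero, smul_zero]

lemma hkrWord_sub_tau {n : ℕ} (x : Word k A (n + 1)) :
    hkrWord k A (n + 1) (x - tau k A (n + 1) x) = hkrUnitWord k A n (bar k A n x) := by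
  rw [hkrWord_eq, LinearMap.smul_apply, kap_sub_tau]
  rfl

lemma hkrWord_mem {n : ℕ} (x : Word k A n) : hkrWord k A n x ∈ formDegree k A n :=
  Submodule.smul_mem _ _ (kap_mem x)

lemma hkrUnitWord_mem {n : ℕ} (x : Word k A n) : hkrUnitWord k A n x ∈ formDegree k A (n + 1) :=
  Submodule.smul_mem _ _ (the_mem x)

/-! ### The HKR map as a weak morphism -/

section Morphism

variable [Algebra.FiniteType k A]

/-- One bound serves all chains at once and may be enlarged, so ε of two different chains can be
compared after a shift of degree; the vanishing at `M` disposes of the extra top term. -/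
lemma exists_hkr_eq_sum :
    ∃ N : ℕ, ∀ M, N ≤ M → hkrWord k A M = 0 ∧ hkrUnitWord k A M = 0 ∧ ∀ x : HochPi k A,
      hkr k A x = ∑ n ∈ Finset.range M, hkrWord k A n (x.1 n) +
        ∑ n ∈ Finset.range M, hkrUnitWord k A n (x.2 n) := by
  obtain ⟨N, hN⟩ := exists_hkr_eq_zero k A
  refine ⟨N, fun M hM => ⟨(hN M hM).1, (hN M hM).2, fun x => ?_⟩⟩
  rw [← Finset.sum_add_distrib]
  refine finsum_eq_sum_of_support_subset _ fun n hn => ?_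
  rw [Finset.coe_range, Set.mem_Iio]
  by_contra h
  rw [not_lt] at h
  refine hn ?_
  simp only [hN n (hM.trans h), LinearMap.zero_apply, add_zero]

/-- The cyclic differential is killed by ε and the insertions of W give -dW∧ in both columns. The
contribution (1-t)y of the e-column to the first column cancels its own -b'y, by `hkrWord_sub_tau`.
-/
lemma hkr_hochb [CharZero k] (W : A) (x : HochPi k A) :
    hkr k A (hochb k W x) = -(dForm k W * hkr k A x) := by
  obtain ⟨N, hN⟩ := exists_hkr_eq_sum (k := k) (A := A)
  rw [(hN (N + 1) (by omega)).2.2, (hN N le_rfl).2.2 x, Finset.sum_range_succ',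
    Finset.sum_range_succ' (fun n => hkrUnitWord k A n _), hochb_fst_zero, hochb_snd_zero, map_add,
    hkrWord_cyc, hkrWord_sub_tau_zero]
  simp only [hochb_fst_succ, hochb_snd_succ, map_add, map_sub, map_neg, hkrWord_cyc,
    hkrWord_curv', hkrUnitWord_curv]
  simp only [← map_sub, hkrWord_sub_tau]
  -- The shift of index drops the top term, which vanishes because the degree exceeds the bound.
  have h : ∑ n ∈ Finset.range N, hkrUnitWord k A n (bar k A n (x.2 (n + 1))) =
      ∑ n ∈ Finset.range N, hkrUnitWord k A (n + 1) (bar k A (n + 1) (x.2 (n + 2))) +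
        hkrUnitWord k A 0 (bar k A 0 (x.2 1)) := by
    rw [← Finset.sum_range_succ' (fun n => hkrUnitWord k A n (bar k A n (x.2 (n + 1)))),
      Finset.sum_range_succ, (hN N le_rfl).2.1, LinearMap.zero_apply, add_zero]
  rw [Finset.sum_add_distrib, h, Finset.sum_sub_distrib, mul_add, Finset.mul_sum, Finset.mul_sum]
  simp only [Finset.sum_add_distrib, Finset.sum_neg_distrib, Finset.sum_const_zero]
  abel

lemma hkr_hochConnes [CharZero k] (x : HochPi k A) :
    hkr k A (hochConnes k A x) = deRham k A (hkr k A x) := by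
  obtain ⟨N, hN⟩ := exists_hkr_eq_sum (k := k) (A := A)
  rw [(hN N le_rfl).2.2, (hN N le_rfl).2.2 x, map_add, map_sum, map_sum, hochConnes_fst]
  simp only [Pi.zero_apply, map_zero, Finset.sum_const_zero, zero_add]
  rw [Finset.sum_eq_zero (s := Finset.range N) (f := fun n => deRham k A (hkrUnitWord k A n _)),
    add_zero]
  · refine Finset.sum_congr rfl fun n _ => ?_
    have h1 := cast_ne_zero (k := k) n
    have h2 : (n.factorial : k) ≠ 0 := Nat.cast_ne_zero.2 n.factorial_ne_zero
    rw [hochConnes_snd, hkrWord_eq, hkrUnitWord_eq, LinearMap.smul_apply, LinearMap.smul_apply,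
      the_norm, map_smul, deRham_kap, smul_smul, Nat.factorial_succ, Nat.cast_mul]
    congr 1
    field_simp
  · intro n _
    rw [hkrUnitWord_eq, LinearMap.smul_apply, map_smul, deRham_the, smul_zero]

lemma hkr_hochU (W : A) (x : HochPi k A) :
    hkr k A (hochU k W x) = algebraMap A (Forms k A) W * hkr k A x := by
  obtain ⟨N, hN⟩ := exists_hkr_eq_sum (k := k) (A := A)
  have h0 : ∀ n (z : Word k A n), hkrWord k A n (mulFirst k W z) =
      algebraMap A (Forms k A) W * hkrWord k A n z := fun n z => by
    rw [hkrWord_eq, LinearMap.smul_apply, LinearMap.smul_apply, kap_mulFirst, mul_smul_comm]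
  have h1 : ∀ n (z : Word k A n), hkrWord k A (n + 1) (cons k W z) =
      algebraMap A (Forms k A) W * hkrUnitWord k A n z := fun n z => by
    rw [hkrWord_eq, hkrUnitWord_eq, LinearMap.smul_apply, LinearMap.smul_apply, kap_cons,
      mul_smul_comm]
  rw [(hN (N + 1) (by omega)).2.2, (hN N le_rfl).2.2 x, hochU_snd, Finset.sum_range_succ']
  simp only [hochU_fst_zero, hochU_fst_succ, map_add, h0, h1, Pi.zero_apply, map_zero,
    Finset.sum_const_zero, add_zero]
  rw [Finset.sum_add_distrib, add_right_comm, ← Finset.sum_range_succ' (fun n =>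
    algebraMap A (Forms k A) W * hkrWord k A n (x.1 n)), Finset.sum_range_succ, (hN N le_rfl).1,
    LinearMap.zero_apply, mul_zero, add_zero, mul_add, Finset.mul_sum, Finset.mul_sum]

/-- Every insertion and rotation yields the same form dW ∧ da₀ ∧ … ∧ daₙ, and there are 1 + 2 + … +
(n+1) = (n+1)(n+2)/2 of them. Divided by (n+2)! this is half of 1/n!. -/
lemma hkr_hochV [CharZero k] (W : A) (x : HochPi k A) :
    hkr k A (hochV k W x) = (1 / 2 : k) • (dForm k W * deRham k A (hkr k A x)) := by
  obtain ⟨N, hN⟩ := exists_hkr_eq_sum (k := k) (A := A)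
  rw [(hN (N + 1) (by omega)).2.2, (hN N le_rfl).2.2 x, map_add, map_sum, map_sum, hochV_fst,
    Finset.sum_range_succ' (fun n => hkrUnitWord k A n _)]
  simp only [Pi.zero_apply, map_zero, Finset.sum_const_zero, zero_add, hochV_snd_zero, add_zero]
  rw [Finset.sum_eq_zero (s := Finset.range N) (f := fun n => deRham k A (hkrUnitWord k A n _)),
    add_zero, Finset.mul_sum, Finset.smul_sum]
  · refine Finset.sum_congr rfl fun n _ => ?_
    have h1 := cast_ne_zero (k := k) n
    have h3 := cast_ne_zero (k := k) (n + 1)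
    have h2 : (n.factorial : k) ≠ 0 := Nat.cast_ne_zero.2 n.factorial_ne_zero
    have hs : ∀ m : ℕ, ∑ l ∈ Finset.range m, (l + 1 : k) = m * (m + 1) / 2 := by
      intro m
      induction m with
      | zero => simp
      | succ m ih => rw [Finset.sum_range_succ, ih]; push_cast; field_simp; ring
    rw [hochV_snd_succ, hkrWord_eq, hkrUnitWord_eq, LinearMap.smul_apply, LinearMap.smul_apply,
      the_vee, map_smul, deRham_kap, mul_smul_comm, smul_smul, smul_smul, Nat.factorial_succ,
      Nat.factorial_succ, Nat.cast_mul, Nat.cast_mul, hs]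
    congr 1
    push_cast at *
    field_simp
  · intro n _
    rw [hkrUnitWord_eq, LinearMap.smul_apply, map_smul, deRham_the, smul_zero]

lemma hkr_hochGamma (x : HochPi k A) :
    hkr k A (hochGamma k A x) = formGamma k A (hkr k A x) := by
  obtain ⟨N, hN⟩ := exists_hkr_eq_sum (k := k) (A := A)
  rw [(hN N le_rfl).2.2, (hN N le_rfl).2.2 x, map_add, map_sum, map_sum]
  congr 1
  · refine Finset.sum_congr rfl fun n _ => ?_
    rw [hochGamma_fst, map_smul, formGamma_of_mem (hkrWord_mem _)]
  · refine Finset.sum_congr rfl fun n _ => ?_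
    rw [hochGamma_snd, map_smul, formGamma_of_mem (hkrUnitWord_mem _)]

lemma hkr_mem_formParity {i : ZMod 2} {x : HochPi k A} (hx : x ∈ hochParity k A i) :
    hkr k A x ∈ formParity k A i := by
  obtain ⟨N, hN⟩ := exists_hkr_eq_sum (k := k) (A := A)
  rw [(hN N le_rfl).2.2]
  refine add_mem (sum_mem fun n _ => ?_) (sum_mem fun n _ => ?_)
  · by_cases h : (n : ZMod 2) = i
    · exact formDegree_le_formParity h (hkrWord_mem _)
    · rw [hx.1 n h, map_zero]; exact zero_mem _
  · by_cases h : ((n + 1 : ℕ) : ZMod 2) = i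
    · exact formDegree_le_formParity h (hkrUnitWord_mem _)
    · rw [hx.2 n h, map_zero]; exact zero_mem _

variable [CharZero k] (W : A)

lemma isMixedMorphism_hkr :
    IsMixedMorphism (hochParity k A) (hochb k W) (hochConnes k A)
        (formParity k A) (twist k W) (deRham k A) (hkr k A) where
  even _ _ hx := hkr_mem_formParity hx
  comm_b := LinearMap.ext fun x => (hkr_hochb W x).symm
  comm_B := LinearMap.ext fun x => (hkr_hochConnes x).symm

/-- The terms U and Γ of the connections correspond under ε, so the left hand side is -(1/2u) dW ∧
dε. On the right, the u⁻² terms from b'H and Hb cancel, Hd = 0 because d² = 0, and uB'H = -(1/2u)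
d(W dε) is what remains. -/
lemma isWeakMorphism_hkr :
    IsWeakMorphism (hochParity k A) (hochb k W) (hochConnes k A) (hochNabla k W)
      (formParity k A) (twist k W) (deRham k A) (formNabla k W) (hkr k A) (hkrHomotopy k W) where
  morphism := isMixedMorphism_hkr W
  odd i x hx m := by
    rw [hkrHomotopy, LinearMap.smul_apply, uCoeff_uMonomial_smul, uCoeff_laurentMap]
    refine Submodule.smul_mem _ _ ?_
    have h1 := (isMixedComplex_forms W).B_odd i _ (hkr_mem_formParity (hx (m - -2)))
    have h2 := map_formParity (f := mulFun k W) (q := 0) (fun p ω h => algebraMap_mul_mem W h) h1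
    rwa [Nat.cast_zero, add_zero] at h2
  homotopy x := by
    refine laurent_ext fun m => ?_
    simp only [formNabla, hochNabla, hkrHomotopy, LinearMap.add_apply,
      LinearMap.restrictScalars_apply, LinearMap.smul_apply,
      uCoeff_add, uCoeff_sub, uCoeff_totalDiff, uCoeff_uMonomial_smul, uCoeff_laurentMap,
      uCoeff_uDeriv, map_add, map_zsmul, map_smul, one_smul, LinearMap.comp_apply, hkr_hochU,
      hkr_hochV, hkr_hochGamma, hkr_hochb, hkr_hochConnes, map_neg, deRham_deRham,
      deRham_dForm_mul, twist_apply, mulFun_apply, deRham_algebraMap_mul,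
      dForm_mul_algebraMap_mul, mul_zero, add_zero, neg_neg]
    have e₂ : m - -2 - 1 = m + 1 := by ring
    have e₄ : m - -1 = m + 1 := by ring
    simp only [e₂, e₄]
    module

end Morphism

end Map

/-! ### Solving perturbed equations degree by degree in a product -/

section Perturbation

/-- Construction of a sequence from its first two terms, each further term depending on the
one two steps before. -/
lemma exists_sequence {V : ℕ → Type*} (G : ∀ n, V n → Prop) (R : ∀ n, V n → V (n + 2) → Prop)
    {v₀ : V 0} (h₀ : G 0 v₀) {v₁ : V 1} (h₁ : G 1 v₁)
    (step : ∀ n v, G n v → ∃ v', R n v v' ∧ G (n + 2) v') :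
    ∃ f : ∀ n, V n, f 0 = v₀ ∧ f 1 = v₁ ∧ ∀ n, G n (f n) ∧ R n (f n) (f (n + 2)) := by
  choose s hs using step
  -- Recursion on pairs of consecutive terms turns the two-step dependence into a one-step one.
  let p : ∀ n, {q : V n × V (n + 1) // G n q.1 ∧ G (n + 1) q.2} :=
    Nat.rec ⟨(v₀, v₁), h₀, h₁⟩ fun n q => ⟨(q.1.2, s n q.1.1 q.2.1), q.2.2, (hs n _ q.2.1).2⟩
  exact ⟨fun n => (p n).1.1, rfl, rfl, fun n => ⟨(p n).2.1, (hs n _ (p n).2.1).1⟩⟩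

variable {V F : ℕ → Type*} [∀ n, AddCommGroup (V n)] [∀ n, AddCommGroup (F n)]

/-- The cycles of a family of maps lowering the degree by one. -/
def IsCycle (d : ∀ n, V (n + 1) →+ V n) : ∀ n, V n → Prop
  | 0, _ => True
  | n + 1, v => d n v = 0

/-- The sum of a family of maps lowering the degree by one and of a family of maps raising it by
one. -/
def perturbed (d : ∀ n, V (n + 1) →+ V n) (w : ∀ n, V n →+ V (n + 1)) (x : ∀ n, V n) : ∀ n, V n
  | 0 => d 0 (x 1)
  | n + 1 => d (n + 1) (x (n + 2)) + w n (x n)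

lemma perturbed_neg (d : ∀ n, V (n + 1) →+ V n) (w : ∀ n, V n →+ V (n + 1)) (x : ∀ n, V n) :
    perturbed d w (-x) = -perturbed d w x := by
  funext n
  cases n with
  | zero => exact map_neg (d 0) _
  | succ n => simp [perturbed, add_comm]

/-- The identities of a curved perturbation of a complex, together with a map `e` to a family
of groups such that every cycle killed by `e` is a boundary of an element with prescribed
image under `e`. -/
structure IsPerturbation (d : ∀ n, V (n + 1) →+ V n) (w : ∀ n, V n →+ V (n + 1))
    (e : ∀ n, V n →+ F n) (δ : ∀ n, F n →+ F (n + 1)) : Prop where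
  dw_zero : ∀ x, d 0 (w 0 x) = 0
  dw : ∀ n x, d (n + 1) (w (n + 1) x) + w n (d n x) = 0
  ww : ∀ n x, w (n + 1) (w n x) = 0
  ew : ∀ n x, e (n + 1) (w n x) = δ n (e n x)
  surj_zero : ∀ ω, ∃ x, e 0 x = ω
  exact : ∀ n x, IsCycle d n x → e n x = 0 → ∀ ω, ∃ y, d n y = x ∧ e (n + 1) y = ω

namespace IsPerturbation

variable {d : ∀ n, V (n + 1) →+ V n} {w : ∀ n, V n →+ V (n + 1)} {e : ∀ n, V n →+ F n}
  {δ : ∀ n, F n →+ F (n + 1)}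

lemma isCycle_zero (d : ∀ n, V (n + 1) →+ V n) (n : ℕ) : IsCycle d n 0 := by
  cases n with
  | zero => trivial
  | succ n => exact map_zero _

/-- Zero is a boundary of an element with any prescribed image. -/
lemma surjective (h : IsPerturbation d w e δ) (n : ℕ) (ω : F n) : ∃ x, e n x = ω := by
  cases n with
  | zero => exact h.surj_zero ω
  | succ n =>
    obtain ⟨y, -, hy⟩ := h.exact n 0 (isCycle_zero d n) (map_zero _) ω
    exact ⟨y, hy⟩

/-- The next term must satisfy d x_{n+2} = -w x_n. The right hand side is a cycle, which is carried
along as an invariant and renewed by dw + wd = 0 and w² = 0, and its image under e is -δω_n = 0. So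
`exact` applies and even prescribes the image of x_{n+2}. -/
lemma exists_cycle (h : IsPerturbation d w e δ) (ω : ∀ n, F n) (hω : ∀ n, δ n (ω n) = 0) :
    ∃ x, perturbed d w x = 0 ∧ ∀ n, e n (x n) = ω n := by
  obtain ⟨x₀, hx₀⟩ := h.surj_zero (ω 0)
  obtain ⟨x₁, hx₁, hx₁'⟩ := h.exact 0 0 trivial (map_zero _) (ω 1)
  have step : ∀ n (x : V n), e n x = ω n ∧ d n (w n x) = 0 →
      ∃ x' : V (n + 2), d (n + 1) x' + w n x = 0 ∧ e (n + 2) x' = ω (n + 2) ∧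
        d (n + 2) (w (n + 2) x') = 0 := by
    rintro n x ⟨hx, hx'⟩
    obtain ⟨y, hy, hy'⟩ := h.exact (n + 1) (-w n x) (by
      change d n _ = 0
      rw [map_neg, hx', neg_zero]) (by rw [map_neg, h.ew, hx, hω, neg_zero]) (ω (n + 2))
    refine ⟨y, by rw [hy, neg_add_cancel], hy', ?_⟩
    rw [eq_neg_of_add_eq_zero_left (h.dw (n + 1) y), hy, map_neg, h.ww, neg_zero, neg_zero]
  obtain ⟨f, -, hf₁, hf⟩ := exists_sequence (V := V)
    (fun n x => e n x = ω n ∧ d n (w n x) = 0)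
    (fun n x x' => d (n + 1) x' + w n x = 0) (v₀ := x₀) ⟨hx₀, h.dw_zero x₀⟩
    (v₁ := x₁) ⟨hx₁', by
      rw [eq_neg_of_add_eq_zero_left (h.dw 0 x₁), hx₁, map_zero, neg_zero]⟩ step
  refine ⟨f, funext fun n => ?_, fun n => (hf n).1.1⟩
  cases n with
  | zero =>
    change d 0 (f 1) = 0
    rw [hf₁, hx₁]
  | succ n => exact (hf n).2

/-- Solve d y_{n+2} = x_{n+1} - w y_n, always choosing y with e y = 0; the invariant is that the
right hand side is a cycle, and e kills it because e x = 0 and e w = δ e. -/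
lemma exists_boundary (h : IsPerturbation d w e δ) (x : ∀ n, V n) (hx : perturbed d w x = 0)
    (hex : ∀ n, e n (x n) = 0) : ∃ y, perturbed d w y = x := by
  have hx0 : d 0 (x 1) = 0 := congrFun hx 0
  have hxs : ∀ n, d (n + 1) (x (n + 2)) + w n (x n) = 0 := fun n => congrFun hx (n + 1)
  obtain ⟨y₁, hy₁, hy₁'⟩ := h.exact 0 (x 0) trivial (hex 0) 0
  have step : ∀ n (y : V n), e n y = 0 ∧ d n (x (n + 1) - w n y) = 0 →
      ∃ y' : V (n + 2), d (n + 1) y' + w n y = x (n + 1) ∧ e (n + 2) y' = 0 ∧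
        d (n + 2) (x (n + 3) - w (n + 2) y') = 0 := by
    rintro n y ⟨hy, hy'⟩
    obtain ⟨z, hz, hz'⟩ := h.exact (n + 1) (x (n + 1) - w n y) hy'
      (by rw [map_sub, hex, h.ew, hy, map_zero, sub_zero]) 0
    refine ⟨z, by rw [hz, sub_add_cancel], hz', ?_⟩
    rw [map_sub, eq_neg_of_add_eq_zero_left (h.dw (n + 1) z), hz, map_sub, h.ww, sub_zero,
      sub_neg_eq_add, hxs]
  obtain ⟨f, -, hf₁, hf⟩ := exists_sequence (V := V)
    (fun n y => e n y = 0 ∧ d n (x (n + 1) - w n y) = 0)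
    (fun n y y' => d (n + 1) y' + w n y = x (n + 1)) (v₀ := 0)
    ⟨map_zero _, by rw [map_zero, sub_zero, hx0]⟩ (v₁ := y₁) ⟨hy₁', by
      rw [map_sub, eq_neg_of_add_eq_zero_left (h.dw 0 y₁), hy₁, sub_neg_eq_add, hxs]⟩ step
  refine ⟨f, funext fun n => ?_⟩
  cases n with
  | zero =>
    change d 0 (f 1) = x 0
    rw [hf₁, hy₁]
  | succ n => exact (hf n).2

end IsPerturbation

end Perturbation

/-! ### Reduction of the quasi-isomorphism to the uncurved statement -/

section Reduction

variable {k : Type*} [Field k] {A : Type*} [CommRing A] [Algebra k A] (W : A)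

/-- The target is trivial: prefixing the letter `1` contracts the bar complex, so the e-column has
no homology. -/
lemma isPerturbation_bar :
    IsPerturbation (V := Word k A) (F := fun _ => PUnit.{1}) (fun n => (bar k A n).toAddMonoidHom)
      (fun n => (curv W n).toAddMonoidHom) (fun _ => 0) (fun _ => 0) where
  dw_zero x := bar_curv_zero W x
  dw _ x := bar_curv W x
  ww _ x := curv_curv W x
  ew _ _ := rfl
  surj_zero _ := ⟨0, rfl⟩
  exact n x hx _ _ := by
    refine ⟨cons k 1 x, ?_, rfl⟩
    cases n with
    | zero => exact (bar_cons_zero 1 x).trans (mulFirst_one x)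
    | succ n =>
      have h : bar k A n x = 0 := hx
      refine (bar_cons 1 x).trans ?_
      rw [h, map_zero, sub_zero, mulFirst_one]

variable (k A) in
/-- Every Hochschild cycle in the kernel of the Hochschild-Kostant-Rosenberg map is a boundary. -/
def HKRInjective : Prop :=
  ∀ n (z : Word k A n), IsCycle (fun n => (cyc k A n).toAddMonoidHom) n z → kap k A n z = 0 →
    ∃ y, cyc k A n y = z

variable (k A) in
/-- The map `hkrWord` to forms of degree `n`. -/
def hkrDegree (n : ℕ) : Word k A n →ₗ[k] formDegree k A n :=
  (hkrWord k A n).codRestrict _ hkrWord_mem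

variable (k) in
/-- The map `ω ↦ - dW ∧ ω` on forms of degree `n`. -/
def twistDegree (n : ℕ) : formDegree k A n →ₗ[k] formDegree k A (n + 1) :=
  ((twist k W).domRestrict _).codRestrict _ fun ω => neg_mem (dForm_mul_mem W ω.2)

lemma cyc_curv'_of_isCycle {w : A} {n : ℕ} {z : Word k A n}
    (hz : IsCycle (fun n => (cyc k A n).toAddMonoidHom) n z) : cyc k A n (curv' w n z) = 0 := by
  cases n with
  | zero => exact cyc_curv'_zero w z
  | succ n =>
    have hz' : cyc k A n z = 0 := hz
    rw [eq_neg_of_add_eq_zero_left (cyc_curv' w z), hz', map_zero, neg_zero]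

/-- Inserting `b` everywhere except in front anticommutes with the cyclic differential and
multiplies the form by -db. Starting from the one-letter word `a`, this produces a cycle over each a
db₁ ∧ … ∧ dbₙ without antisymmetrizing by hand. -/
lemma exists_cycle_hkrWord [CharZero k] {n : ℕ} {ω : Forms k A} (hω : ω ∈ formDegree k A n) :
    ∃ z, IsCycle (fun n => (cyc k A n).toAddMonoidHom) n z ∧ hkrWord k A n z = ω := by
  refine formDegree_induction (P := fun ω => ∃ z, IsCycle (fun n => (cyc k A n).toAddMonoidHom) n z
    ∧ hkrWord k A n z = ω) ⟨0, IsPerturbation.isCycle_zero _ n, map_zero _⟩ ?_ ?_ hω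
  · rintro _ _ ⟨x, hx, rfl⟩ ⟨y, hy, rfl⟩
    refine ⟨x + y, ?_, map_add _ _ _⟩
    cases n with
    | zero => trivial
    | succ n =>
      have hx' : cyc k A n x = 0 := hx
      have hy' : cyc k A n y = 0 := hy
      change cyc k A n (x + y) = 0
      rw [map_add, hx', hy', add_zero]
  · intro a l hl
    clear hω
    subst hl
    induction l with
    | nil =>
      refine ⟨letter k a, trivial, ?_⟩
      simp [hkrWord_eq, kap_letter]
    | cons b l ih =>
      obtain ⟨z, hz, hz'⟩ := ih
      refine ⟨-curv' b l.length z, ?_, ?_⟩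
      · change cyc k A l.length (-curv' b l.length z) = 0
        rw [map_neg, cyc_curv'_of_isCycle hz, neg_zero]
      · rw [map_neg]
        refine (congrArg _ (hkrWord_curv' b z)).trans ?_
        rw [neg_neg, hz', dForm_mul_algebraMap_mul]
        rfl

lemma isPerturbation_cyc [CharZero k] (h : HKRInjective k A) :
    IsPerturbation (V := Word k A) (F := fun n => formDegree k A n)
      (fun n => (cyc k A n).toAddMonoidHom) (fun n => (curv' W n).toAddMonoidHom)
      (fun n => (hkrDegree k A n).toAddMonoidHom) (fun n => (twistDegree k W n).toAddMonoidHom) where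
  dw_zero x := cyc_curv'_zero W x
  dw _ x := cyc_curv' W x
  ww _ x := curv'_curv' W x
  ew _ x := Subtype.ext (hkrWord_curv' W x)
  surj_zero ω := by
    obtain ⟨z, -, hz⟩ := exists_cycle_hkrWord ω.2
    exact ⟨z, Subtype.ext hz⟩
  exact n x hx hx' ω := by
    have h1 : kap k A n x = 0 := by
      have h2 : hkrWord k A n x = 0 := congrArg Subtype.val hx'
      rw [hkrWord_eq, LinearMap.smul_apply, smul_eq_zero] at h2
      exact h2.resolve_left (one_div_ne_zero (Nat.cast_ne_zero.2 n.factorial_ne_zero))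
    obtain ⟨y, hy⟩ := h n x hx h1
    -- A cycle does not change the boundary of y, so it can be used to correct the image of y to the
    -- prescribed form.
    obtain ⟨z, hz, hz'⟩ := exists_cycle_hkrWord (sub_mem ω.2 (hkrWord_mem y))
    have hz0 : cyc k A n z = 0 := hz
    refine ⟨y + z, ?_, Subtype.ext ?_⟩
    · change cyc k A n (y + z) = x
      rw [map_add, hy, hz0, add_zero]
    · change hkrWord k A (n + 1) (y + z) = ω
      rw [map_add, hz', add_sub_cancel]

lemma hochb_inl (x : ∀ n, Word k A n) :
    hochb k W (x, 0) = (perturbed (fun n => (cyc k A n).toAddMonoidHom)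
      (fun n => (curv' W n).toAddMonoidHom) x, 0) := by
  refine hochPi_ext (fun n => ?_) (fun n => ?_)
  · cases n with
    | zero => simp [hochb_fst_zero, perturbed]
    | succ n => simp [hochb_fst_succ, perturbed]
  · cases n with
    | zero => simp [hochb_snd_zero]
    | succ n => simp [hochb_snd_succ]

lemma hochb_snd (x : HochPi k A) :
    (hochb k W x).2 = -perturbed (fun n => (bar k A n).toAddMonoidHom)
      (fun n => (curv W n).toAddMonoidHom) x.2 := by
  funext n
  cases n with
  | zero => simp [hochb_snd_zero, perturbed]
  | succ n => simp [hochb_snd_succ, perturbed]; abel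

lemma formComponent_dForm_mul (p : ℕ) (a : A) (ω : Forms k A) :
    formComponent k A (p + 1) (dForm k a * ω) = dForm k a * formComponent k A p ω := by
  have : formComponent k A (p + 1) ∘ₗ LinearMap.mulLeft k (dForm k a) =
      LinearMap.mulLeft k (dForm k a) ∘ₗ formComponent k A p := by
    refine forms_ext_degree fun q ω h => ?_
    simp only [LinearMap.comp_apply, LinearMap.mulLeft_apply]
    by_cases hq : q = p
    · subst hq
      rw [formComponent_of_mem (dForm_mul_mem a h), formComponent_of_mem h]
    · rw [formComponent_of_mem_ne (dForm_mul_mem a h) (by omega), formComponent_of_mem_ne h hq,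
        mul_zero]
  exact LinearMap.congr_fun this ω

variable [Algebra.FiniteType k A]

lemma formComponent_hkr_inl (x : ∀ n, Word k A n) (p : ℕ) :
    formComponent k A p (hkr k A (x, 0)) = hkrWord k A p (x p) := by
  obtain ⟨N, hN⟩ := exists_hkr_eq_sum (k := k) (A := A)
  rw [(hN (N + (p + 1)) (by omega)).2.2, map_add, map_sum,
    Finset.sum_eq_single_of_mem p (Finset.mem_range.2 (by omega))
      fun q _ hq => formComponent_of_mem_ne (hkrWord_mem _) hq, formComponent_of_mem (hkrWord_mem _)]
  simp

lemma hkr_inl_eq_of_components {x : ∀ n, Word k A n} {ω : Forms k A}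
    (h : ∀ n, hkrWord k A n (x n) = formComponent k A n ω) : hkr k A (x, 0) = ω := by
  rw [← sub_eq_zero]
  refine forms_eq_zero fun p => ?_
  rw [map_sub, formComponent_hkr_inl, h, sub_self]

/-- Subtract boundaries from x in three stages: clear the e-column, make the image under ε zero,
then solve the remaining equation in the column of words with first letter in `A`. -/
lemma exists_hochb_eq [CharZero k] (h : HKRInjective k A) {x : HochPi k A} (hx : hochb k W x = 0)
    {η : Forms k A} (hη : hkr k A x = twist k W η) : ∃ y, hochb k W y = x := by
  -- The sign is there because the second component of b is minus the perturbed bar differential.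
  obtain ⟨v, hv⟩ := (isPerturbation_bar W).exists_boundary (-x.2) (by
    rw [perturbed_neg, ← hochb_snd, hx]
    rfl) fun n => rfl
  have hp := isPerturbation_cyc W h
  -- The part of the primitive η not yet accounted for by the e-column is lifted to words, so that
  -- the boundary of (z, 0) removes the rest of ε(x).
  choose z hz using fun n => hp.surjective n
    ⟨formComponent k A n (η - hkr k A (0, v)), formComponent_mem _ _⟩
  have hz' : hkr k A (z, 0) = η - hkr k A (0, v) :=
    hkr_inl_eq_of_components fun n => congrArg Subtype.val (hz n)
  have hx2 : (x - hochb k W (0, v) - hochb k W (z, 0)).2 = 0 := by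
    rw [Prod.snd_sub, Prod.snd_sub, hochb_inl, hochb_snd, hv]
    simp
  obtain ⟨x', hx'⟩ : ∃ x', x - hochb k W (0, v) - hochb k W (z, 0) = (x', 0) :=
    ⟨_, Prod.ext rfl hx2⟩
  obtain ⟨y, hy⟩ := hp.exists_boundary x' (by
    have : hochb k W (x', 0) = 0 := by
      rw [← hx', map_sub, map_sub, hx, hochb_hochb, hochb_hochb, sub_zero, sub_zero]
    rw [hochb_inl] at this
    exact congrArg Prod.fst this) fun n => Subtype.ext (by
      change hkrWord k A n (x' n) = 0
      have h0 : hkr k A (x - hochb k W (0, v) - hochb k W (z, 0)) = 0 := by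
        rw [map_sub, map_sub, hkr_hochb, hkr_hochb, hη, twist_apply, hz', mul_sub]
        abel
      rw [← formComponent_hkr_inl, ← hx', h0, map_zero])
  refine ⟨(0, v) + (z, 0) + (y, 0), ?_⟩
  rw [map_add, map_add, hochb_inl W y, hy, ← hx']
  abel

lemma exists_cycle_hkr [CharZero k] (h : HKRInjective k A) {ω : Forms k A} (hω : twist k W ω = 0) :
    ∃ x, hochb k W x = 0 ∧ hkr k A x = ω := by
  obtain ⟨x, hx, hx'⟩ := (isPerturbation_cyc W h).exists_cycle
    (fun n => ⟨formComponent k A n ω, formComponent_mem n ω⟩) fun n => Subtype.ext (by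
      change -(dForm k W * formComponent k A n ω) = 0
      rw [← formComponent_dForm_mul, ← map_neg, ← twist_apply, hω, map_zero])
  refine ⟨(x, 0), ?_, hkr_inl_eq_of_components fun n => congrArg Subtype.val (hx' n)⟩
  rw [hochb_inl, hx]
  rfl

lemma isQuasiIso_hkr [CharZero k] (h : HKRInjective k A) : IsQuasiIso (hochb k W) (twist k W) (hkr k A) := by
  refine ⟨(isMixedMorphism_hkr W).comm_b, ?_, ?_⟩
  · rw [injective_iff_map_eq_zero]
    intro c hc
    obtain ⟨⟨x, hx⟩, rfl⟩ := Submodule.Quotient.mk_surjective _ c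
    rw [cohomologyMap, Submodule.mapQ_apply, Submodule.Quotient.mk_eq_zero] at hc
    obtain ⟨η, hη⟩ := hc
    obtain ⟨y, hy⟩ := exists_hochb_eq W h hx (η := η) hη.symm
    rw [Submodule.Quotient.mk_eq_zero]
    exact ⟨y, hy⟩
  · intro c
    obtain ⟨⟨ω, hω⟩, rfl⟩ := Submodule.Quotient.mk_surjective _ c
    obtain ⟨x, hx, rfl⟩ := exists_cycle_hkr W h hω
    exact ⟨Submodule.Quotient.mk ⟨x, hx⟩, rfl⟩

end Reduction

/-! ### Generators of the homology of a tensor product -/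

section Generators

variable {R : Type*} [CommRing R] {C : ℕ → Type*} [∀ n, AddCommGroup (C n)] [∀ n, Module R (C n)]
  (d : ∀ n, C (n + 1) →ₗ[R] C n)
  (S : Type*) [CommRing S] [Algebra R S]
  (M : Type*) [AddCommGroup M] [Module R M] [Module S M] [IsScalarTower R S M]
  {N : Type*} [AddCommGroup N] [Module R N] [Module S N] [IsScalarTower R S N]

/-- The differential of `M ⊗ C`. -/
def tensorDiff (n : ℕ) : M ⊗[R] C (n + 1) →ₗ[S] M ⊗[R] C n :=
  TensorProduct.AlgebraTensorModule.lTensor S M (d n)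

/-- The cycles of `M ⊗ C`. -/
def tensorCycles : ∀ n, Submodule S (M ⊗[R] C n)
  | 0 => ⊤
  | n + 1 => LinearMap.ker (tensorDiff d S M n)

/-- The boundaries of `M ⊗ C`. -/
abbrev tensorBoundaries (n : ℕ) : Submodule S (M ⊗[R] C n) := LinearMap.range (tensorDiff d S M n)

/-- The homology of `M ⊗ C` in degree `n` is generated by at most `c` elements. -/
def HomologyGenBy (n c : ℕ) : Prop :=
  ∃ s : Finset (M ⊗[R] C n), s.card ≤ c ∧ (s : Set (M ⊗[R] C n)) ⊆ tensorCycles d S M n ∧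
    tensorCycles d S M n ≤ Submodule.span S s ⊔ tensorBoundaries d S M n

variable {S M}

variable (C) in
/-- The map induced on `M ⊗ C` by a map of coefficients. -/
def tensorMap (f : M →ₗ[S] N) (n : ℕ) : M ⊗[R] C n →ₗ[S] N ⊗[R] C n :=
  TensorProduct.AlgebraTensorModule.rTensor R (C n) f

lemma tensorDiff_tensorMap (f : M →ₗ[S] N) (n : ℕ) (x : M ⊗[R] C (n + 1)) :
    tensorDiff d S N n (tensorMap C f (n + 1) x) = tensorMap C f n (tensorDiff d S M n x) := by
  induction x with
  | zero => simp only [map_zero]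
  | tmul m c => rfl
  | add x y hx hy => simp only [map_add, hx, hy]

lemma tensorMap_mem_cycles (f : M →ₗ[S] N) {n : ℕ} {x : M ⊗[R] C n}
    (hx : x ∈ tensorCycles d S M n) : tensorMap C f n x ∈ tensorCycles d S N n := by
  cases n with
  | zero => trivial
  | succ n =>
    have hx' : tensorDiff d S M n x = 0 := hx
    change tensorDiff d S N n _ = 0
    rw [tensorDiff_tensorMap, hx', map_zero]

lemma tensorMap_mem_boundaries (f : M →ₗ[S] N) {n : ℕ} {x : M ⊗[R] C n}
    (hx : x ∈ tensorBoundaries d S M n) : tensorMap C f n x ∈ tensorBoundaries d S N n := by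
  obtain ⟨y, rfl⟩ := hx
  exact ⟨tensorMap C f (n + 1) y, tensorDiff_tensorMap d f n y⟩

lemma tensorMap_comp_apply {P : Type*} [AddCommGroup P] [Module R P] [Module S P]
    [IsScalarTower R S P] (f : M →ₗ[S] N) (g : N →ₗ[S] P) (n : ℕ) (x : M ⊗[R] C n) :
    tensorMap C (g ∘ₗ f) n x = tensorMap C g n (tensorMap C f n x) := by
  induction x with
  | zero => simp only [map_zero]
  | tmul m c => rfl
  | add x y hx hy => simp only [map_add, hx, hy]

lemma tensorMap_id (n : ℕ) (x : M ⊗[R] C n) :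
    tensorMap C (LinearMap.id : M →ₗ[S] M) n x = x := by
  induction x with
  | zero => simp only [map_zero]
  | tmul m c => rfl
  | add x y hx hy => simp only [map_add, hx, hy]

lemma tensorMap_lsmul (s : S) (n : ℕ) (x : M ⊗[R] C n) :
    tensorMap C (LinearMap.lsmul S M s) n x = s • x := by
  induction x with
  | zero => simp only [map_zero, smul_zero]
  | tmul m c => rfl
  | add x y hx hy => simp only [map_add, hx, hy, smul_add]

variable {d}

lemma tensorDiff_tensorDiff (hdd : ∀ n x, d n (d (n + 1) x) = 0) {n : ℕ}
    (z : M ⊗[R] C (n + 2)) : tensorDiff d S M n (tensorDiff d S M (n + 1) z) = 0 := by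
  induction z with
  | zero => simp only [map_zero]
  | tmul m c => exact (congrArg (m ⊗ₜ[R] ·) (hdd n c)).trans (TensorProduct.tmul_zero _ _)
  | add x y hx hy => simp only [map_add, hx, hy, add_zero]

lemma HomologyGenBy.of_retract {n c : ℕ} (h : HomologyGenBy d S M n c) (i : N →ₗ[S] M)
    (p : M →ₗ[S] N) (hpi : p ∘ₗ i = LinearMap.id) : HomologyGenBy d S N n c := by
  classical
  obtain ⟨s, hs, hsc, hsg⟩ := h
  refine ⟨s.image (tensorMap C p n), Finset.card_image_le.trans hs, ?_, fun z hz => ?_⟩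
  · rintro _ hx
    rw [Finset.coe_image] at hx
    obtain ⟨x, hx, rfl⟩ := hx
    exact tensorMap_mem_cycles d p (hsc hx)
  · obtain ⟨a, ha, b, hb, hab⟩ := Submodule.mem_sup.1 (hsg (tensorMap_mem_cycles d i hz))
    refine Submodule.mem_sup.2 ⟨tensorMap C p n a, ?_, tensorMap C p n b,
      tensorMap_mem_boundaries d p hb, ?_⟩
    · rw [Finset.coe_image, ← Submodule.map_span]
      exact Submodule.mem_map_of_mem ha
    · rw [← map_add, hab, ← tensorMap_comp_apply, hpi, tensorMap_id]

/-- Flatness of the terms of the complex is used here, so that a regular element of the coefficients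
stays regular on chains. -/
lemma tensorMap_injective [∀ n, Module.Flat R (C n)] {f : M →ₗ[S] N} (hf : Function.Injective f) (n : ℕ) :
    Function.Injective (tensorMap (R := R) C f n) :=
  Module.Flat.rTensor_preserves_injective_linearMap (LinearMap.restrictScalars R f : M →ₗ[R] N) hf

lemma tensorMap_surjective {f : M →ₗ[S] N} (hf : Function.Surjective f) (n : ℕ) :
    Function.Surjective (tensorMap (R := R) C f n) :=
  LinearMap.rTensor_surjective (C n) (g := (LinearMap.restrictScalars R f : M →ₗ[R] N)) hf

lemma tensorMap_exact {x : S} {π : M →ₗ[S] N} (hπ : Function.Surjective π)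
    (hex : ∀ m, π m = 0 → ∃ m', m = x • m') (hx : ∀ m, π (x • m) = 0) (n : ℕ)
    {z : M ⊗[R] C n} (hz : tensorMap C π n z = 0) : ∃ z', z = x • z' := by
  have h : Function.Exact (LinearMap.restrictScalars R (LinearMap.lsmul S M x) : M →ₗ[R] M)
      (LinearMap.restrictScalars R π : M →ₗ[R] N) := by
    intro m
    constructor
    · intro hm
      obtain ⟨m', rfl⟩ := hex m hm
      exact ⟨m', rfl⟩
    · rintro ⟨m', rfl⟩
      exact hx m'
  obtain ⟨z', hz'⟩ := (rTensor_exact (C n) h hπ z).1 hz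
  refine ⟨z', hz'.symm.trans (tensorMap_lsmul x n z')⟩

/-- If `x` is regular on `M` and annihilates the homology of `M ⊗ C`, then the homology of
`M/x ⊗ C` is an extension of homology modules of `M ⊗ C`. -/
lemma HomologyGenBy.quotient [∀ n, Module.Flat R (C n)] (hdd : ∀ n x, d n (d (n + 1) x) = 0) {x : S} {π : M →ₗ[S] N} (hπ : Function.Surjective π)
    (hex : ∀ m, π m = 0 → ∃ m', m = x • m') (hx : ∀ m, π (x • m) = 0)
    (hinj : ∀ m : M, x • m = 0 → m = 0)
    (hkill : ∀ n, ∀ z ∈ tensorCycles d S M n, x • z ∈ tensorBoundaries d S M n)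
    {n c c' : ℕ} (h : HomologyGenBy d S M (n + 1) c) (h' : HomologyGenBy d S M n c') :
    HomologyGenBy d S N (n + 1) (c + c') := by
  classical
  obtain ⟨s, hs, hsc, hsg⟩ := h
  obtain ⟨t, ht, htc, htg⟩ := h'
  have hxinj : ∀ (n : ℕ) (z : M ⊗[R] C n), x • z = 0 → z = 0 := by
    intro n z hz
    rw [← tensorMap_lsmul] at hz
    refine tensorMap_injective (C := C) (f := LinearMap.lsmul S M x) (fun a b hab => ?_) n
      (hz.trans (map_zero _).symm)
    rw [← sub_eq_zero] at hab ⊢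
    rw [← map_sub] at hab
    exact hinj _ hab
  have hπx : ∀ (n : ℕ) (z : M ⊗[R] C n), tensorMap C π n (x • z) = 0 := by
    intro n z
    have : π ∘ₗ LinearMap.lsmul S M x = 0 := LinearMap.ext hx
    rw [← tensorMap_lsmul, ← tensorMap_comp_apply, this]
    induction z with
    | zero => simp only [map_zero]
    | tmul m c => exact TensorProduct.zero_tmul _ _
    | add x y hx hy => simp only [map_add, hx, hy, add_zero]
  -- For a generator y of H_n, a chain u with boundary x·y becomes a cycle modulo x; it lifts y
  -- along the connecting map. Outside `t` the value 0 is irrelevant.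
  have hdt : ∀ y : M ⊗[R] C n, ∃ u, y ∈ t → tensorDiff d S M n u = x • y := by
    intro y
    by_cases hy : y ∈ t
    · obtain ⟨u, hu⟩ := hkill n y (htc hy)
      exact ⟨u, fun _ => hu⟩
    · exact ⟨0, fun h => (hy h).elim⟩
  choose u hu using hdt
  refine ⟨s.image (tensorMap C π (n + 1)) ∪ (t.image u).image (tensorMap C π (n + 1)), ?_, ?_, ?_⟩
  · exact (Finset.card_union_le _ _).trans (add_le_add (Finset.card_image_le.trans hs)
      (Finset.card_image_le.trans (Finset.card_image_le.trans ht)))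
  · intro z hz
    rw [Finset.coe_union, Finset.coe_image, Finset.coe_image, Finset.coe_image] at hz
    rcases hz with ⟨z, hz, rfl⟩ | ⟨_, ⟨y, hy, rfl⟩, rfl⟩
    · exact tensorMap_mem_cycles d π (hsc hz)
    · change tensorDiff d S N n _ = 0
      rw [tensorDiff_tensorMap, hu y hy, hπx]
  · intro z hz
    obtain ⟨z, rfl⟩ := tensorMap_surjective hπ (n + 1) z
    have hz' : tensorMap C π n (tensorDiff d S M n z) = 0 := by
      rw [← tensorDiff_tensorMap]
      exact hz
    obtain ⟨y, hy⟩ := tensorMap_exact hπ hex hx n hz'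
    -- The class of y is the image of the given cycle under the connecting map; y is a cycle because
    -- x is injective on chains.
    have hyc : y ∈ tensorCycles d S M n := by
      cases n with
      | zero => trivial
      | succ n =>
        refine hxinj _ _ ?_
        rw [← map_smul, ← hy, tensorDiff_tensorDiff hdd]
    obtain ⟨a, ha, _, ⟨v, rfl⟩, rfl⟩ := Submodule.mem_sup.1 (htg hyc)
    have hb : ∃ b ∈ Submodule.span S ((t.image u : Finset _) : Set (M ⊗[R] C (n + 1))),
        tensorDiff d S M n b = x • a := by
      clear hy hyc
      induction ha using Submodule.span_induction with
      | mem y hy => exact ⟨u y, Submodule.subset_span (by simpa using ⟨y, hy, rfl⟩), hu y hy⟩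
      | zero => exact ⟨0, zero_mem _, by simp⟩
      | add a a' _ _ ha ha' =>
        obtain ⟨b, hb, hb'⟩ := ha
        obtain ⟨c, hc, hc'⟩ := ha'
        exact ⟨b + c, add_mem hb hc, by rw [map_add, hb', hc', smul_add]⟩
      | smul r a _ ha =>
        obtain ⟨b, hb, hb'⟩ := ha
        exact ⟨r • b, Submodule.smul_mem _ r hb, by rw [map_smul, hb', smul_comm]⟩
    obtain ⟨b, hb, hb'⟩ := hb
    -- Once the lift b of the connecting class is removed, together with a multiple of x that dies
    -- in the quotient, the chain is a genuine cycle over M.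
    have hz2 : z - b - x • v ∈ tensorCycles d S M (n + 1) := by
      change tensorDiff d S M n _ = 0
      rw [map_sub, map_sub, map_smul, hb', hy, smul_add]
      abel
    obtain ⟨e, he, f, hf, hef⟩ := Submodule.mem_sup.1 (hsg hz2)
    refine Submodule.mem_sup.2 ⟨tensorMap C π (n + 1) e + tensorMap C π (n + 1) b, ?_,
      tensorMap C π (n + 1) f, tensorMap_mem_boundaries d π hf, ?_⟩
    · rw [Finset.coe_union, Submodule.span_union, Finset.coe_image, Finset.coe_image (s := t.image u),
        ← Submodule.map_span, ← Submodule.map_span]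
      exact Submodule.add_mem_sup (Submodule.mem_map_of_mem he) (Submodule.mem_map_of_mem hb)
    · rw [add_right_comm, ← map_add, hef, map_sub, map_sub, hπx]
      abel

lemma HomologyGenBy.quotient_zero {π : M →ₗ[S] N} (hπ : Function.Surjective π)
    {c : ℕ} (h : HomologyGenBy d S M 0 c) : HomologyGenBy d S N 0 c := by
  classical
  obtain ⟨s, hs, hsc, hsg⟩ := h
  refine ⟨s.image (tensorMap C π 0), Finset.card_image_le.trans hs, fun _ _ => trivial,
    fun z _ => ?_⟩
  obtain ⟨z, rfl⟩ := tensorMap_surjective hπ 0 z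
  obtain ⟨a, ha, b, hb, rfl⟩ := Submodule.mem_sup.1 (hsg (x := z) trivial)
  rw [map_add, Finset.coe_image, ← Submodule.map_span]
  exact Submodule.add_mem_sup (Submodule.mem_map_of_mem ha) (tensorMap_mem_boundaries d π hb)

universe u

open scoped Pointwise

/-- Each division by a regular element adds the counts in degrees `n + 1` and `n`, so the binomial
coefficients follow Pascal's rule. The annihilation hypothesis is asked of all coefficient modules
because M changes along the list. -/
lemma HomologyGenBy.quotient_ofList [∀ n, Module.Flat R (C n)]
    (hdd : ∀ n x, d n (d (n + 1) x) = 0) {rs : List S}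
    (hkill : ∀ r ∈ rs, ∀ (M : Type u) [AddCommGroup M] [Module R M] [Module S M]
      [IsScalarTower R S M] (n : ℕ), ∀ z ∈ tensorCycles d S M n, r • z ∈ tensorBoundaries d S M n)
    {M : Type u} [AddCommGroup M] [Module R M] [Module S M] [IsScalarTower R S M]
    (hreg : RingTheory.Sequence.IsWeaklyRegular M rs) {l : ℕ}
    (h : ∀ n, HomologyGenBy d S M n (l.choose n)) (n : ℕ) :
    HomologyGenBy d S (M ⧸ (Ideal.ofList rs • ⊤ : Submodule S M)) n
      ((l + rs.length).choose n) := by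
  induction rs generalizing M l n with
  | nil =>
    have h0 : (Ideal.ofList ([] : List S) • ⊤ : Submodule S M) = ⊥ := by
      rw [Ideal.ofList_nil, Submodule.bot_smul]
    let e := Submodule.quotEquivOfEqBot _ h0
    refine (h n).of_retract e.toLinearMap e.symm.toLinearMap ?_
    ext x
    simp
  | cons r rs ih =>
    obtain ⟨hr, hrs⟩ := (RingTheory.Sequence.isWeaklyRegular_cons_iff M r rs).1 hreg
    have hq : ∀ n, HomologyGenBy d S (QuotSMulTop r M) n ((l + 1).choose n) := by
      have hπ : Function.Surjective (Submodule.mkQ (r • (⊤ : Submodule S M))) :=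
        Submodule.mkQ_surjective _
      rintro (_ | n)
      · have := (h 0).quotient_zero hπ
        simpa using this
      · rw [Nat.choose_succ_succ, add_comm (l.choose n)]
        refine (h (n + 1)).quotient hdd (x := r) hπ (fun m hm => ?_) (fun m => ?_) (fun m hm => ?_)
          (hkill r List.mem_cons_self M) (h n)
        · obtain ⟨m', -, hm'⟩ := (Submodule.mem_smul_pointwise_iff_exists _ _ _).1
            ((Submodule.Quotient.mk_eq_zero _).1 hm)
          exact ⟨m', hm'.symm⟩
        · exact (Submodule.Quotient.mk_eq_zero _).2
            (Submodule.smul_mem_pointwise_smul _ _ _ trivial)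
        · exact hr (hm.trans (smul_zero r).symm)
    have := ih (fun r hr => hkill r (List.mem_cons_of_mem _ hr)) hrs hq n
    let e := Submodule.quotOfListConsSMulTopEquivQuotSMulTopInner M r rs
    have h2 := this.of_retract e.toLinearMap e.symm.toLinearMap (by ext x; simp)
    rw [List.length_cons, add_comm rs.length, ← add_assoc]
    exact h2

end Generators

/-! ### The bar resolution -/

section BarModule

variable (k : Type*) [Field k] (A : Type*) [CommRing A] [Algebra k A]

/-- The multiplication of the first letter, as an action of `A`. -/
def firstAction (n : ℕ) : A →ₐ[k] Module.End k (Word k A n) :=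
  AlgHom.ofLinearMap
    { toFun := fun a => mulFirst k a
      map_add' := fun a b => LinearMap.ext fun x => by simp [mulFirst, insertAt_add]
      map_smul' := fun r a => LinearMap.ext fun x => by simp [mulFirst, insertAt_smul] }
    (LinearMap.ext fun x => mulFirst_one x)
    fun a b => LinearMap.ext fun x => (mulFirst_mulFirst a b x).symm

/-- The multiplication of the last letter, as an action of `A`. -/
def lastAction (n : ℕ) : A →ₐ[k] Module.End k (Word k A n) :=
  AlgHom.ofLinearMap
    { toFun := fun a => mulLast k a
      map_add' := fun a b => LinearMap.ext fun x => by simp [mulLast, insertAt_add]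
      map_smul' := fun r a => LinearMap.ext fun x => by simp [mulLast, insertAt_smul] }
    (LinearMap.ext fun x => mulLast_one x)
    fun a b => LinearMap.ext fun x => (mulLast_mulLast a b x).symm

/-- The action of `A ⊗ A` on the outer letters. -/
def outerAction (n : ℕ) : A ⊗[k] A →ₐ[k] Module.End k (Word k A n) :=
  Algebra.TensorProduct.lift (firstAction k A n) (lastAction k A n) fun a b =>
    LinearMap.ext fun x => mulFirst_mulLast a b x

/-- The term `A^{⊗ (n+2)}` of the bar resolution of the `A ⊗ A`-module `A`. -/
def Bar (n : ℕ) : Type _ := Word k A (n + 1)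

instance (n : ℕ) : AddCommGroup (Bar k A n) := inferInstanceAs (AddCommGroup (Word k A (n + 1)))

instance (n : ℕ) : Module k (Bar k A n) := inferInstanceAs (Module k (Word k A (n + 1)))

instance (n : ℕ) : Module (A ⊗[k] A) (Bar k A n) :=
  Module.compHom (Word k A (n + 1)) (outerAction k A (n + 1)).toRingHom

variable {k A}

lemma tmul_smul_bar {n : ℕ} (a b : A) (x : Bar k A n) :
    (a ⊗ₜ[k] b) • x = (mulFirst k a (mulLast k b (n := n + 1) x) : Word k A (n + 1)) := by
  exact LinearMap.congr_fun (Algebra.TensorProduct.lift_tmul (firstAction k A (n + 1))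
    (lastAction k A (n + 1)) (fun a b => LinearMap.ext fun x => mulFirst_mulLast a b x) a b) x

lemma tmul_one_smul_bar {n : ℕ} (a : A) (x : Bar k A n) :
    (a ⊗ₜ[k] (1 : A)) • x = (mulFirst k a (n := n + 1) x : Word k A (n + 1)) :=
  (tmul_smul_bar a 1 x).trans (congrArg (mulFirst k a) (mulLast_one (n := n + 1) x))

lemma one_tmul_smul_bar {n : ℕ} (a : A) (x : Bar k A n) :
    ((1 : A) ⊗ₜ[k] a) • x = (mulLast k a (n := n + 1) x : Word k A (n + 1)) :=
  (tmul_smul_bar 1 a x).trans (mulFirst_one (n := n + 1) _)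

/-- A map compatible with the multiplications of the outer letters is linear over `A ⊗ A`. -/
def barMap {n m : ℕ} (f : Word k A (n + 1) →ₗ[k] Word k A (m + 1))
    (h1 : ∀ a x, f (mulFirst k a x) = mulFirst k a (f x))
    (h2 : ∀ a x, f (mulLast k a x) = mulLast k a (f x)) : Bar k A n →ₗ[A ⊗[k] A] Bar k A m where
  toFun := f
  map_add' := f.map_add
  map_smul' r x := by
    let g : Bar k A n →+ Bar k A m := f.toAddMonoidHom
    change g (r • x) = r • g x
    induction r with
    | zero => rw [zero_smul, zero_smul, map_zero]
    | tmul a b =>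
      exact (congrArg g (tmul_smul_bar a b x)).trans ((h1 _ _).trans
        ((congrArg _ (h2 _ _)).trans (tmul_smul_bar a b (g x)).symm))
    | add r s hr hs => rw [add_smul, add_smul, map_add, hr, hs]

variable (k A)

/-- The differential of the bar resolution. -/
def barDiff (n : ℕ) : Bar k A (n + 1) →ₗ[A ⊗[k] A] Bar k A n :=
  barMap (bar k A (n + 1)) (fun a x => bar_mulFirst a x) (fun a x => bar_mulLast a x)

variable {k A}

lemma barDiff_barDiff (n : ℕ) (x : Bar k A (n + 2)) : barDiff k A n (barDiff k A (n + 1) x) = 0 :=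
  bar_bar (k := k) (A := A) x

lemma barDiff_exact (n : ℕ) : Function.Exact (barDiff k A (n + 1)) (barDiff k A n) := by
  intro (x : Word k A (n + 2))
  constructor
  · intro (h : bar k A (n + 1) x = 0)
    refine ⟨cons k 1 x, ?_⟩
    change bar k A (n + 2) (cons k 1 x) = x
    rw [bar_cons, h, map_zero, sub_zero, mulFirst_one]
  · rintro ⟨y, rfl⟩
    exact barDiff_barDiff n y

/-! The contracting homotopies. -/

/-- The alternating sum of the insertions of `w` between two letters. -/
def inner (w : A) (n : ℕ) : Word k A n →ₗ[k] Word k A (n + 1) :=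
  curv' w n + (-1 : k) ^ n • snoc k w

lemma inner_apply (w : A) {n : ℕ} (x : Word k A n) :
    inner w n x = curv' w n x + (-1 : k) ^ n • snoc k w x := rfl

lemma inner_zero (w : A) (x : Word k A 0) : inner w 0 x = 0 := by
  have : inner w 0 = (0 : Word k A 0 →ₗ[k] _) := by
    refine word_ext_zero fun a => ?_
    rw [inner_apply, curv'_letter, cons_letter, pow_zero, one_smul, neg_add_cancel]
    rfl
  exact LinearMap.congr_fun this x

lemma inner_snoc (w a : A) {n : ℕ} (x : Word k A n) :
    inner w (n + 1) (snoc k a x) = snoc k a (curv' w n x) := by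
  rw [inner_apply, curv'_apply, curv'_apply, curv_snoc, map_sub, cons_snoc, pow_succ]
  simp
  abel

lemma inner_mulFirst (w a : A) {n : ℕ} (x : Word k A (n + 1)) :
    inner w (n + 1) (mulFirst k a x) = mulFirst k a (inner w (n + 1) x) := by
  rw [inner_apply, curv'_mulFirst, inner_apply, map_add, map_smul, mulFirst_snoc]

lemma inner_mulLast (w a : A) {n : ℕ} (x : Word k A (n + 1)) :
    inner w (n + 1) (mulLast k a x) = mulLast k a (inner w (n + 1) x) := by
  have : inner w (n + 1) ∘ₗ mulLast k a = mulLast k a ∘ₗ inner w (n + 1) := by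
    refine word_ext_snoc fun b y => ?_
    simp only [LinearMap.comp_apply, mulLast_snoc, inner_snoc]
  exact LinearMap.congr_fun this x

/-- Inserting w between letters is a homotopy between multiplication by w at the two ends. The term
`(-1) ^ n • snoc k w` in `inner` removes the insertion after the last letter from `curv'`, which
makes the operator linear over A ⊗ A. -/
lemma bar_inner (w : A) {n : ℕ} (x : Word k A (n + 1)) :
    bar k A (n + 1) (inner w (n + 1) x) + inner w n (bar k A n x) =
      mulLast k w x - mulFirst k w x := by
  have h := bar_curv w x
  rw [inner_apply, inner_apply, curv'_apply, curv'_apply, map_add, map_sub, map_smul, bar_snoc,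
    bar_cons, smul_add, smul_smul, ← pow_add, Even.neg_one_pow ⟨n + 1, rfl⟩, one_smul,
    eq_neg_of_add_eq_zero_left h, pow_succ]
  simp
  abel

/-- Insertions of `w`, as a map of the bar resolution. -/
def barInner (w : A) (n : ℕ) : Bar k A n →ₗ[A ⊗[k] A] Bar k A (n + 1) :=
  barMap (inner w (n + 1)) (fun a x => inner_mulFirst w a x) (fun a x => inner_mulLast w a x)

lemma barDiff_barInner_zero (w : A) (x : Bar k A 0) :
    barDiff k A 0 (barInner w 0 x) = ((1 : A) ⊗ₜ[k] w - w ⊗ₜ[k] 1) • x := by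
  have h := bar_inner (k := k) w (n := 0) x
  rw [inner_zero, add_zero] at h
  rw [sub_smul, one_tmul_smul_bar, tmul_one_smul_bar]
  exact h

lemma barDiff_barInner (w : A) (n : ℕ) (x : Bar k A (n + 1)) :
    barDiff k A (n + 1) (barInner w (n + 1) x) + barInner w n (barDiff k A n x) =
      ((1 : A) ⊗ₜ[k] w - w ⊗ₜ[k] 1) • x := by
  rw [sub_smul, one_tmul_smul_bar, tmul_one_smul_bar]
  exact bar_inner (k := k) w (n := n + 1) x

section Coefficients

variable {S : Type*} [CommRing S] [Algebra (A ⊗[k] A) S]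
  {M : Type*} [AddCommGroup M] [Module (A ⊗[k] A) M] [Module S M] [IsScalarTower (A ⊗[k] A) S M]

/-- The diagonal ideal is generated by the elements 1 ⊗ w - w ⊗ 1, each of which acts
null-homotopically through `barInner w`. -/
lemma smul_mem_tensorBoundaries_bar {r : A ⊗[k] A} (hr : r ∈ KaehlerDifferential.ideal k A) {n : ℕ}
    {z : M ⊗[A ⊗[k] A] Bar k A n} (hz : z ∈ tensorCycles (barDiff k A) S M n) :
    algebraMap (A ⊗[k] A) S r • z ∈ tensorBoundaries (barDiff k A) S M n := by
  rw [← KaehlerDifferential.span_range_eq_ideal] at hr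
  induction hr using Submodule.span_induction with
  | mem r hr =>
    obtain ⟨w, rfl⟩ := hr
    refine ⟨(LinearMap.lTensor M (barInner w n)) z, ?_⟩
    rw [algebraMap_smul]
    cases n with
    | zero =>
      clear hz
      induction z with
      | zero => simp only [map_zero, smul_zero]
      | tmul m c =>
        exact (congrArg (m ⊗ₜ[A ⊗[k] A] ·) (barDiff_barInner_zero w c)).trans
          (TensorProduct.tmul_smul _ _ _)
      | add x y hx hy => rw [map_add, map_add, hx, hy, smul_add]
    | succ n =>
      have key : ∀ z : M ⊗[A ⊗[k] A] Bar k A (n + 1),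
          tensorDiff (barDiff k A) S M (n + 1) (LinearMap.lTensor M (barInner w (n + 1)) z) +
            LinearMap.lTensor M (barInner w n) (tensorDiff (barDiff k A) S M n z) =
          ((1 : A) ⊗ₜ[k] w - w ⊗ₜ[k] 1) • z := by
        intro z
        induction z with
        | zero => simp only [map_zero, smul_zero, add_zero]
        | tmul m c =>
          rw [← TensorProduct.tmul_smul, ← barDiff_barInner, TensorProduct.tmul_add]
          rfl
        | add x y hx hy =>
          simp only [map_add, smul_add, ← hx, ← hy]
          abel
      have hz' : tensorDiff (barDiff k A) S M n z = 0 := hz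
      have := key z
      rwa [hz', map_zero, add_zero] at this
  | zero => rw [map_zero, zero_smul]; exact zero_mem _
  | add r s _ _ hr hs => rw [map_add, add_smul]; exact add_mem hr hs
  | smul a r _ hr => rw [smul_eq_mul, map_mul, mul_smul]; exact Submodule.smul_mem _ _ hr

end Coefficients

end BarModule

/-! ### Flatness of the bar resolution -/

section BarFlat

variable (k : Type*) [Field k] (A : Type*) [CommRing A] [Algebra k A]

/-- Splitting off the first letter. -/
def unconsWord (n : ℕ) : Word k A (n + 1) →ₗ[k] A ⊗[k] Word k A n :=
  PiTensorProduct.lift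
    (LinearMap.uncurryLeft (M := fun _ : Fin (n + 2) => A)
      { toFun := fun a =>
          (TensorProduct.mk k A (Word k A n) a).compMultilinearMap (PiTensorProduct.tprod k)
        map_add' := fun a b => by ext; simp
        map_smul' := fun r a => by ext; simp [TensorProduct.smul_tmul'] })

/-- Splitting off the last letter. -/
def unsnocWord (n : ℕ) : Word k A (n + 1) →ₗ[k] A ⊗[k] Word k A n :=
  PiTensorProduct.lift
    (MultilinearMap.uncurryRight (M := fun _ : Fin (n + 2) => A)
      ((TensorProduct.mk k A (Word k A n)).flip.compMultilinearMap (PiTensorProduct.tprod k)))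

variable {k A}

lemma unconsWord_cons (a : A) {n : ℕ} (x : Word k A n) :
    unconsWord k A n (cons k a x) = a ⊗ₜ x := by
  have : unconsWord k A n ∘ₗ cons k a = TensorProduct.mk k A (Word k A n) a := by
    ext b
    simp [unconsWord, cons, LinearMap.uncurryLeft_apply]
  exact LinearMap.congr_fun this x

lemma unsnocWord_snoc (a : A) {n : ℕ} (x : Word k A n) :
    unsnocWord k A n (snoc k a x) = a ⊗ₜ x := by
  have : unsnocWord k A n ∘ₗ snoc k a = TensorProduct.mk k A (Word k A n) a := by
    ext b
    simp [unsnocWord, snoc, MultilinearMap.uncurryRight_apply, Fin.init_def]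
  exact LinearMap.congr_fun this x

instance (n : ℕ) : IsScalarTower k (A ⊗[k] A) (Bar k A n) :=
  IsScalarTower.of_algebraMap_smul fun r x =>
    LinearMap.congr_fun ((outerAction k A (n + 1)).commutes r) x

/-- The word `(1, 1)`. -/
def barOne : Bar k A 0 := cons k 1 (letter k 1)

lemma tmul_smul_barOne (a b : A) : (a ⊗ₜ[k] b) • (barOne : Bar k A 0) = cons k a (letter k b) := by
  refine (tmul_smul_bar a b _).trans ?_
  rw [barOne, mulLast_cons, mulFirst_cons, mulLast_letter, one_mul, mul_one]

variable (k A)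

/-- `Bar 0` is free of rank one. -/
def barZeroEquiv : (A ⊗[k] A) ≃ₗ[A ⊗[k] A] Bar k A 0 :=
  LinearEquiv.ofBijective (LinearMap.toSpanSingleton (A ⊗[k] A) (Bar k A 0) barOne) <| by
    let s : Word k A 0 →ₗ[k] A := (PiTensorProduct.subsingletonEquiv (0 : Fin 1)).toLinearMap
    have hs : ∀ a : A, s (letter k a) = a := fun a => by simp [s, letter, word]
    let g : Word k A 1 →ₗ[k] A ⊗[k] A := LinearMap.lTensor A s ∘ₗ unconsWord k A 0
    refine Function.bijective_iff_has_inverse.2 ⟨g, fun r => ?_, ?_⟩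
    · change g (r • (barOne : Bar k A 0)) = r
      induction r with
      | zero => rw [zero_smul]; exact map_zero g
      | tmul a b =>
        rw [tmul_smul_barOne]
        simp only [g, LinearMap.comp_apply, unconsWord_cons, LinearMap.lTensor_tmul, hs]
      | add r s hr hs =>
        rw [add_smul]
        exact (map_add g _ _).trans (congrArg₂ _ hr hs)
    · let f : A ⊗[k] A →ₗ[k] Word k A 1 :=
        (LinearMap.toSpanSingleton (A ⊗[k] A) (Bar k A 0) barOne).restrictScalars k
      have : f ∘ₗ g = LinearMap.id := by
        refine word_ext_cons fun a x => ?_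
        refine LinearMap.congr_fun (f := (f ∘ₗ g) ∘ₗ cons k a) (g := cons k a) ?_ x
        refine word_ext_zero fun b => ?_
        simp only [g, LinearMap.comp_apply, unconsWord_cons, LinearMap.lTensor_tmul, hs]
        exact tmul_smul_barOne a b
      exact fun x => LinearMap.congr_fun this x

/-- `(a_0, …, a_n) ↦ (1, a_0, …, a_n, 1)`. -/
def padOne (n : ℕ) : Word k A n →ₗ[k] Bar k A (n + 1) :=
  (cons k 1 ∘ₗ snoc k 1 : Word k A n →ₗ[k] Word k A (n + 2))

/-- `Bar (n + 1)` is an extended module. -/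
def barSuccEquiv (n : ℕ) : (A ⊗[k] A) ⊗[k] Word k A n ≃ₗ[A ⊗[k] A] Bar k A (n + 1) :=
  LinearEquiv.ofBijective
    (LinearMap.liftBaseChange (A ⊗[k] A) (padOne k A n)) <| by
    have hf : ∀ (a b : A) (x : Word k A n),
        LinearMap.liftBaseChange (A ⊗[k] A) (padOne k A n)
          ((a ⊗ₜ[k] b) ⊗ₜ[k] x) = (cons k a (snoc k b x) : Word k A (n + 2)) := fun a b x => by
      rw [LinearMap.liftBaseChange_tmul]
      refine (tmul_smul_bar a b _).trans ?_
      change mulFirst k a (mulLast k b (cons k 1 (snoc k 1 x))) = _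
      rw [mulLast_cons, mulFirst_cons, mulLast_snoc, one_mul, mul_one]
    let g : Word k A (n + 2) →ₗ[k] (A ⊗[k] A) ⊗[k] Word k A n :=
      (TensorProduct.assoc k A A (Word k A n)).symm.toLinearMap ∘ₗ
        LinearMap.lTensor A (unsnocWord k A n) ∘ₗ unconsWord k A (n + 1)
    have hg : ∀ (a b : A) (x : Word k A n), g (cons k a (snoc k b x)) = (a ⊗ₜ[k] b) ⊗ₜ[k] x :=
      fun a b x => by
        simp only [g, LinearMap.comp_apply, unconsWord_cons, LinearMap.lTensor_tmul,
          unsnocWord_snoc, LinearEquiv.coe_coe, TensorProduct.assoc_symm_tmul]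
    let f : (A ⊗[k] A) ⊗[k] Word k A n →ₗ[k] Word k A (n + 2) :=
      (LinearMap.liftBaseChange (A ⊗[k] A) (padOne k A n)).restrictScalars k
    refine Function.bijective_iff_has_inverse.2 ⟨g, fun r => ?_, fun x => ?_⟩
    · refine LinearMap.congr_fun (f := g ∘ₗ f) (g := LinearMap.id) ?_ r
      ext a b x
      -- Words with both outer letters split off match pure tensors on the two sides, so checking
      -- the composites on these suffices.
      exact (congrArg g (hf a b (PiTensorProduct.tprod k x))).trans (hg a b _)
    · refine LinearMap.congr_fun (f := f ∘ₗ g) (g := LinearMap.id) ?_ x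
      refine word_ext_cons fun a x => ?_
      refine LinearMap.congr_fun (f := (f ∘ₗ g) ∘ₗ cons k a) (g := cons k a) ?_ x
      refine word_ext_snoc fun b x => ?_
      rw [LinearMap.comp_apply, LinearMap.comp_apply, hg]
      exact hf a b x

instance : ∀ n, Module.Flat (A ⊗[k] A) (Bar k A n)
  | 0 => Module.Flat.of_linearEquiv (barZeroEquiv k A).symm
  | n + 1 => Module.Flat.of_linearEquiv (barSuccEquiv k A n).symm

variable {k A}

/-- The homology of the bar resolution after a flat base change. -/
lemma homologyGenBy_of_flat (S : Type*) [CommRing S] [Algebra (A ⊗[k] A) S]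
    [Module.Flat (A ⊗[k] A) S] (n : ℕ) :
    HomologyGenBy (barDiff k A) S S n (Nat.choose 0 n) := by
  cases n with
  | zero =>
    refine ⟨{1 ⊗ₜ barOne}, by simp, fun _ _ => trivial, fun z hz => ?_⟩
    refine Submodule.mem_sup_left ?_
    clear hz
    rw [Finset.coe_singleton]
    induction z with
    | zero => exact zero_mem _
    | tmul s x =>
      obtain ⟨r, rfl⟩ := (barZeroEquiv k A).surjective x
      refine Submodule.mem_span_singleton.2 ⟨r • s, ?_⟩
      rw [TensorProduct.smul_tmul', smul_eq_mul, mul_one, TensorProduct.smul_tmul]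
      rfl
    | add x y hx hy => exact add_mem hx hy
  | succ n =>
    refine ⟨∅, by simp, by simp, fun z hz => Submodule.mem_sup_right ?_⟩
    -- The bar resolution is exact in positive degrees, and flat coefficients preserve this; so no
    -- generators are needed there.
    obtain ⟨y, hy⟩ := (Module.Flat.lTensor_exact S (barDiff_exact (k := k) (A := A) n) z).1 hz
    exact ⟨y, hy⟩

end BarFlat

/-! ### The diagonal of an étale algebra over a polynomial ring -/

section Variables

variable {σ K : Type*} [CommRing K]

/-- Membership in a monomial ideal is tested on monomials, and multiplication by Xᵢ does not create
divisibility by any other variable. -/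
lemma mem_span_variables_of_X_mul {s : Set σ} {i : σ} (hi : i ∉ s) {p : MvPolynomial σ K}
    (hp : MvPolynomial.X i * p ∈ Ideal.span (MvPolynomial.X '' s : Set (MvPolynomial σ K))) :
    p ∈ Ideal.span (MvPolynomial.X '' s : Set (MvPolynomial σ K)) := by
  classical
  rw [MvPolynomial.mem_ideal_span_X_image] at hp ⊢
  intro m hm
  obtain ⟨j, hj, hmj⟩ := hp (Finsupp.single i 1 + m) (by
    rw [MvPolynomial.mem_support_iff, MvPolynomial.coeff_X_mul]
    exact MvPolynomial.mem_support_iff.1 hm)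
  refine ⟨j, hj, ?_⟩
  have hij : i ≠ j := fun h => hi (h ▸ hj)
  rwa [Finsupp.add_apply, Finsupp.single_eq_of_ne hij.symm, zero_add] at hmj

lemma isWeaklyRegular_variables {l : List σ} (hl : l.Nodup) :
    RingTheory.Sequence.IsWeaklyRegular (MvPolynomial σ K)
      (l.map (MvPolynomial.X (R := K))) := by
  induction l using List.reverseRecOn with
  | nil => simp
  | append_singleton l i ih =>
    rw [List.nodup_append] at hl
    rw [List.map_append, RingTheory.Sequence.isWeaklyRegular_append_iff]
    refine ⟨ih hl.1, ?_⟩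
    rw [List.map_singleton, RingTheory.Sequence.isWeaklyRegular_singleton_iff]
    have hI : (Ideal.ofList (l.map (MvPolynomial.X (R := K))) • ⊤ :
        Submodule (MvPolynomial σ K) (MvPolynomial σ K)) =
        Ideal.span (MvPolynomial.X '' {j | j ∈ l}) := by
      rw [smul_eq_mul, Ideal.mul_top, Ideal.ofList]
      congr 1
      ext p
      simp
    rw [hI, isSMulRegular_iff_right_eq_zero_of_smul]
    intro p hp
    obtain ⟨p, rfl⟩ := Submodule.Quotient.mk_surjective _ p
    rw [← Submodule.Quotient.mk_smul, Submodule.Quotient.mk_eq_zero] at hp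
    rw [Submodule.Quotient.mk_eq_zero]
    exact mem_span_variables_of_X_mul (i := i) (s := {j | j ∈ l}) (fun h => hl.2.2 i h i (List.mem_singleton_self i) rfl) hp

/-- Translation of the variables. -/
def translation (t : σ → K) : MvPolynomial σ K →ₐ[K] MvPolynomial σ K :=
  MvPolynomial.aeval fun i => MvPolynomial.X i + MvPolynomial.C (t i)

lemma translation_X (t : σ → K) (i : σ) :
    translation t (MvPolynomial.X i) = MvPolynomial.X i + MvPolynomial.C (t i) :=
  MvPolynomial.aeval_X _ i

lemma translation_translation {s t : σ → K} (h : ∀ i, s i + t i = 0) (p : MvPolynomial σ K) :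
    translation s (translation t p) = p := by
  have : (translation s).comp (translation t) = AlgHom.id K _ := by
    ext i : 1
    rw [AlgHom.comp_apply, translation_X, map_add, translation_X, ← MvPolynomial.algebraMap_eq,
      AlgHom.commutes, add_assoc, ← map_add, h, map_zero, add_zero]
    rfl
  exact DFunLike.congr_fun this p

end Variables

section Diagonal

variable (k : Type*) [Field k] (L : Type*) [CommRing L] [Algebra k L] {σ : Type*}
  [Algebra (MvPolynomial σ k) L]

/-- The coordinate functions. -/
def coordinate (i : σ) : L := algebraMap (MvPolynomial σ k) L (MvPolynomial.X i)

/-- The difference of the two pullbacks of a coordinate function. -/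
def diagonalElement (i : σ) : L ⊗[k] L :=
  1 ⊗ₜ coordinate k L i - coordinate k L i ⊗ₜ 1

lemma diagonalElement_mem (i : σ) : diagonalElement k L i ∈ KaehlerDifferential.ideal k L :=
  KaehlerDifferential.one_smul_sub_smul_one_mem_ideal k _

variable [IsScalarTower k (MvPolynomial σ k) L]

/-- The map of the affine space over `L` to `L ⊗ L` given by the elements `diagonalElement`. -/
def diagonalMap : MvPolynomial σ L →+* L ⊗[k] L :=
  ((Algebra.TensorProduct.map (AlgHom.id L L)
      (IsScalarTower.toAlgHom k (MvPolynomial σ k) L)).toRingHom.comp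
    (MvPolynomial.algebraTensorAlgEquiv k L (σ := σ)).symm.toAlgHom.toRingHom).comp
    (translation fun i => -coordinate k L i).toRingHom

lemma diagonalMap_X (i : σ) : diagonalMap k L (MvPolynomial.X i) = diagonalElement k L i := by
  let e := MvPolynomial.algebraTensorAlgEquiv k L (σ := σ)
  let f : L ⊗[k] MvPolynomial σ k →ₐ[L] L ⊗[k] L := Algebra.TensorProduct.map (AlgHom.id L L)
    (IsScalarTower.toAlgHom k (MvPolynomial σ k) L)
  change f (e.symm (translation _ (MvPolynomial.X i))) = _
  rw [translation_X, map_add, ← MvPolynomial.algebraMap_eq, AlgEquiv.commutes,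
    MvPolynomial.algebraTensorAlgEquiv_symm_X, map_add, AlgHom.commutes, map_neg, ← sub_eq_add_neg]
  simp only [f, Algebra.TensorProduct.map_tmul, map_one]
  rfl

/-- Translation and the identification of L[X] with L ⊗ k[X] are isomorphisms; what is left is a
base change of the flat map from k[X] to L. -/
lemma diagonalMap_flat [Module.Flat (MvPolynomial σ k) L] :
    (diagonalMap k L (σ := σ)).Flat := by
  refine RingHom.Flat.comp (RingHom.Flat.of_bijective ?_) (RingHom.Flat.comp
    (RingHom.Flat.of_bijective (AlgEquiv.bijective _)) (RingHom.Flat.tensorProductMap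
      (RingHom.Flat.id L) (RingHom.flat_algebraMap_iff.2 inferInstance)))
  exact Function.bijective_iff_has_inverse.2 ⟨translation fun i => coordinate k L i,
    translation_translation fun i => add_neg_cancel _,
    translation_translation fun i => neg_add_cancel _⟩

/-- The variables of L[X] are weakly regular, and flat maps preserve this; `diagonalMap` sends them
to the diagonal elements. -/
lemma isWeaklyRegular_diagonalElement [Module.Flat (MvPolynomial σ k) L] {l : List σ}
    (hl : l.Nodup) :
    RingTheory.Sequence.IsWeaklyRegular (L ⊗[k] L) (l.map (diagonalElement k L)) := by
  let _ := (diagonalMap k L (σ := σ)).toAlgebra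
  have : Module.Flat (MvPolynomial σ L) (L ⊗[k] L) := diagonalMap_flat k L
  have h := (isWeaklyRegular_variables (K := L) hl).of_flat (S := L ⊗[k] L)
  rw [List.map_map] at h
  have h2 : l.map (diagonalElement k L) =
      l.map (algebraMap (MvPolynomial σ L) (L ⊗[k] L) ∘ MvPolynomial.X) :=
    List.map_congr_left fun i _ => (diagonalMap_X k L i).symm
  rw [h2]
  exact h

/-- The differentials of the coordinates form a basis. -/
def coordinateBasis [Algebra.FormallyEtale (MvPolynomial σ k) L] : Module.Basis σ L Ω[L⁄k] :=
  ((KaehlerDifferential.mvPolynomialBasis k σ).baseChange L).map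
    (KaehlerDifferential.tensorKaehlerEquivOfFormallyEtale k (MvPolynomial σ k) L)

lemma coordinateBasis_apply [Algebra.FormallyEtale (MvPolynomial σ k) L] (i : σ) :
    coordinateBasis k L i = KaehlerDifferential.D k L (coordinate k L i) := by
  simp [coordinateBasis, coordinate]

/-- The diagonal is open and closed in the zero locus of I, the ideal of the diagonal elements.
Indeed the differentials of the coordinates generate J/J², the module of differentials, so J = I +
J², and J is finitely generated. -/
lemma exists_projector [Algebra.FormallyEtale (MvPolynomial σ k) L]
    [Algebra.FiniteType k L] {l : List σ} (hl : ∀ i, i ∈ l) :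
    ∃ e ∈ KaehlerDifferential.ideal k L, ∀ j ∈ KaehlerDifferential.ideal k L,
      j - j * e ∈ Ideal.ofList (l.map (diagonalElement k L)) := by
  set J := KaehlerDifferential.ideal k L
  set I := Ideal.ofList (l.map (diagonalElement k L))
  have hmem : ∀ i, diagonalElement k L i ∈ I := fun i =>
    Ideal.subset_span (List.mem_map_of_mem (hl i))
  have hIJ : I ≤ J := Ideal.span_le.2 fun x hx => by
    obtain ⟨i, -, rfl⟩ := List.mem_map.1 hx
    exact diagonalElement_mem k L i
  have hspan : ∀ ω : Ω[L⁄k], ∃ y : J, (y : L ⊗[k] L) ∈ I ∧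
      KaehlerDifferential.fromIdeal k L y = ω := by
    intro ω
    have hω : ω ∈ Submodule.span L (Set.range (coordinateBasis k L (σ := σ))) := by
      rw [Module.Basis.span_eq]; trivial
    induction hω using Submodule.span_induction with
    | mem ω hω =>
      obtain ⟨i, rfl⟩ := hω
      exact ⟨⟨_, diagonalElement_mem k L i⟩, hmem i, (coordinateBasis_apply k L i).symm⟩
    | zero => exact ⟨0, zero_mem _, map_zero _⟩
    | add ω η _ _ hω hη =>
      obtain ⟨y, hy, rfl⟩ := hω
      obtain ⟨z, hz, rfl⟩ := hη
      exact ⟨y + z, add_mem hy hz, map_add _ _ _⟩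
    | smul a ω _ hω =>
      obtain ⟨y, hy, rfl⟩ := hω
      refine ⟨(a ⊗ₜ[k] (1 : L)) • y, I.mul_mem_left _ hy, ?_⟩
      rw [map_smul]
      exact algebraMap_smul (L ⊗[k] L) a (KaehlerDifferential.fromIdeal k L y)
  have hJ : J ≤ I ⊔ J • J := by
    intro j hj
    obtain ⟨y, hy, hyj⟩ := hspan (KaehlerDifferential.fromIdeal k L ⟨j, hj⟩)
    have h2 : (y : L ⊗[k] L) - j ∈ J ^ 2 := (Ideal.toCotangent_eq J).1 hyj
    rw [← neg_mem_iff, neg_sub, pow_two] at h2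
    rw [← sub_add_cancel j (y : L ⊗[k] L)]
    exact add_mem (Submodule.mem_sup_right h2) (Submodule.mem_sup_left hy)
  -- Nakayama's lemma gives r ≡ 1 modulo J with rJ contained in I; the projector is e = 1 - r.
  obtain ⟨r, hr, hrJ⟩ := Submodule.exists_sub_one_mem_and_smul_le_of_fg_of_le_sup
    (KaehlerDifferential.ideal_fg k L) le_rfl hJ
  refine ⟨1 - r, ?_, fun j hj => ?_⟩
  · rw [← neg_mem_iff, neg_sub]
    exact hr
  · have : j - j * (1 - r) = r • j := by rw [smul_eq_mul]; ring
    rw [this]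
    exact hrJ (Submodule.smul_mem_pointwise_smul _ _ _ hj)

end Diagonal

/-! ### Generators of the homology over an étale coordinate chart -/

section ChangeOfScalars

variable {R : Type*} [CommRing R] {C : ℕ → Type*} [∀ n, AddCommGroup (C n)] [∀ n, Module R (C n)]
  {d : ∀ n, C (n + 1) →ₗ[R] C n}
  {S : Type*} [CommRing S] [Algebra R S] {S' : Type*} [CommRing S'] [Algebra R S'] [Algebra S S']
  {M : Type*} [AddCommGroup M] [Module R M] [Module S M] [IsScalarTower R S M]
  [Module S' M] [IsScalarTower R S' M] [IsScalarTower S S' M]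

lemma HomologyGenBy.of_scalarTower {n c : ℕ} (h : HomologyGenBy d S M n c) :
    HomologyGenBy d S' M n c := by
  obtain ⟨s, hs, hsc, hsg⟩ := h
  have hc : ∀ x, x ∈ tensorCycles d S M n ↔ x ∈ tensorCycles d S' M n := by
    cases n with
    | zero => exact fun x => Iff.rfl
    | succ n => exact fun x => Iff.rfl
  refine ⟨s, hs, fun x hx => (hc x).1 (hsc hx), fun x hx => ?_⟩
  obtain ⟨a, ha, b, hb, rfl⟩ := Submodule.mem_sup.1 (hsg ((hc x).2 hx))
  exact Submodule.add_mem_sup (Submodule.span_le_restrictScalars S S' _ ha) hb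

end ChangeOfScalars

section Chart

variable {k : Type*} [Field k] {A : Type*} [CommRing A] [Algebra k A]

/-- The homology of the bar resolution over an algebra `L`, a direct factor of the quotient of a
flat algebra `S` by a weakly regular sequence which divides elements of the diagonal ideal. -/
lemma homologyGenBy_of_isWeaklyRegular {S L : Type*} [CommRing S] [CommRing L]
    [Algebra (A ⊗[k] A) S] [Algebra (A ⊗[k] A) L] [Algebra S L]
    (hflat : (algebraMap (A ⊗[k] A) S).Flat)
    (htower : ∀ r, algebraMap (A ⊗[k] A) L r = algebraMap S L (algebraMap (A ⊗[k] A) S r))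
    (hsurj : Function.Surjective (algebraMap S L)) {rs : List S}
    (hreg : RingTheory.Sequence.IsWeaklyRegular S rs)
    (hkill : ∀ r ∈ rs, ∃ (v : Sˣ) (x : A ⊗[k] A), x ∈ KaehlerDifferential.ideal k A ∧
      algebraMap (A ⊗[k] A) S x = v * r)
    {e : S} (he : algebraMap S L e = 0) (hrs : ∀ r ∈ rs, algebraMap S L r = 0)
    (hproj : ∀ s, algebraMap S L s = 0 → s - s * e ∈ Ideal.ofList rs) (n : ℕ) :
    HomologyGenBy (barDiff k A) L L n (rs.length.choose n) := by
  have : Module.Flat (A ⊗[k] A) S := RingHom.flat_algebraMap_iff.1 hflat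
  have : IsScalarTower (A ⊗[k] A) S L := IsScalarTower.of_algebraMap_eq htower
  -- Only elements coming from the diagonal ideal of A ⊗ A act on the bar resolution; a member of
  -- the list is such an element up to a unit of S, so it kills homology too.
  have hgen := HomologyGenBy.quotient_ofList (d := barDiff k A) barDiff_barDiff
    (rs := rs) (fun r hr M _ _ _ _ n z hz => by
      obtain ⟨v, x, hx, hxr⟩ := hkill r hr
      have h := Submodule.smul_mem _ ((v⁻¹ : Sˣ) : S) (smul_mem_tensorBoundaries_bar (S := S) hx hz)
      rwa [hxr, smul_smul, Units.inv_mul_cancel_left] at h)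
    hreg (homologyGenBy_of_flat S) n
  rw [zero_add] at hgen
  have hI : (Ideal.ofList rs • ⊤ : Submodule S S) = Ideal.ofList rs := by
    rw [smul_eq_mul, Ideal.mul_top]
  have hker : (Ideal.ofList rs • ⊤ : Submodule S S) ≤ LinearMap.ker (Algebra.linearMap S L) := by
    rw [hI, Ideal.ofList, Ideal.span_le]
    exact hrs
  choose t ht using hsurj
  -- Multiplication by 1 - e sends the kernel of S → L into the ideal of the sequence, so the class
  -- of s(1 - e) depends only on the image of s in L. This gives the S-linear section of the
  -- projection to L, as e maps to 0.
  have hmk : ∀ s s', algebraMap S L s = algebraMap S L s' →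
      Submodule.Quotient.mk (p := (Ideal.ofList rs • ⊤ : Submodule S S)) (s * (1 - e)) =
        Submodule.Quotient.mk (s' * (1 - e)) := fun s s' h => by
    rw [Submodule.Quotient.eq, hI]
    have := hproj (s - s') (by rw [map_sub, h, sub_self])
    convert this using 1
    ring
  let i : L →ₗ[S] S ⧸ (Ideal.ofList rs • ⊤ : Submodule S S) :=
    { toFun := fun l => Submodule.Quotient.mk (t l * (1 - e))
      map_add' := fun l l' => by
        rw [← Submodule.Quotient.mk_add, ← add_mul]
        exact hmk _ _ (by rw [map_add, ht, ht, ht])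
      map_smul' := fun s l => by
        have h : s • (t l * (1 - e)) = s * t l * (1 - e) := (mul_assoc s _ _).symm
        rw [RingHom.id_apply, ← Submodule.Quotient.mk_smul, h]
        exact hmk _ _ (by rw [map_mul, ht, ht, Algebra.smul_def]) }
  refine (hgen.of_retract i (Submodule.liftQ _ (Algebra.linearMap S L) hker) ?_).of_scalarTower
  ext l
  change algebraMap S L (t l * (1 - e)) = l
  rw [map_mul, ht, map_sub, he, map_one, sub_zero, mul_one]

variable (L : Type*) [CommRing L] [Algebra k L] [Algebra A L] [IsScalarTower k A L]

/-- Over a localization, the diagonal elements divide elements of the diagonal ideal. -/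
lemma exists_unit_mul_of_isLocalization (f : A) [IsLocalization.Away f L] (l : L) :
    ∃ (v : (L ⊗[k] L)ˣ) (x : A ⊗[k] A), x ∈ KaehlerDifferential.ideal k A ∧
      Algebra.TensorProduct.map (IsScalarTower.toAlgHom k A L) (IsScalarTower.toAlgHom k A L) x =
        v * ((1 : L) ⊗ₜ[k] l - l ⊗ₜ[k] (1 : L)) := by
  obtain ⟨m, a, ha⟩ := IsLocalization.Away.surj f l
  have hu : IsUnit (algebraMap A L f ^ m) := (IsLocalization.Away.algebraMap_isUnit f).pow m
  have hv : IsUnit ((algebraMap A L f ^ m) ⊗ₜ[k] (algebraMap A L f ^ m)) := by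
    have := (hu.map (Algebra.TensorProduct.includeLeft (R := k) (S := k) (A := L) (B := L))).mul
      (hu.map (Algebra.TensorProduct.includeRight (R := k) (A := L) (B := L)))
    simpa using this
  obtain ⟨v, hv⟩ := hv
  -- With a = f^m l in L, this is (f^m ⊗ f^m)(1 ⊗ l - l ⊗ 1).
  refine ⟨v, (f ^ m) ⊗ₜ[k] a - a ⊗ₜ[k] (f ^ m), ?_, ?_⟩
  · rw [KaehlerDifferential.ideal, RingHom.mem_ker, map_sub]
    simp [mul_comm]
  · rw [hv, map_sub, Algebra.TensorProduct.map_tmul, Algebra.TensorProduct.map_tmul, mul_sub,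
      Algebra.TensorProduct.tmul_mul_tmul, Algebra.TensorProduct.tmul_mul_tmul,
      IsScalarTower.toAlgHom_apply, IsScalarTower.toAlgHom_apply, ← ha, map_pow, mul_one,
      mul_comm l]

/-- Apply the preceding criterion with S = L ⊗ L, which is flat over A ⊗ A because L is flat over A,
and with the diagonal elements of the étale coordinates. -/
lemma homologyGenBy_chart (f : A) [IsLocalization.Away f L] [Algebra.FiniteType k L]
    {σ : Type*} [Finite σ] [Algebra (MvPolynomial σ k) L] [IsScalarTower k (MvPolynomial σ k) L]
    [Algebra.Etale (MvPolynomial σ k) L] [Algebra (A ⊗[k] A) L]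
    (hL : ∀ a b : A, algebraMap (A ⊗[k] A) L (a ⊗ₜ b) = algebraMap A L (a * b)) (n : ℕ) :
    HomologyGenBy (barDiff k A) L L n ((Nat.card σ).choose n) := by
  have := Fintype.ofFinite σ
  let φ : A ⊗[k] A →ₐ[k] L ⊗[k] L :=
    Algebra.TensorProduct.map (IsScalarTower.toAlgHom k A L) (IsScalarTower.toAlgHom k A L)
  have hflatL : Module.Flat A L := IsLocalization.flat L (Submonoid.powers f)
  have hflat : φ.toRingHom.Flat :=
    RingHom.Flat.tensorProductMap (f := IsScalarTower.toAlgHom k A L)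
      (g := IsScalarTower.toAlgHom k A L) (RingHom.flat_algebraMap_iff.2 hflatL)
      (RingHom.flat_algebraMap_iff.2 hflatL)
  let μ : L ⊗[k] L →ₐ[k] L := Algebra.TensorProduct.lmul' k
  have htower : ∀ r, algebraMap (A ⊗[k] A) L r = μ (φ r) := fun r => by
    induction r with
    | zero => simp
    | tmul a b =>
      rw [hL, map_mul]
      exact (Algebra.TensorProduct.lmul'_apply_tmul _ _).symm
    | add x y hx hy => simp only [map_add, hx, hy]
  let l : List σ := (Finset.univ : Finset σ).toList
  obtain ⟨e, he, hI⟩ := exists_projector k L (l := l) (fun i => by simp [l])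
  have hlen : (l.map (diagonalElement k L)).length = Nat.card σ := by
    rw [List.length_map, Finset.length_toList, Finset.card_univ, Nat.card_eq_fintype_card]
  have hreg := isWeaklyRegular_diagonalElement k L (Finset.nodup_toList (Finset.univ : Finset σ))
  let _ : Algebra (A ⊗[k] A) (L ⊗[k] L) := φ.toRingHom.toAlgebra
  let _ : Algebra (L ⊗[k] L) L := μ.toRingHom.toAlgebra
  rw [← hlen]
  refine homologyGenBy_of_isWeaklyRegular (S := L ⊗[k] L) hflat htower
    (fun x => ⟨x ⊗ₜ 1, ?_⟩) hreg (fun r hr => ?_) he (fun r hr => ?_) hI n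
  · change Algebra.TensorProduct.lmul' k (x ⊗ₜ[k] (1 : L)) = x
    rw [Algebra.TensorProduct.lmul'_apply_tmul, mul_one]
  · obtain ⟨i, -, rfl⟩ := List.mem_map.1 hr
    exact exists_unit_mul_of_isLocalization L f (coordinate k L i)
  · obtain ⟨i, -, rfl⟩ := List.mem_map.1 hr
    exact diagonalElement_mem k L i

end Chart

/-! ### Comparison of the bar complex with the Hochschild complex -/

section Wrap

variable (k : Type*) [Field k] (A : Type*) [CommRing A] [Algebra k A]

/-- `(a_0, …, a_{n+1}) ↦ (a_{n+1} a_0, a_1, …, a_n)`. -/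
def wrap (n : ℕ) : Word k A (n + 1) →ₗ[k] Word k A n := merge k 0 ∘ₗ rotate k 1

variable {k A}

lemma wrap_snoc (b : A) {n : ℕ} (x : Word k A n) : wrap k A n (snoc k b x) = mulFirst k b x := by
  rw [wrap, LinearMap.comp_apply]
  exact congrArg _ (LinearMap.congr_fun (rotate_one_snoc b) x)

lemma wrap_mulFirst_mulLast (a b : A) {n : ℕ} (x : Word k A (n + 1)) :
    wrap k A n (mulFirst k a (mulLast k b x)) = mulFirst k (a * b) (wrap k A n x) := by
  have : wrap k A n ∘ₗ mulFirst k a ∘ₗ mulLast k b = mulFirst k (a * b) ∘ₗ wrap k A n := by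
    refine word_ext_snoc fun c y => ?_
    simp only [LinearMap.comp_apply, mulLast_snoc, mulFirst_snoc, wrap_snoc, mulFirst_mulFirst]
    congr 2
    ring
  exact LinearMap.congr_fun this x

lemma cyc_eq_wrap {n : ℕ} (x : Word k A (n + 1)) :
    cyc k A n x = bar k A n x + (-1 : k) ^ (n + 1) • wrap k A n x := by
  rw [cyc_eq, tau_apply, map_smul]
  rfl

/-- Gluing the two outer letters is the passage from the bar resolution to its coinvariants, and
there the two outer faces become the first and the wrapping face of the cyclic differential. -/
lemma wrap_bar {n : ℕ} (x : Word k A (n + 2)) :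
    wrap k A n (bar k A (n + 1) x) = cyc k A n (wrap k A (n + 1) x) := by
  have : wrap k A n ∘ₗ bar k A (n + 1) = cyc k A n ∘ₗ wrap k A (n + 1) := by
    refine word_ext_snoc fun b y => ?_
    have h := wrap_mulFirst_mulLast 1 b y
    have h' := wrap_mulFirst_mulLast b 1 y
    rw [mulFirst_one, one_mul] at h
    rw [mulLast_one, mul_one] at h'
    simp only [LinearMap.comp_apply]
    rw [bar_snoc, map_add, map_smul, wrap_snoc, wrap_snoc, h, cyc_eq_wrap, bar_mulFirst, h']
  exact LinearMap.congr_fun this x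

end Wrap

section Pairing

variable {k : Type*} [Field k] {A : Type*} [CommRing A] [Algebra k A]

variable (k A) in
/-- The identification of words with the terms of the bar resolution. -/
def toBar (n : ℕ) : Word k A (n + 1) →ₗ[k] Bar k A n :=
  (LinearMap.id : Word k A (n + 1) →ₗ[k] Word k A (n + 1))

lemma tmul_smul_toBar (a b : A) {n : ℕ} (x : Word k A (n + 1)) :
    (a ⊗ₜ[k] b) • toBar k A n x = toBar k A n (mulFirst k a (mulLast k b x)) :=
  tmul_smul_bar a b _

lemma barDiff_toBar {n : ℕ} (x : Word k A (n + 2)) :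
    barDiff k A n (toBar k A (n + 1) x) = toBar k A n (bar k A (n + 1) x) := rfl

variable {L : Type*} [CommRing L] [Algebra (A ⊗[k] A) L]

variable (L) in
/-- The class of `(a_0, …, a_n)` is the class of `1 ⊗ (a_0, …, a_n, 1)`. -/
def unwrap (n : ℕ) : Word k A n →+ L ⊗[A ⊗[k] A] Bar k A n :=
  (TensorProduct.mk (A ⊗[k] A) L (Bar k A n) 1).toAddMonoidHom.comp
    (toBar k A n ∘ₗ snoc k 1).toAddMonoidHom

lemma unwrap_apply {n : ℕ} (x : Word k A n) :
    unwrap L n x = (1 : L) ⊗ₜ[A ⊗[k] A] toBar k A n (snoc k 1 x) := rfl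

variable [Algebra A L]

/-- Over L the two outer letters act through their product, so the last letter can be moved to the
front and replaced by 1. -/
lemma one_tmul_toBar
    (hL : ∀ a b : A, algebraMap (A ⊗[k] A) L (a ⊗ₜ b) = algebraMap A L (a * b))
    {n : ℕ} (x : Word k A (n + 1)) :
    (1 : L) ⊗ₜ[A ⊗[k] A] toBar k A n x = unwrap L n (wrap k A n x) := by
  let f : Word k A (n + 1) →+ L ⊗[A ⊗[k] A] Bar k A n :=
    (TensorProduct.mk (A ⊗[k] A) L (Bar k A n) 1).toAddMonoidHom.comp
      (toBar k A n).toAddMonoidHom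
  have hsnoc : ∀ (b : A) (y : Word k A n), f (snoc k b y) = unwrap L n (wrap k A n (snoc k b y)) := by
    intro b y
    have h1 : snoc k b y = mulFirst k 1 (mulLast k b (snoc k 1 y)) := by
      rw [mulFirst_one, mulLast_snoc, one_mul]
    have h2 : snoc k 1 (mulFirst k b y) = mulFirst k b (mulLast k 1 (snoc k 1 y)) := by
      rw [mulLast_one, mulFirst_snoc]
    rw [wrap_snoc, unwrap_apply, h2, ← tmul_smul_toBar]
    change (1 : L) ⊗ₜ[A ⊗[k] A] toBar k A n (snoc k b y) = _
    rw [h1, ← tmul_smul_toBar, TensorProduct.tmul_smul, TensorProduct.tmul_smul,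
      TensorProduct.smul_tmul', TensorProduct.smul_tmul', Algebra.smul_def, Algebra.smul_def, hL, hL,
      mul_comm b]
  change f x = _
  -- The maps compared are only additive; the scalar in front of a word is absorbed into the word
  -- itself.
  have hx : x ∈ Submodule.span k (Set.range (PiTensorProduct.tprod k (s := fun _ : Fin (n + 2) => A))) := by
    rw [PiTensorProduct.span_tprod_eq_top]; trivial
  induction hx using Submodule.closure_induction with
  | zero => simp only [map_zero]
  | add x y _ _ hx hy => simp only [map_add, hx, hy]
  | smul_mem r x hx =>
    obtain ⟨a, rfl⟩ := hx
    obtain ⟨b, rfl⟩ := exists_eq_val a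
    change f (r • word k (n + 1) b) = unwrap L n (wrap k A n (r • word k (n + 1) b))
    rw [word_succ_snoc, ← map_smul, hsnoc]

lemma tensorDiff_unwrap
    (hL : ∀ a b : A, algebraMap (A ⊗[k] A) L (a ⊗ₜ b) = algebraMap A L (a * b))
    {n : ℕ} (x : Word k A (n + 1)) :
    tensorDiff (barDiff k A) L L n (unwrap L (n + 1) x) = unwrap L n (cyc k A n x) := by
  change (1 : L) ⊗ₜ[A ⊗[k] A] barDiff k A n (toBar k A (n + 1) (snoc k 1 x)) = _
  rw [barDiff_toBar, bar_snoc, mulLast_one, map_add, TensorProduct.tmul_add,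
    one_tmul_toBar hL, one_tmul_toBar hL, wrap_snoc, mulFirst_one, map_smul, cyc_eq_wrap, map_add]

lemma unwrap_mulFirst
    (hL : ∀ a b : A, algebraMap (A ⊗[k] A) L (a ⊗ₜ b) = algebraMap A L (a * b))
    (a : A) {n : ℕ} (x : Word k A n) :
    unwrap L n (mulFirst k a x) = algebraMap A L a • unwrap L n x := by
  have h : snoc k 1 (mulFirst k a x) = mulFirst k a (mulLast k 1 (snoc k 1 x)) := by
    rw [mulLast_one, mulFirst_snoc]
  rw [unwrap_apply, h, ← tmul_smul_toBar, TensorProduct.tmul_smul, ← algebraMap_smul L, hL, mul_one]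
  rfl

section Lift

variable {N : Type*} [AddCommGroup N] [Module L N]

/-- The map `l ⊗ w ↦ l • g (wrap w)`. -/
def wrapLift
    (hL : ∀ a b : A, algebraMap (A ⊗[k] A) L (a ⊗ₜ b) = algebraMap A L (a * b)) (n : ℕ)
    (g : Word k A n →+ N) (hg : ∀ a x, g (mulFirst k a x) = algebraMap A L a • g x) :
    L ⊗[A ⊗[k] A] Bar k A n →+ N :=
  TensorProduct.liftAddHom
    ((AddMonoidHom.compHom' (g.comp (wrap k A n).toAddMonoidHom)).comp (smulAddHom L N)) <| by
    intro r l x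
    change (r • l) • g (wrap k A n x) = l • g (wrap k A n (r • x : Bar k A n))
    let h : Bar k A n →+ N := g.comp (wrap k A n).toAddMonoidHom
    change (r • l) • h x = l • h (r • x)
    induction r with
    | zero => simp only [zero_smul, map_zero, smul_zero]
    | tmul a b =>
      have hx : h ((a ⊗ₜ[k] b) • x) = algebraMap A L (a * b) • h x :=
        (congrArg h (tmul_smul_bar a b x)).trans
          ((congrArg g (wrap_mulFirst_mulLast a b x)).trans (hg _ _))
      rw [hx, Algebra.smul_def, hL, smul_smul, mul_comm]
    | add r s hr hs => simp only [add_smul, map_add, smul_add, hr, hs]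

variable (hL : ∀ a b : A, algebraMap (A ⊗[k] A) L (a ⊗ₜ b) = algebraMap A L (a * b)) {n : ℕ}
    (g : Word k A n →+ N) (hg : ∀ a x, g (mulFirst k a x) = algebraMap A L a • g x)

lemma wrapLift_tmul (l : L) (x : Word k A (n + 1)) :
    wrapLift hL n g hg (l ⊗ₜ toBar k A n x) = l • g (wrap k A n x) := rfl

lemma wrapLift_smul (l : L) (z : L ⊗[A ⊗[k] A] Bar k A n) :
    wrapLift hL n g hg (l • z) = l • wrapLift hL n g hg z := by
  induction z with
  | zero => simp only [smul_zero, map_zero]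
  | tmul m x =>
    rw [TensorProduct.smul_tmul']
    exact mul_smul l m _
  | add x y hx hy => simp only [smul_add, map_add, hx, hy]

lemma wrapLift_unwrap (x : Word k A n) : wrapLift hL n g hg (unwrap L n x) = g x := by
  rw [unwrap_apply, wrapLift_tmul, wrap_snoc, mulFirst_one, one_smul]

lemma wrapLift_tensorDiff (h0 : ∀ x, g (cyc k A n x) = 0) (z : L ⊗[A ⊗[k] A] Bar k A (n + 1)) :
    wrapLift hL n g hg (tensorDiff (barDiff k A) L L n z) = 0 := by
  induction z with
  | zero => simp only [map_zero]
  | tmul l x =>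
    refine (wrapLift_tmul hL g hg l (bar k A (n + 1) x)).trans ?_
    exact (congrArg (fun y => l • g y) (wrap_bar (k := k) (n := n) x)).trans
      ((congrArg (l • ·) (h0 _)).trans (smul_zero l))
  | add x y hx hy => simp only [map_add, hx, hy, add_zero]

end Lift

end Pairing

/-! ### Injectivity of the Hochschild-Kostant-Rosenberg map -/

section Orzech

variable {L : Type*} [CommRing L] {T N : Type*} [AddCommGroup T] [Module L T]
  [AddCommGroup N] [Module L N]

/-- A surjection of a module with at most `c` generators onto a free module of rank `c` is
injective. -/
lemma mem_of_surjective_of_card_le {ι : Type*} [Finite ι] (b : Module.Basis ι L N)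
    {Z D : Submodule L T} (κ : T →ₗ[L] N) (hκ : ∀ w ∈ D, κ w = 0) (hZ : ∀ η, ∃ u ∈ Z, κ u = η)
    {s : Finset T} (hs : s.card ≤ Nat.card ι) (hsg : Z ≤ Submodule.span L s ⊔ D) {z : T}
    (hz : z ∈ Z) (h0 : κ z = 0) : z ∈ D := by
  let c : (s →₀ L) →ₗ[L] T := Finsupp.linearCombination L Subtype.val
  have hdecomp : ∀ u ∈ Z, ∃ v : s →₀ L, u - c v ∈ D := by
    intro u hu
    obtain ⟨a, ha, w, hw, rfl⟩ := Submodule.mem_sup.1 (hsg hu)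
    obtain ⟨v, rfl⟩ := (Finsupp.mem_span_iff_linearCombination L _ _).1 ha
    refine ⟨v, ?_⟩
    change c v + w - c v ∈ D
    rwa [add_sub_cancel_left]
  have hκ0 : ∀ u v, u - c v ∈ D → κ u = (κ ∘ₗ c) v := by
    intro u v hw
    have := hκ _ hw
    rwa [map_sub, sub_eq_zero] at this
  have hg : Function.Surjective (κ ∘ₗ c) := by
    intro η
    obtain ⟨u, hu, rfl⟩ := hZ η
    obtain ⟨v, hv⟩ := hdecomp u hu
    exact ⟨v, (hκ0 u v hv).symm⟩
  have := Fintype.ofFinite ι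
  -- An embedding of the generators into the basis makes the free module on `s` a submodule of N; a
  -- surjection from a submodule of a finitely generated module onto that module is injective.
  obtain ⟨j⟩ : Nonempty (s ↪ ι) := Function.Embedding.nonempty_of_card_le (by
    rwa [Fintype.card_coe, ← Nat.card_eq_fintype_card])
  have : Module.Finite L N := Module.Finite.of_basis b
  have hginj : Function.Injective (κ ∘ₗ c) := OrzechProperty.injective_of_surjective_of_injective
    (b.repr.symm.toLinearMap ∘ₗ Finsupp.lmapDomain L L j) (κ ∘ₗ c)
    (b.repr.symm.injective.comp (Finsupp.mapDomain_injective j.injective)) hg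
  obtain ⟨v, hv⟩ := hdecomp z hz
  have hgv : (κ ∘ₗ c) v = (κ ∘ₗ c) 0 := by rw [map_zero, ← hκ0 z v hv, h0]
  rwa [hginj hgv, map_zero, sub_zero] at hv

end Orzech

section Unwrap

variable {k : Type*} [Field k] {A : Type*} [CommRing A] [Algebra k A]
  {L : Type*} [CommRing L] [Algebra A L] [Algebra (A ⊗[k] A) L]

lemma unwrap_mem_tensorCycles
    (hL : ∀ a b : A, algebraMap (A ⊗[k] A) L (a ⊗ₜ b) = algebraMap A L (a * b)) {n : ℕ}
    {x : Word k A n} (hx : IsCycle (fun n => (cyc k A n).toAddMonoidHom) n x) :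
    unwrap L n x ∈ tensorCycles (barDiff k A) L L n := by
  cases n with
  | zero => trivial
  | succ n =>
    have hx' : cyc k A n x = 0 := hx
    change tensorDiff (barDiff k A) L L n _ = 0
    rw [tensorDiff_unwrap hL, hx', map_zero]

end Unwrap

/-! ### Forms and Hochschild homology over an étale chart -/

section FormsMap

variable (k : Type*) [Field k] (A : Type*) [CommRing A] [Algebra k A]
  (L : Type*) [CommRing L] [Algebra k L] [Algebra A L] [IsScalarTower k A L]

/-- The pullback of forms. -/
def formsMap : Forms k A →ₐ[A] Forms k L :=
  ExteriorAlgebra.lift A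
    ⟨(ExteriorAlgebra.ι L).restrictScalars A ∘ₗ KaehlerDifferential.map k k A L,
      fun _ => ExteriorAlgebra.ι_sq_zero _⟩

variable {k A}

lemma formsMap_algebraMap_mul (a : A) (ω : Forms k A) :
    formsMap k A L (algebraMap A (Forms k A) a * ω) = algebraMap A L a • formsMap k A L ω := by
  rw [map_mul, AlgHom.commutes, IsScalarTower.algebraMap_apply A L (Forms k L), ← Algebra.smul_def]

lemma formsMap_dForm (a : A) : formsMap k A L (dForm k a) = dForm k (algebraMap A L a) := by
  refine (ExteriorAlgebra.lift_ι_apply A _ _ _).trans ?_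
  exact congrArg (ExteriorAlgebra.ι L) (KaehlerDifferential.map_D k k A L a)

lemma formsMap_prod (l : List A) :
    formsMap k A L (l.map (dForm k)).prod = ((l.map (algebraMap A L)).map (dForm k)).prod := by
  rw [map_list_prod, List.map_map, List.map_map]
  exact congrArg List.prod (List.map_congr_left fun a _ => formsMap_dForm L a)

lemma formsMap_mem {p : ℕ} {ω : Forms k A} (hω : ω ∈ formDegree k A p) :
    formsMap k A L ω ∈ formDegree k L p := by
  refine formDegree_induction (P := fun ω => formsMap k A L ω ∈ formDegree k L p) ?_
    (fun x y hx hy => ?_) (fun a l hl => ?_) hω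
  · rw [map_zero]; exact zero_mem _
  · rw [map_add]; exact add_mem hx hy
  · rw [formsMap_algebraMap_mul, formsMap_prod, Algebra.smul_def]
    have h := prod_mem (k := k) (l.map (algebraMap A L))
    rw [List.length_map, hl] at h
    exact algebraMap_mul_mem _ h

/-- The pullback of the form attached to a word. -/
def kapMap (n : ℕ) : Word k A n →+ Forms k L :=
  (formsMap k A L).toRingHom.toAddMonoidHom.comp (kap k A n).toAddMonoidHom

lemma kapMap_apply {n : ℕ} (x : Word k A n) : kapMap L n x = formsMap k A L (kap k A n x) := rfl

lemma kapMap_mulFirst {n : ℕ} (a : A) (x : Word k A n) :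
    kapMap L n (mulFirst k a x) = algebraMap A L a • kapMap L n x := by
  rw [kapMap_apply, kap_mulFirst, formsMap_algebraMap_mul]
  rfl

variable {L} [Algebra (A ⊗[k] A) L]
  (hL : ∀ a b : A, algebraMap (A ⊗[k] A) L (a ⊗ₜ b) = algebraMap A L (a * b))

/-- Over a localization of `A`, every form is the image of a cycle. -/
lemma exists_cycle_wrapLift [CharZero k] (f : A) [IsLocalization.Away f L] {n : ℕ} {η : Forms k L}
    (hη : η ∈ formDegree k L n) : ∃ u ∈ tensorCycles (barDiff k A) L L n,
      wrapLift hL n (kapMap L n) (kapMap_mulFirst L) u = η := by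
  rw [mem_formDegree_iff, ← exteriorPower.ιMulti_span_fixedDegree_of_span_eq_top L n _
    (KaehlerDifferential.span_range_map_derivation_of_isLocalization k A L (Submonoid.powers f))]
    at hη
  induction hη using Submodule.span_induction with
  | zero => exact ⟨0, zero_mem _, map_zero _⟩
  | add x y _ _ hx hy =>
    obtain ⟨u, hu, rfl⟩ := hx
    obtain ⟨v, hv, rfl⟩ := hy
    exact ⟨u + v, add_mem hu hv, map_add _ _ _⟩
  | smul l x _ hx =>
    obtain ⟨u, hu, rfl⟩ := hx
    exact ⟨l • u, Submodule.smul_mem _ l hu, wrapLift_smul _ _ _ _ _⟩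
  | mem x hx =>
    obtain ⟨v, hv, rfl⟩ := hx
    choose b hb using fun i => hv (Set.mem_range_self i)
    have hmem := prod_mem (k := k) (List.ofFn b)
    rw [List.length_ofFn] at hmem
    obtain ⟨z, hz, hzω⟩ := exists_cycle_hkrWord hmem
    have hn : (n.factorial : k) ≠ 0 := Nat.cast_ne_zero.2 n.factorial_ne_zero
    -- The cycle z was normalized for `hkrWord`, which is 1/n! times `kap`; the factor passes from
    -- one normalization to the other.
    refine ⟨algebraMap k L (1 / (n.factorial : k)) • unwrap L n z,
      Submodule.smul_mem _ _ (unwrap_mem_tensorCycles hL hz), ?_⟩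
    rw [wrapLift_smul, wrapLift_unwrap, IsScalarTower.algebraMap_apply k A L, kapMap_apply,
      ← formsMap_algebraMap_mul, ← IsScalarTower.algebraMap_apply k A (Forms k A),
      ← Algebra.smul_def]
    rw [hkrWord_eq, LinearMap.smul_apply] at hzω
    rw [hzω, formsMap_prod, List.map_ofFn, List.map_ofFn, ExteriorAlgebra.ιMulti_apply]
    congr 2
    funext i
    refine congrArg (ExteriorAlgebra.ι L) ?_
    rw [← hb i]
    exact (KaehlerDifferential.map_D k k A L (b i)).symm

lemma wrapLift_kapMap_mem {n : ℕ} (z : L ⊗[A ⊗[k] A] Bar k A n) :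
    wrapLift hL n (kapMap L n) (kapMap_mulFirst L) z ∈ ⋀[L]^n (KaehlerDifferential k L) := by
  induction z with
  | zero => rw [map_zero]; exact zero_mem _
  | tmul l x =>
    have h := formsMap_mem L (kap_mem (wrap k A n x))
    rw [mem_formDegree_iff] at h
    have h2 : wrapLift hL n (kapMap L n) (kapMap_mulFirst L) (l ⊗ₜ x) =
        l • formsMap k A L (kap k A n (wrap k A n x)) :=
      wrapLift_tmul hL (kapMap L n) (kapMap_mulFirst L) l x
    rw [h2]
    exact Submodule.smul_mem _ l h
  | add x y hx hy => rw [map_add]; exact add_mem hx hy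

/-- The map to forms induced by `kap`. -/
def kapLift (n : ℕ) : L ⊗[A ⊗[k] A] Bar k A n →ₗ[L] ⋀[L]^n (KaehlerDifferential k L) where
  toFun z := ⟨wrapLift hL n (kapMap L n) (kapMap_mulFirst L) z, wrapLift_kapMap_mem hL z⟩
  map_add' x y := Subtype.ext (map_add (wrapLift hL n (kapMap L n) (kapMap_mulFirst L)) x y)
  map_smul' l x := Subtype.ext (wrapLift_smul hL (kapMap L n) (kapMap_mulFirst L) l x)

lemma kapLift_unwrap {n : ℕ} (x : Word k A n) :
    (kapLift hL n (unwrap L n x) : Forms k L) = formsMap k A L (kap k A n x) :=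
  wrapLift_unwrap hL (kapMap L n) (kapMap_mulFirst L) x

lemma kapLift_tensorDiff {n : ℕ} (w : L ⊗[A ⊗[k] A] Bar k A (n + 1)) :
    kapLift hL n (tensorDiff (barDiff k A) L L n w) = 0 :=
  Subtype.ext (wrapLift_tensorDiff hL (kapMap L n) (kapMap_mulFirst L)
    (fun x => by rw [kapMap_apply, kap_cyc, map_zero]) w)

/-- The cycles in degree n are generated by (d choose n) elements modulo boundaries and map onto
forms of degree n, a free module of that rank; the Orzech argument leaves no kernel. -/
lemma mem_tensorBoundaries_of_kapLift_eq_zero [CharZero k] (f : A) [IsLocalization.Away f L]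
    [Algebra.FiniteType k L]
    {σ : Type*} [Finite σ] [Algebra (MvPolynomial σ k) L] [IsScalarTower k (MvPolynomial σ k) L]
    [Algebra.Etale (MvPolynomial σ k) L] {n : ℕ} {z : L ⊗[A ⊗[k] A] Bar k A n}
    (hz : z ∈ tensorCycles (barDiff k A) L L n) (h0 : kapLift hL n z = 0) :
    z ∈ tensorBoundaries (barDiff k A) L L n := by
  obtain ⟨s, hs, _, hsg⟩ := homologyGenBy_chart L f (σ := σ) hL n
  classical
  -- An order on the coordinates is needed only to index the basis of the exterior power by subsets.
  let _ : LinearOrder σ := linearOrderOfSTO WellOrderingRel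
  rw [← Set.powersetCard.card] at hs
  refine mem_of_surjective_of_card_le ((coordinateBasis k L (σ := σ)).exteriorPower n)
    (kapLift hL n) ?_ (fun η => ?_) hs hsg hz h0
  · rintro _ ⟨w, rfl⟩
    exact kapLift_tensorDiff hL w
  · obtain ⟨u, hu, huη⟩ := exists_cycle_wrapLift hL f (n := n) (η := η.1) η.2
    exact ⟨u, hu, Subtype.ext huη⟩

end FormsMap

/-! ### Clearing denominators -/

section Local

variable {k : Type*} [Field k] {A : Type*} [CommRing A] [Algebra k A]

variable (k A) in
/-- The words `A^{⊗ (n+1)}`, as a module over `A` acting on the first letter. -/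
def FirstModule (n : ℕ) : Type _ := Word k A n

instance (n : ℕ) : AddCommGroup (FirstModule k A n) := inferInstanceAs (AddCommGroup (Word k A n))

instance (n : ℕ) : Module A (FirstModule k A n) :=
  Module.compHom (Word k A n) (firstAction k A n).toRingHom

variable (k) in
/-- Hochschild chains over a localization of `A`. -/
def localizedWord (f : A) (n : ℕ) :
    Word k A n →+ LocalizedModule (Submonoid.powers f) (FirstModule k A n) :=
  (LocalizedModule.mkLinearMap (Submonoid.powers f) (FirstModule k A n)).toAddMonoidHom

lemma localizedWord_mulFirst (f a : A) {n : ℕ} (x : Word k A n) :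
    localizedWord k f n (mulFirst k a x) =
      algebraMap A (Localization.Away f) a • localizedWord k f n x := by
  rw [algebraMap_smul]
  exact (LocalizedModule.mkLinearMap (Submonoid.powers f) (FirstModule k A n)).map_smul a x

lemma exists_pow_mulFirst_eq {f : A} {n : ℕ} {x y : Word k A n}
    (h : localizedWord k f n x = localizedWord k f n y) :
    ∃ m : ℕ, mulFirst k (f ^ m) x = mulFirst k (f ^ m) y := by
  obtain ⟨⟨_, m, rfl⟩, hm⟩ := (IsLocalizedModule.eq_iff_exists (Submonoid.powers f)
    (LocalizedModule.mkLinearMap (Submonoid.powers f) (FirstModule k A n))).1 h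
  exact ⟨m, hm⟩

variable {f : A} [Algebra (A ⊗[k] A) (Localization.Away f)]

lemma exists_pow_smul_eq_unwrap
    (hL : ∀ a b : A, algebraMap (A ⊗[k] A) (Localization.Away f) (a ⊗ₜ b) =
      algebraMap A (Localization.Away f) (a * b)) {n : ℕ}
    (z : Localization.Away f ⊗[A ⊗[k] A] Bar k A n) :
    ∃ (m : ℕ) (x : Word k A n),
      algebraMap A (Localization.Away f) (f ^ m) • z = unwrap (Localization.Away f) n x := by
  induction z with
  | zero => exact ⟨0, 0, by rw [smul_zero, map_zero]⟩
  | tmul l w =>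
    obtain ⟨m, a, ha⟩ := IsLocalization.Away.surj f l
    refine ⟨m, mulFirst k a (wrap k A n w), ?_⟩
    have hw : unwrap (Localization.Away f) n (wrap k A n w) = 1 ⊗ₜ w := (one_tmul_toBar hL _).symm
    rw [unwrap_mulFirst hL, hw, TensorProduct.smul_tmul', TensorProduct.smul_tmul',
      smul_eq_mul, smul_eq_mul, map_pow, mul_comm, ha, mul_one]
  | add z w hz hw =>
    obtain ⟨m, x, hx⟩ := hz
    obtain ⟨m', y, hy⟩ := hw
    refine ⟨m + m', mulFirst k (f ^ m') x + mulFirst k (f ^ m) y, ?_⟩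
    rw [map_add, unwrap_mulFirst hL, unwrap_mulFirst hL, ← hx, ← hy, smul_smul, smul_smul,
      ← map_mul, ← map_mul, ← pow_add, ← pow_add, smul_add, add_comm m' m]

/-- A power of f clears the denominators of the bounding chain, giving an equality over the
localization; a second power makes it an equality of words. -/
lemma exists_cyc_eq_of_unwrap_mem
    (hL : ∀ a b : A, algebraMap (A ⊗[k] A) (Localization.Away f) (a ⊗ₜ b) =
      algebraMap A (Localization.Away f) (a * b)) {n : ℕ} {x : Word k A n}
    (hx : unwrap (Localization.Away f) n x ∈
      tensorBoundaries (barDiff k A) (Localization.Away f) (Localization.Away f) n) :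
    ∃ (m : ℕ) (y : Word k A (n + 1)), cyc k A n y = mulFirst k (f ^ m) x := by
  obtain ⟨w, hw⟩ := hx
  obtain ⟨m, y, hy⟩ := exists_pow_smul_eq_unwrap hL w
  have h : unwrap (Localization.Away f) n (mulFirst k (f ^ m) x) =
      unwrap (Localization.Away f) n (cyc k A n y) := by
    rw [unwrap_mulFirst hL, ← hw, ← tensorDiff_unwrap hL, ← hy, map_smul]
  -- Mapping to the localized module of words undoes `unwrap`, and equality there is equality after
  -- multiplication by a power of f.
  have h2 := congrArg (wrapLift hL n (localizedWord k f n)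
    fun a x => localizedWord_mulFirst f a x) h
  rw [wrapLift_unwrap, wrapLift_unwrap] at h2
  obtain ⟨m', h3⟩ := exists_pow_mulFirst_eq h2
  refine ⟨m' + m, mulFirst k (f ^ m') y, ?_⟩
  rw [pow_add, ← mulFirst_mulFirst, h3, cyc_mulFirst]

end Local

/-! ### From local to global -/

section Global

variable {k : Type*} [Field k] [CharZero k] {A : Type*} [CommRing A] [Algebra k A]

/-- Near every prime, a cycle in the kernel of the Hochschild-Kostant-Rosenberg map is a
boundary. -/
lemma exists_cyc_eq_mulFirst_pow [Algebra.Smooth k A] (p : Ideal A) [p.IsPrime] {n : ℕ}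
    {z : Word k A n} (hz : IsCycle (fun n => (cyc k A n).toAddMonoidHom) n z)
    (h0 : kap k A n z = 0) :
    ∃ f ∉ p, ∃ (m : ℕ) (y : Word k A (n + 1)), cyc k A n y = mulFirst k (f ^ m) z := by
  -- A smooth algebra is étale over an affine space near each prime; this supplies the chart.
  obtain ⟨f, hf, d, _, _, _⟩ :=
    Algebra.IsSmoothAt.exists_isStandardEtale_mvPolynomial (R := k) (p := p)
  refine ⟨f, hf, ?_⟩
  have : Algebra.FiniteType k (Localization.Away f) :=
    Algebra.FiniteType.trans (S := A) inferInstance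
      (IsLocalization.finiteType_of_monoid_fg (Submonoid.powers f) _)
  let _ : Algebra (A ⊗[k] A) (Localization.Away f) :=
    ((algebraMap A (Localization.Away f)).comp
      (Algebra.TensorProduct.lmul' k (S := A)).toRingHom).toAlgebra
  have hL : ∀ a b : A, algebraMap (A ⊗[k] A) (Localization.Away f) (a ⊗ₜ b) =
      algebraMap A (Localization.Away f) (a * b) := fun a b =>
    congrArg (algebraMap A (Localization.Away f)) (Algebra.TensorProduct.lmul'_apply_tmul a b)
  refine exists_cyc_eq_of_unwrap_mem hL (mem_tensorBoundaries_of_kapLift_eq_zero hL f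
    (σ := Fin d) (unwrap_mem_tensorCycles hL hz) (Subtype.ext ?_))
  rw [kapLift_unwrap, h0, map_zero]
  rfl

/-- The elements a for which a·z is a boundary form an ideal, since the cyclic differential is
linear in the first letter. Near each prime it contains a power of some f outside that prime, so it
lies in no maximal ideal and contains 1. -/
lemma hkrInjective_of_smooth [Algebra.Smooth k A] : HKRInjective k A := by
  intro n z hz h0
  let I : Ideal A :=
    { carrier := {a | ∃ y, cyc k A n y = mulFirst k a z}
      zero_mem' := ⟨0, by
        rw [map_zero]
        exact (LinearMap.congr_fun (firstAction k A n).map_zero z).symm⟩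
      add_mem' := by
        rintro a b ⟨x, hx⟩ ⟨y, hy⟩
        exact ⟨x + y, by
          rw [map_add, hx, hy]
          exact (LinearMap.congr_fun ((firstAction k A n).map_add a b) z).symm⟩
      smul_mem' := by
        rintro a b ⟨x, hx⟩
        exact ⟨mulFirst k a x, by rw [cyc_mulFirst, hx, mulFirst_mulFirst]; rfl⟩ }
  have hI : I = ⊤ := by
    by_contra hI
    obtain ⟨p, hp, hIp⟩ := Ideal.exists_le_maximal I hI
    obtain ⟨f, hf, m, hm⟩ := exists_cyc_eq_mulFirst_pow p hz h0
    exact hf (hp.isPrime.mem_of_pow_mem m (hIp hm))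
  obtain ⟨y, hy⟩ := (Ideal.eq_top_iff_one I).1 hI
  exact ⟨y, hy.trans (mulFirst_one z)⟩

end Global

end HKR

end

open HKR in
theorem proposition3p9 (k : Type*) [Field k] [CharZero k]
    (A : Type*) [CommRing A] [Algebra k A] [Algebra.FiniteType k A] [Algebra.Smooth k A] (W : A) :
    -- both sides are mixed complexes with `u`-connections
    (IsMixedComplex (hochParity k A) (hochb k W) (hochConnes k A) ∧
      IsUConnection (hochb k W) (hochConnes k A) (hochNabla k W)) ∧
    (IsMixedComplex (formParity k A) (twist k W) (deRham k A) ∧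
      IsUConnection (twist k W) (deRham k A) (formNabla k W)) ∧
    -- the map `ε` is a quasi-isomorphism of mixed complexes
    (IsMixedMorphism (hochParity k A) (hochb k W) (hochConnes k A)
        (formParity k A) (twist k W) (deRham k A) (hkr k A) ∧
      IsQuasiIso (hochb k W) (twist k W) (hkr k A)) ∧
    -- weakly compatible with the connections, through the homotopy `H`
    IsWeakMorphism (hochParity k A) (hochb k W) (hochConnes k A) (hochNabla k W)
      (formParity k A) (twist k W) (deRham k A) (formNabla k W) (hkr k A) (hkrHomotopy k W) := by
  have h2 : (2 : k) ≠ 0 := two_ne_zero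
  exact ⟨⟨isMixedComplex_hoch W, isUConnection_hoch W h2⟩,
    ⟨isMixedComplex_forms W, isUConnection_forms W h2⟩,
    ⟨isMixedMorphism_hkr W, isQuasiIso_hkr W hkrInjective_of_smooth⟩, isWeakMorphism_hkr W⟩
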